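/- Let $X$ be a complex manifold of complex dimension $3$ whose underlying smooth manifold is diffeomorphic to the standard sphere $S^6$ (i.e. $S^6$ endowed with a hypothetical complex structure). For $p,q\ge 0$ let $$H^{p,q}_{\overline\partial}(X)=\frac{\{\alpha \text{ a smooth } (p,q)\text{-form on } X:\ \overline\partial\alpha=0\}}{\{\overline\partial\eta:\ \eta \text{ a smooth } (p,q-1)\text{-form on } X\}}$$ be the Dolbeault cohomology of $X$ (the denominator being $0$ if $q=0$), and let $h^{p,q}(X)=\dim_{\mathbb C}H^{p,q}_{\overline\partial}(X)$. Then $X$ has no nonzero holomorphic $3$-forms, that is, $H^0(X;\Omega^3_X)=0$; moreover $h^{3,0}(X)=0$ and $h^{0,3}(X)=0$. -/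

import Mathlib

open scoped Manifold ContDiff

namespace ComplexForms

open Complex

noncomputable section

section Model

variable {E F : Type*} [NormedAddCommGroup E] [NormedSpace ℂ E]
  [NormedAddCommGroup F] [NormedSpace ℂ F]

/-- The conjugate-linear part `v ↦ (L v + i L (i v)) / 2` of a real-linear map `L`. -/
def antilinearPart (L : E →L[ℝ] F) : E →L[ℝ] F :=
  (1 / 2 : ℂ) • (L + I • L.comp (I • ContinuousLinearMap.id ℝ E))

theorem antilinearPart_add (L M : E →L[ℝ] F) :
    antilinearPart (L + M) = antilinearPart L + antilinearPart M := by
  ext v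
  simp only [antilinearPart, ContinuousLinearMap.add_comp, smul_add, add_apply]
  abel

theorem antilinearPart_smul (c : ℂ) (L : E →L[ℝ] F) :
    antilinearPart (c • L) = c • antilinearPart L := by
  ext v
  simp only [antilinearPart, ContinuousLinearMap.smul_comp, smul_add, add_apply, smul_apply,
    smul_smul]
  congr 2 <;> ring

/-- The operator `∂̄` on complex-valued `k`-forms on (an open subset of) the complex vector space
`E`.  In linear coordinates, if `θ = ∑ f_{IJ} dz^I ∧ dz̄^J`, then
`∂̄θ = ∑ ∂̄f_{IJ} ∧ dz^I ∧ dz̄^J`, that is, `∂̄` is the exterior derivative with the derivative of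
the coefficients replaced by its conjugate-linear part. -/
def dbarModel {k : ℕ} (θ : E → E [⋀^Fin k]→L[ℝ] ℂ) (y : E) : E [⋀^Fin (k + 1)]→L[ℝ] ℂ :=
  ContinuousAlternatingMap.alternatizeUncurryFin (antilinearPart (fderiv ℝ θ y))

theorem dbarModel_add {k : ℕ} {θ η : E → E [⋀^Fin k]→L[ℝ] ℂ} {y : E}
    (hf : DifferentiableAt ℝ θ y) (hη : DifferentiableAt ℝ η y) :
    dbarModel (θ + η) y = dbarModel θ y + dbarModel η y := by
  simp only [dbarModel, fderiv_add hf hη, antilinearPart_add,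
    ContinuousAlternatingMap.alternatizeUncurryFin_add]

theorem dbarModel_smul {k : ℕ} (c : ℂ) (θ : E → E [⋀^Fin k]→L[ℝ] ℂ) {y : E}
    (hf : DifferentiableAt ℝ θ y) :
    dbarModel (c • θ) y = c • dbarModel θ y := by
  simp only [dbarModel, fderiv_const_smul hf, antilinearPart_smul]
  ext v
  simp [ContinuousAlternatingMap.alternatizeUncurryFin_apply, Finset.mul_sum]

end Model

section Manifold

variable (E : Type*) [NormedAddCommGroup E] [NormedSpace ℂ E]
variable (X : Type*) [TopologicalSpace X] [ChartedSpace E X]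

/-- (Not necessarily continuous) complex-valued differential `k`-forms: at each point `x`, a
real-multilinear alternating map on the tangent space at `x` with values in `ℂ`, that is, an
element of the `k`-th exterior power of the complexified cotangent space. -/
def CForm (k : ℕ) : Type _ :=
  ∀ x : X, TangentSpace 𝓘(ℂ, E) x [⋀^Fin k]→L[ℝ] ℂ

instance (k : ℕ) : AddCommGroup (CForm E X k) :=
  inferInstanceAs (AddCommGroup (∀ x : X, TangentSpace 𝓘(ℂ, E) x [⋀^Fin k]→L[ℝ] ℂ))

instance (k : ℕ) : Module ℂ (CForm E X k) :=
  inferInstanceAs (Module ℂ (∀ x : X, TangentSpace 𝓘(ℂ, E) x [⋀^Fin k]→L[ℝ] ℂ))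

variable {E X}

/-- The expression of a form in a chart `e`: its pullback under `e.symm`
(meaningful on `e.target`). -/
def CForm.inChart {k : ℕ} (e : OpenPartialHomeomorph X E) (α : CForm E X k) (y : E) :
    E [⋀^Fin k]→L[ℝ] ℂ :=
  (α (e.symm y)).compContinuousLinearMap
    ((mfderiv 𝓘(ℂ, E) 𝓘(ℂ, E) e.symm y : E →L[ℂ] TangentSpace 𝓘(ℂ, E) (e.symm y)).restrictScalars
      ℝ)

theorem CForm.zero_apply {k : ℕ} (x : X) (v : Fin k → TangentSpace 𝓘(ℂ, E) x) :
    (0 : CForm E X k) x v = 0 := rfl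

theorem CForm.add_apply {k : ℕ} (α β : CForm E X k) (x : X)
    (v : Fin k → TangentSpace 𝓘(ℂ, E) x) : (α + β) x v = α x v + β x v := rfl

theorem CForm.smul_apply {k : ℕ} (c : ℂ) (α : CForm E X k) (x : X)
    (v : Fin k → TangentSpace 𝓘(ℂ, E) x) : (c • α) x v = c * α x v := rfl

theorem CForm.inChart_add {k : ℕ} (e : OpenPartialHomeomorph X E) (α β : CForm E X k) :
    (α + β).inChart e = α.inChart e + β.inChart e := rfl

theorem CForm.inChart_smul {k : ℕ} (e : OpenPartialHomeomorph X E) (c : ℂ) (α : CForm E X k) :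
    (c • α).inChart e = c • α.inChart e := rfl

/-- A form is smooth if its coefficients in every chart are smooth (in the real sense). -/
def CForm.IsSmooth {k : ℕ} (α : CForm E X k) : Prop :=
  ∀ e ∈ atlas E X, ContDiffOn ℝ ∞ (α.inChart e) e.target

/-- A form has bidegree `(p, q)`, where `k = p + q`, if `α(ζv₁, …, ζv_k) = ζ^p ζ̄^q α(v₁, …, v_k)`
for all complex numbers `ζ`.  This singles out the summand spanned by the products of `p`
complex-linear and `q` conjugate-linear `1`-forms in the space of complex-valued `k`-forms, because
`ζ` scales the summand of bidegree `(r, s)` by `ζ^r ζ̄^s`, and these characters are pairwise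
different for `r + s = k`. -/
def CForm.HasBidegree (p q : ℕ) (α : CForm E X (p + q)) : Prop :=
  ∀ (x : X) (ζ : ℂ) (v : Fin (p + q) → TangentSpace 𝓘(ℂ, E) x),
    α x (fun i => ζ • v i) = ζ ^ p * (starRingEnd ℂ ζ) ^ q * α x v

/-- The operator `∂̄` on complex-valued forms on a complex manifold, computed at each point in the
preferred chart there.  It is only applied to smooth forms. -/
def CForm.dbar {k : ℕ} (α : CForm E X k) : CForm E X (k + 1) := fun x =>
  (dbarModel (α.inChart (chartAt E x)) (chartAt E x x)).compContinuousLinearMap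
    ((mfderiv 𝓘(ℂ, E) 𝓘(ℂ, E) (chartAt E x) x : TangentSpace 𝓘(ℂ, E) x →L[ℂ] E).restrictScalars ℝ)

theorem CForm.IsSmooth.differentiableAt {k : ℕ} {α : CForm E X k} (hα : α.IsSmooth) (x : X) :
    DifferentiableAt ℝ (α.inChart (chartAt E x)) (chartAt E x x) :=
  ((hα _ (chart_mem_atlas E x)).contDiffAt
    ((chartAt E x).open_target.mem_nhds (mem_chart_target E x))).differentiableAt (by simp)

theorem CForm.dbar_add {k : ℕ} {α β : CForm E X k} (hα : α.IsSmooth) (hβ : β.IsSmooth) :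
    (α + β).dbar = α.dbar + β.dbar := by
  funext x
  simp only [CForm.dbar, CForm.inChart_add,
    dbarModel_add (hα.differentiableAt x) (hβ.differentiableAt x)]
  rfl

theorem CForm.dbar_smul {k : ℕ} (c : ℂ) {α : CForm E X k} (hα : α.IsSmooth) :
    (c • α).dbar = c • α.dbar := by
  funext x
  simp only [CForm.dbar, CForm.inChart_smul,
    dbarModel_smul c _ (hα.differentiableAt x)]
  rfl

theorem CForm.dbar_zero {k : ℕ} : (0 : CForm E X k).dbar = 0 := by
  have h : (0 : CForm E X k).IsSmooth := fun _ _ => contDiffOn_const (c := 0)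
  simpa using CForm.dbar_smul (0 : ℂ) h

variable (E X)

/-- The space of smooth `(p, q)`-forms. -/
def smoothForms (p q : ℕ) : Submodule ℂ (CForm E X (p + q)) where
  carrier := {α | α.IsSmooth ∧ α.HasBidegree p q}
  zero_mem' := ⟨fun _ _ => contDiffOn_const (c := 0), fun x ζ v => by
    simp only [CForm.zero_apply, mul_zero]⟩
  add_mem' := by
    rintro α β ⟨hα, hα'⟩ ⟨hβ, hβ'⟩
    refine ⟨fun e he => (hα e he).add (hβ e he), fun x ζ v => ?_⟩
    have h1 := hα' x ζ v
    have h2 := hβ' x ζ v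
    simp only [CForm.add_apply, h1, h2, mul_add]
  smul_mem' := by
    rintro c α ⟨hα, hα'⟩
    refine ⟨fun e he => (hα e he).const_smul c, fun x ζ v => ?_⟩
    have h1 := hα' x ζ v
    simp only [CForm.smul_apply, h1]
    ring

/-- The space of smooth `∂̄`-closed `(p, q)`-forms. -/
def closedForms (p q : ℕ) : Submodule ℂ (CForm E X (p + q)) where
  carrier := {α | α ∈ smoothForms E X p q ∧ α.dbar = 0}
  zero_mem' := ⟨zero_mem _, CForm.dbar_zero⟩
  add_mem' := by
    rintro α β ⟨hα, hα'⟩ ⟨hβ, hβ'⟩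
    exact ⟨add_mem hα hβ, by rw [CForm.dbar_add hα.1 hβ.1, hα', hβ', add_zero]⟩
  smul_mem' := by
    rintro c α ⟨hα, hα'⟩
    exact ⟨Submodule.smul_mem _ c hα, by rw [CForm.dbar_smul c hα.1, hα', smul_zero]⟩

/-- The space of `∂̄`-exact smooth `(p, q)`-forms; it is zero for `q = 0`. -/
def exactForms (p : ℕ) : (q : ℕ) → Submodule ℂ (CForm E X (p + q))
  | 0 => ⊥
  | q + 1 =>
    { carrier := {α | α ∈ smoothForms E X p (q + 1) ∧ ∃ η ∈ smoothForms E X p q, η.dbar = α}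
      zero_mem' := ⟨zero_mem _, 0, zero_mem _, CForm.dbar_zero⟩
      add_mem' := by
        rintro α β ⟨hα, η, hη, rfl⟩ ⟨hβ, θ, hθ, rfl⟩
        exact ⟨add_mem hα hβ, η + θ, add_mem hη hθ, CForm.dbar_add hη.1 hθ.1⟩
      smul_mem' := by
        rintro c α ⟨hα, η, hη, rfl⟩
        exact ⟨Submodule.smul_mem _ c hα, c • η, Submodule.smul_mem _ c hη,
          CForm.dbar_smul c hη.1⟩ }

/-- The Dolbeault cohomology space `H^{p,q}_{∂̄}(X)`. -/
abbrev DolbeaultCohomology (p q : ℕ) : Type _ :=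
  closedForms E X p q ⧸ (exactForms E X p q).submoduleOf (closedForms E X p q)

/-- The Hodge number `h^{p,q}(X) = dim_ℂ H^{p,q}_{∂̄}(X)`, as a cardinal. -/
def hodgeNumber (p q : ℕ) : Cardinal :=
  Module.rank ℂ (DolbeaultCohomology E X p q)

variable {E X}

/-- A holomorphic `p`-form: a section `α` of the `p`-th exterior power of the holomorphic cotangent
bundle whose coefficients in every chart are holomorphic. -/
def IsHolomorphicForm {p : ℕ}
    (α : ∀ x : X, TangentSpace 𝓘(ℂ, E) x [⋀^Fin p]→L[ℂ] ℂ) : Prop :=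
  ∀ e ∈ atlas E X, ContDiffOn ℂ ω
    (fun y : E => ((α (e.symm y)).compContinuousLinearMap
      (mfderiv 𝓘(ℂ, E) 𝓘(ℂ, E) e.symm y : E →L[ℂ] TangentSpace 𝓘(ℂ, E) (e.symm y)) :
        E [⋀^Fin p]→L[ℂ] ℂ))
    e.target

end Manifold

end

end ComplexForms

/-! The vanishing in bidegree (3,0) is a Stokes argument. A holomorphic 3-form α on a complex
threefold is closed, because its exterior derivative could only be of type (4,0). As H³(S⁶) = 0, one
has α = dβ, so ∫ α∧ᾱ = ∫ d(β∧ᾱ) = 0. Locally α = c dz₁∧dz₂∧dz₃, hence α∧ᾱ is |c|² times a fixed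
constant times the volume form of the complex orientation. The integrand has constant phase, so c =
0 everywhere.

De Rham theory on the sphere is avoided. Inverse stereographic projection pulls α back to a closed
form on ℝ⁶ whose size at w is O((1+‖w‖²)⁻³). The radial Poincaré primitive of such a form is
bounded, and cutoffs whose gradients are O(1/(1+‖w‖)) make the boundary term in Stokes' theorem tend
to 0 (`integral_pairing_eq_zero`). The projection pole is varied so that every point of X is reached
(`eq_zero_of_mem_closedForms`).

The vanishing in bidegree (0,3) is Serre duality, proved by hand. If some smooth (0,3)-form f were
not exact, a linear functional t, with no continuity assumed, would vanish on exact forms but not at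
f. In a chart, a compactly supported (0,3)-form differs from its mollification by a ∂̄-exact form
(`dbarModel_mollifyHomotopy`), so t is invariant under a smoothing operator. That operator has a
continuous kernel, so it is within distance less than 1 of a finite rank operator, and this forces
the functional induced by t on continuous coefficients to be continuous, indeed given by continuous
densities (`exists_density`).

The densities glue to a continuous (3,0)-form ψ. Mollification invariance makes ψ smooth, and
vanishing on exact forms makes it holomorphic (`contDiffOn_of_mollify_invariant`,
`antilinearPart_fderiv_eq_zero`). By the first half ψ = 0, hence t f = 0, a contradiction
(`smoothForms_le_exactForms`). -/

namespace ComplexForms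

open Complex

noncomputable section

/-! ### Linear algebra of forms of bidegree (3,0) and (0,3) on a complex 3-space. -/

section Polarization

variable {E : Type*} [AddCommGroup E] [Module ℂ E] {f : E → E → E → ℂ}

/-- Let J₁, J₂, J₃ be multiplication by I in the three slots. They commute and square to -1, so
their joint eigenvalues are ±I. Homogeneity gives J₁ + J₂ + J₃ = 3I, which leaves only the
eigenvalue I for each. This turns the character definition of bidegree into complex linearity in
each slot. -/
theorem triadditive_I_smul_left
    (h₁ : ∀ a a' b c, f (a + a') b c = f a b c + f a' b c)
    (h₂ : ∀ a b b' c, f a (b + b') c = f a b c + f a b' c)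
    (h₃ : ∀ a b c c', f a b (c + c') = f a b c + f a b c')
    (hf : ∀ (ζ : ℂ) a b c, f (ζ • a) (ζ • b) (ζ • c) = ζ ^ 3 * f a b c) (a b c : E) :
    f (I • a) b c = I * f a b c := by
  have z₁ : ∀ b c, f 0 b c = 0 := fun b c => by simpa using h₁ 0 0 b c
  have z₂ : ∀ a c, f a 0 c = 0 := fun a c => by simpa using h₂ a 0 0 c
  have z₃ : ∀ a b, f a b 0 = 0 := fun a b => by simpa using h₃ a b 0 0
  have n₁ : ∀ a b c, f (-a) b c = -f a b c := fun a b c => by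
    have := h₁ a (-a) b c
    rw [add_neg_cancel, z₁] at this
    linear_combination -this
  have n₂ : ∀ a b c, f a (-b) c = -f a b c := fun a b c => by
    have := h₂ a b (-b) c
    rw [add_neg_cancel, z₂] at this
    linear_combination -this
  have n₃ : ∀ a b c, f a b (-c) = -f a b c := fun a b c => by
    have := h₃ a b c (-c)
    rw [add_neg_cancel, z₃] at this
    linear_combination -this
  -- Half the difference of the identities for 1 + I and 1 - I is the sum of the terms with one or
  -- three factors I; the identity for I removes the latter.
  have key : ∀ a b c, f (I • a) b c + f a (I • b) c + f a b (I • c) = 3 * I * f a b c := by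
    intro a b c
    have e₁ := hf (1 + I) a b c
    have e₂ := hf (1 - I) a b c
    have e₃ := hf I a b c
    simp only [sub_eq_add_neg, add_smul, neg_smul, one_smul, h₁, h₂, h₃, n₁, n₂, n₃] at e₁ e₂
    linear_combination (1 / 2) * e₁ - (1 / 2) * e₂ - e₃
  have dd : ∀ x : E, I • I • x = -x := fun x => by rw [smul_smul, I_mul_I, neg_one_smul]
  have r₀ := key a b c
  have r₁ := key (I • a) b c
  have r₂ := key a (I • b) c
  have r₃ := key a b (I • c)
  have r₁₂ := key (I • a) (I • b) c
  have r₁₃ := key (I • a) b (I • c)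
  have r₂₃ := key a (I • b) (I • c)
  have r₁₂₃ := key (I • a) (I • b) (I • c)
  simp only [dd, n₁, n₂, n₃] at r₀ r₁ r₂ r₃ r₁₂ r₁₃ r₂₃ r₁₂₃
  -- The coefficients express J₁ - I as a multiple of J₁ + J₂ + J₃ - 3I modulo the relations Jᵢ² =
  -- -1; they can be checked at the eight sign choices Jᵢ = ±I.
  linear_combination (norm := skip) (1 / 24) * (7 * r₀ - 2 * I * r₂ - 2 * I * r₃ - r₂₃
    + 7 * I * r₁ + 2 * r₁₂ + 2 * r₁₃ - I * r₁₂₃)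
  ring_nf
  simp only [I_sq]
  ring

end Polarization

variable {E : Type*} [NormedAddCommGroup E] [NormedSpace ℂ E]

/-- Multiplication by `ζ` acts on a form of bidegree `(3, 0)` in each slot separately. -/
theorem map_complex_smul_of_bidegree {α : E [⋀^Fin 3]→L[ℝ] ℂ}
    (hα : ∀ (ζ : ℂ) v, α (fun i => ζ • v i) = ζ ^ 3 * α v) (v : Fin 3 → E) (i : Fin 3) (c : ℂ)
    (x : E) : α (Function.update v i (c • x)) = c * α (Function.update v i x) := by
  have hvec : ∀ w : Fin 3 → E, w = ![w 0, w 1, w 2] := fun w => by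
    ext j; fin_cases j <;> rfl
  have key : ∀ a b c : E, α ![I • a, b, c] = I * α ![a, b, c] := by
    refine triadditive_I_smul_left (f := fun a b c => α ![a, b, c]) ?_ ?_ ?_ ?_
    · intro a a' b c
      have := α.map_update_add ![a, b, c] 0 a a'
      have h1 : ∀ x, Function.update ![a, b, c] 0 x = ![x, b, c] := fun x => by
        ext j; fin_cases j <;> rfl
      simpa only [h1] using this
    · intro a b b' c
      have := α.map_update_add ![a, b, c] 1 b b'
      have h1 : ∀ x, Function.update ![a, b, c] 1 x = ![a, x, c] := fun x => by
        ext j; fin_cases j <;> rfl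
      simpa only [h1] using this
    · intro a b c c'
      have := α.map_update_add ![a, b, c] 2 c c'
      have h1 : ∀ x, Function.update ![a, b, c] 2 x = ![a, b, x] := fun x => by
        ext j; fin_cases j <;> rfl
      simpa only [h1] using this
    · intro ζ a b c
      have := hα ζ ![a, b, c]
      rw [← this]
      congr 1
      ext j; fin_cases j <;> rfl
  have keyI : α (Function.update v i (I • x)) = I * α (Function.update v i x) := by
    -- Slot i is moved to the front by a transposition, whose sign is the same on both sides of the
    -- identity to be proved.
    have hs : ∀ y, α (Function.update v i y) =
        (Equiv.Perm.sign (Equiv.swap 0 i) : ℤ) • α ![y, (Function.update v i y ∘ Equiv.swap 0 i) 1,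
          (Function.update v i y ∘ Equiv.swap 0 i) 2] := by
      intro y
      have := α.toAlternatingMap.map_perm (Function.update v i y) (Equiv.swap 0 i)
      have h2 : Function.update v i y ∘ Equiv.swap 0 i
          = ![y, (Function.update v i y ∘ Equiv.swap 0 i) 1,
          (Function.update v i y ∘ Equiv.swap 0 i) 2] := by
        rw [hvec (Function.update v i y ∘ Equiv.swap 0 i)]
        congr 1
        simp
      rw [← h2]
      have h3 : α (Function.update v i y ∘ Equiv.swap 0 i) =
        (Equiv.Perm.sign (Equiv.swap 0 i) : ℤ) • α (Function.update v i y) := this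
      rw [h3, smul_smul, ← Units.val_mul, Int.units_mul_self, Units.val_one, one_smul]
    have hne : ∀ (y : E) (j : Fin 3), j ≠ 0 → (Function.update v i y ∘ Equiv.swap 0 i) j
        = (v ∘ Equiv.swap 0 i) j := by
      intro y j hj
      have : Equiv.swap 0 i j ≠ i := by
        intro h
        apply hj
        have := congrArg (Equiv.swap 0 i) h
        simpa using this
      simp [Function.update_of_ne this]
    rw [hs, hs x]
    simp only [hne _ 1 (by decide), hne _ 2 (by decide), key]
    simp only [zsmul_eq_mul]
    ring
  have hc : c • x = c.re • x + c.im • (I • x) := by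
    conv_lhs => rw [← re_add_im c]
    rw [add_smul, mul_smul]
    rfl
  rw [hc, α.map_update_add, α.map_update_smul, α.map_update_smul, keyI, real_smul, real_smul]
  conv_rhs => rw [← re_add_im c]
  ring

variable (b : Module.Basis (Fin 3) ℂ E)

/-- The determinant in the basis `b`, as a continuous complex alternating form. -/
def complexVolForm : E [⋀^Fin 3]→L[ℂ] ℂ where
  toMultilinearMap := b.det.toMultilinearMap
  map_eq_zero_of_eq' := b.det.map_eq_zero_of_eq'
  cont := by
    have : FiniteDimensional ℂ E := b.finiteDimensional_of_finite
    change Continuous fun v : Fin 3 → E => b.det v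
    simp only [Module.Basis.det_apply, Matrix.det_apply, Module.Basis.toMatrix_apply]
    refine continuous_finsetSum _ fun σ _ => Continuous.const_smul
      (continuous_finsetProd _ fun i _ => ?_) _
    exact ((b.coord (σ i)).continuous_of_finiteDimensional).comp (continuous_apply i)

@[simp]
theorem complexVolForm_apply (v : Fin 3 → E) : complexVolForm b v = b.det v := rfl

/-- The form `dz₁ ∧ dz₂ ∧ dz₃` in the linear coordinates given by the basis `b`. -/
def volForm : E [⋀^Fin 3]→L[ℝ] ℂ := (complexVolForm b).restrictScalars ℝ

/-- The form `dz̄₁ ∧ dz̄₂ ∧ dz̄₃` in the linear coordinates given by the basis `b`. -/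
def conjVolForm : E [⋀^Fin 3]→L[ℝ] ℂ :=
  (conjCLE : ℂ →L[ℝ] ℂ).compContinuousAlternatingMap (volForm b)

@[simp]
theorem volForm_apply (v : Fin 3 → E) : volForm b v = b.det v := rfl

@[simp]
theorem conjVolForm_apply (v : Fin 3 → E) : conjVolForm b v = starRingEnd ℂ (b.det v) := rfl

theorem det_smul_vec (ζ : ℂ) (v : Fin 3 → E) : b.det (fun i => ζ • v i) = ζ ^ 3 * b.det v := by
  have := b.det.map_smul_univ (fun _ => ζ) v
  simpa using this

/-- Being complex linear in each slot, such a form is a complex alternating form of top degree,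
hence a multiple of the determinant. -/
theorem eq_smul_volForm {α : E [⋀^Fin 3]→L[ℝ] ℂ}
    (hα : ∀ (ζ : ℂ) v, α (fun i => ζ • v i) = ζ ^ 3 * α v) : α = α b • volForm b := by
  let A : E [⋀^Fin 3]→ₗ[ℂ] ℂ :=
    { toFun := α
      map_update_add' := fun v i x y => by
        exact α.map_update_add v i x y
      map_update_smul' := fun {inst} v i c x => by
        rw [Subsingleton.elim inst (instDecidableEqFin 3)]
        exact map_complex_smul_of_bidegree hα v i c x
      map_eq_zero_of_eq' := α.map_eq_zero_of_eq' }
  have h := A.eq_smul_basis_det b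
  ext v
  exact DFunLike.congr_fun h v

theorem eq_smul_conjVolForm {α : E [⋀^Fin 3]→L[ℝ] ℂ}
    (hα : ∀ (ζ : ℂ) v, α (fun i => ζ • v i) = (starRingEnd ℂ ζ) ^ 3 * α v) :
    α = α b • conjVolForm b := by
  have h := eq_smul_volForm b (α := (conjCLE : ℂ →L[ℝ] ℂ).compContinuousAlternatingMap α)
    (fun ζ v => by
      change starRingEnd ℂ (α _) = _ * starRingEnd ℂ (α v)
      rw [hα]; simp)
  ext v
  have h2 : starRingEnd ℂ (α v) = starRingEnd ℂ (α b) * b.det v := DFunLike.congr_fun h v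
  have h3 := congrArg (starRingEnd ℂ) h2
  simpa using h3

theorem volForm_comp (A : E →L[ℂ] E) :
    (volForm b).compContinuousLinearMap (A.restrictScalars ℝ) =
      LinearMap.det (A : E →ₗ[ℂ] E) • volForm b := by
  ext v
  exact b.det_comp (A : E →ₗ[ℂ] E) v

theorem conjVolForm_comp (A : E →L[ℂ] E) :
    (conjVolForm b).compContinuousLinearMap (A.restrictScalars ℝ) =
      starRingEnd ℂ (LinearMap.det (A : E →ₗ[ℂ] E)) • conjVolForm b := by
  ext v
  have := b.det_comp (A : E →ₗ[ℂ] E) v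
  change starRingEnd ℂ (b.det ((A : E →ₗ[ℂ] E) ∘ v)) = _ * starRingEnd ℂ (b.det v)
  rw [this, map_mul]

/-- The sum is the value of the 4-form l ∧ det, and alternating 4-forms vanish on a space of
dimension 3. -/
theorem sum_removeNth_det_eq_zero (l : E →ₗ[ℂ] ℂ) (v : Fin 4 → E) :
    ∑ i, (-1 : ℂ) ^ i.val * (l (v i) * b.det (i.removeNth v)) = 0 := by
  have : FiniteDimensional ℂ E := b.finiteDimensional_of_finite
  have hdim : Module.finrank ℂ E = 3 := by simpa using Module.finrank_eq_card_basis b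
  have h := ContinuousAlternatingMap.alternatizeUncurryFin_apply
    ((LinearMap.toContinuousLinearMap l).smulRight (complexVolForm b)) v
  have h0 := (ContinuousAlternatingMap.alternatizeUncurryFin
    ((LinearMap.toContinuousLinearMap l).smulRight (complexVolForm b))).toAlternatingMap.map_linearDependent
    v (fun hv => by
      have := hv.fintype_card_le_finrank
      simp [hdim] at this)
  have h1 := h.symm.trans h0
  rw [← h1]
  refine Finset.sum_congr rfl fun i _ => ?_
  simp [zsmul_eq_mul]

end

end ComplexForms

/-! ### Conjugate-linear parts and the operator ∂̄ in linear coordinates. -/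

namespace ComplexForms

open Complex Filter Topology

noncomputable section

section Antilinear

variable {E F : Type*} [NormedAddCommGroup E] [NormedSpace ℂ E]
  [NormedAddCommGroup F] [NormedSpace ℂ F]

theorem antilinearPart_apply (L : E →L[ℝ] F) (v : E) :
    antilinearPart L v = (1 / 2 : ℂ) • (L v + I • L (I • v)) := rfl

theorem antilinearPart_map_smul (L : E →L[ℝ] F) (ζ : ℂ) (v : E) :
    antilinearPart L (ζ • v) = starRingEnd ℂ ζ • antilinearPart L v := by
  have hL : ∀ (ζ : ℂ) (v : E), L (ζ • v) = (ζ.re : ℂ) • L v + (ζ.im : ℂ) • L (I • v) := by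
    intro ζ v
    have : ζ • v = ζ.re • v + ζ.im • (I • v) := by
      conv_lhs => rw [← re_add_im ζ]
      rw [add_smul, mul_smul]
      rfl
    rw [this, map_add, L.map_smul, L.map_smul]
    rfl
  have hII : I • I • v = -v := by rw [smul_smul, I_mul_I, neg_one_smul]
  simp only [antilinearPart_apply]
  rw [smul_comm I ζ v, hL ζ v, hL ζ (I • v), hII, map_neg]
  have hζ : starRingEnd ℂ ζ = ζ.re - ζ.im * I := by
    apply Complex.ext <;> simp
  rw [hζ]
  match_scalars
  · ring
  · linear_combination (1 / 2 : ℂ) * ζ.im * I_sq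

theorem antilinearPart_eq_zero {L : E →L[ℝ] F} (hL : ∀ v, L (I • v) = I • L v) :
    antilinearPart L = 0 := by
  ext v
  rw [antilinearPart_apply, hL, smul_smul, I_mul_I, neg_one_smul, add_neg_cancel, smul_zero]
  rfl

theorem map_I_smul_of_antilinearPart_eq_zero {L : E →L[ℝ] F} (hL : antilinearPart L = 0) (v : E) :
    L (I • v) = I • L v := by
  have h : (1 / 2 : ℂ) • (L v + I • L (I • v)) = 0 := by
    rw [← antilinearPart_apply, hL]; rfl
  have h2 : L v + I • L (I • v) = 0 := by
    exact (smul_eq_zero.mp h).resolve_left (by norm_num)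
  have h3 : I • (L v + I • L (I • v)) = 0 := by rw [h2, smul_zero]
  rw [smul_add, smul_smul, I_mul_I, neg_one_smul, ← sub_eq_add_neg, sub_eq_zero] at h3
  exact h3.symm

theorem antilinearPart_smulRight (L : E →L[ℝ] ℂ) (f : F) :
    antilinearPart (L.smulRight f) = (antilinearPart L).smulRight f := by
  ext v
  simp [antilinearPart_apply, smul_add, add_smul, smul_smul, mul_add]

end Antilinear

section Model

variable {E : Type*} [NormedAddCommGroup E] [NormedSpace ℂ E]

theorem _root_.Filter.EventuallyEq.dbarModel_eq {k : ℕ} {θ η : E → E [⋀^Fin k]→L[ℝ] ℂ} {y : E}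
    (h : θ =ᶠ[𝓝 y] η) : dbarModel θ y = dbarModel η y := by
  simp only [dbarModel, h.fderiv_eq]

theorem fderiv_smul_form {k : ℕ} {g : E → ℂ} {y : E} (hg : DifferentiableAt ℝ g y)
    (β : E [⋀^Fin k]→L[ℝ] ℂ) :
    fderiv ℝ (fun z => g z • β) y = (fderiv ℝ g y).smulRight β :=
  (hg.hasFDerivAt.smul_const β).fderiv

theorem dbarModel_smul_const {k : ℕ} {g : E → ℂ} {y : E} (hg : DifferentiableAt ℝ g y)
    (β : E [⋀^Fin k]→L[ℝ] ℂ) :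
    dbarModel (fun z => g z • β) y =
      ContinuousAlternatingMap.alternatizeUncurryFin
        ((antilinearPart (fderiv ℝ g y)).smulRight β) := by
  rw [dbarModel, fderiv_smul_form hg, antilinearPart_smulRight]

/-- `∂̄` commutes with pullback under holomorphic maps. -/
theorem dbarModel_pullback {k : ℕ} {θ : E → E [⋀^Fin k]→L[ℝ] ℂ} {τ : E → E} {y : E}
    (hθ : DifferentiableAt ℝ θ (τ y)) (hτ : ContDiffAt ℂ 2 τ y) :
    dbarModel (fun z => (θ (τ z)).compContinuousLinearMap ((fderiv ℂ τ z).restrictScalars ℝ)) y =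
      (dbarModel θ (τ y)).compContinuousLinearMap ((fderiv ℂ τ y).restrictScalars ℝ) := by
  have hτ1 : HasFDerivAt τ (fderiv ℂ τ y) y := (hτ.differentiableAt (by simp)).hasFDerivAt
  have hτ2 : HasFDerivAt (fderiv ℂ τ) (fderiv ℂ (fderiv ℂ τ) y) y :=
    ((hτ.fderiv_right (m := 1) (by norm_num)).differentiableAt (by simp)).hasFDerivAt
  have hD := (hθ.hasFDerivAt.comp y (hτ1.restrictScalars ℝ)).continuousAlternatingMapCompContinuousLinearMap
    (((ContinuousLinearMap.restrictScalarsL ℂ E E ℝ ℝ).hasFDerivAt (x := fderiv ℂ τ y)).comp y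
      (hτ2.restrictScalars ℝ))
  have hL : fderiv ℝ (fun z => (θ (τ z)).compContinuousLinearMap
      ((fderiv ℂ τ z).restrictScalars ℝ)) y = _ := hD.fderiv
  have hsymm : ∀ x y' : E, fderiv ℂ (fderiv ℂ τ) y x y' = fderiv ℂ (fderiv ℂ τ) y y' x := by
    have := hτ.isSymmSndFDerivAt (by simp)
    exact fun x y' => this x y'
  set H : E →L[ℝ] E →L[ℝ] E := (ContinuousLinearMap.restrictScalarsL ℂ E E ℝ ℝ).comp
    ((fderiv ℂ (fderiv ℂ τ) y).restrictScalars ℝ) with hH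
  -- The terms with second derivatives of τ vanish after alternation by symmetry of D²τ.
  -- Precomposing with I preserves that symmetry, since D²τ is complex bilinear.
  have hz : ContinuousAlternatingMap.alternatizeUncurryFin (antilinearPart
      (((θ (τ y)).fderivCompContinuousLinearMap ((fderiv ℂ τ y).restrictScalars ℝ)).comp H)) = 0 := by
    rw [antilinearPart, ContinuousAlternatingMap.alternatizeUncurryFin_smul,
      ContinuousAlternatingMap.alternatizeUncurryFin_add,
      ContinuousAlternatingMap.alternatizeUncurryFin_smul,
      ContinuousAlternatingMap.alternatizeUncurryFin_fderivCompContinuousLinearMap_eq_zero,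
      ContinuousLinearMap.comp_assoc,
      ContinuousAlternatingMap.alternatizeUncurryFin_fderivCompContinuousLinearMap_eq_zero]
    · simp
    · intro x y'
      simp [hH, hsymm x y']
    · intro x y'
      simp [hH, hsymm x y']
  rw [dbarModel, hL, antilinearPart_add, ContinuousAlternatingMap.alternatizeUncurryFin_add]
  refine (congrArg₂ (· + ·) rfl hz).trans ?_
  rw [add_zero]
  ext v
  simp only [dbarModel, ContinuousAlternatingMap.alternatizeUncurryFin_apply,
    ContinuousAlternatingMap.compContinuousLinearMap_apply]
  refine Finset.sum_congr rfl fun i _ => ?_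
  -- Taking conjugate-linear parts commutes with precomposition by Dτ because Dτ is complex linear.
  have : ∀ w : E, antilinearPart ((ContinuousAlternatingMap.compContinuousLinearMapCLM
      ((fderiv ℂ τ y).restrictScalars ℝ)).comp
      ((fderiv ℝ θ (τ y)).comp ((fderiv ℂ τ y).restrictScalars ℝ))) w =
      (antilinearPart (fderiv ℝ θ (τ y)) (fderiv ℂ τ y w)).compContinuousLinearMap
        ((fderiv ℂ τ y).restrictScalars ℝ) := by
    intro w
    ext u
    simp [antilinearPart_apply]
  exact congrArg (fun z : E [⋀^Fin k]→L[ℝ] ℂ => (-1) ^ i.val • z (i.removeNth v)) (this (v i))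

variable (b : Module.Basis (Fin 3) ℂ E)

theorem alternatizeUncurryFin_smulRight_volForm {L : E →L[ℝ] ℂ} (hL : ∀ v, L (I • v) = I • L v) :
    ContinuousAlternatingMap.alternatizeUncurryFin (L.smulRight (volForm b)) = 0 := by
  let l : E →ₗ[ℂ] ℂ :=
    { toFun := L
      map_add' := L.map_add
      map_smul' := fun c x => by
        conv_lhs => rw [← re_add_im c]
        rw [add_smul, mul_smul, map_add]
        have h1 : L ((c.re : ℂ) • x) = (c.re : ℂ) • L x := L.map_smul c.re x
        have h2 : L ((c.im : ℂ) • I • x) = (c.im : ℂ) • L (I • x) := L.map_smul c.im (I • x)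
        rw [h1, h2, hL, smul_smul, ← add_smul, re_add_im]
        rfl }
  ext v
  rw [ContinuousAlternatingMap.alternatizeUncurryFin_apply]
  have h := sum_removeNth_det_eq_zero b l v
  refine Eq.trans ?_ h
  refine Finset.sum_congr rfl fun i _ => ?_
  simp [zsmul_eq_mul, l]

theorem sum_removeNth_conjVolForm_eq_zero {L : E →L[ℝ] ℂ}
    (hL : ∀ (ζ : ℂ) v, L (ζ • v) = starRingEnd ℂ ζ • L v) (v : Fin 4 → E) :
    ∑ i, (-1 : ℂ) ^ i.val * (L (v i) * conjVolForm b (i.removeNth v)) = 0 := by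
  let l : E →ₗ[ℂ] ℂ :=
    { toFun := fun x => starRingEnd ℂ (L x)
      map_add' := fun x y => by simp
      map_smul' := fun c x => by simp [hL] }
  have h := congrArg (starRingEnd ℂ) (sum_removeNth_det_eq_zero b l v)
  simpa [map_sum, l] using h

/-- Contracting the vanishing 4-form L ∧ dz̄₁∧dz̄₂∧dz̄₃ with w gives L(w) dz̄₁∧dz̄₂∧dz̄₃ = L ∧
ι_w(dz̄₁∧dz̄₂∧dz̄₃). Thus ∂̄ of u ι_w(dz̄₁∧dz̄₂∧dz̄₃) has coefficient ∂̄u(w). -/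
theorem alternatizeUncurryFin_smulRight_curryLeft_conjVolForm {L : E →L[ℝ] ℂ}
    (hL : ∀ (ζ : ℂ) v, L (ζ • v) = starRingEnd ℂ ζ • L v) (w : E) :
    ContinuousAlternatingMap.alternatizeUncurryFin
      (L.smulRight ((conjVolForm b).curryLeft w)) = L w • conjVolForm b := by
  ext v
  rw [ContinuousAlternatingMap.alternatizeUncurryFin_apply]
  have h := sum_removeNth_conjVolForm_eq_zero b hL (Fin.cons w v)
  rw [Fin.sum_univ_succ] at h
  simp only [Fin.cons_zero, Fin.cons_succ, Fin.removeNth_zero, Fin.tail_cons, Fin.val_zero,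
    pow_zero, one_mul, Fin.val_succ, pow_succ] at h
  have h2 : ∀ i : Fin 3, i.succ.removeNth (Fin.cons w v : Fin 4 → E)
      = Matrix.vecCons w (i.removeNth v) := by
    intro i
    ext j
    fin_cases i <;> fin_cases j <;> rfl
  simp only [h2] at h
  simp only [mul_neg, mul_one, neg_mul, Finset.sum_neg_distrib] at h
  simp only [ContinuousLinearMap.smulRight_apply, ContinuousAlternatingMap.smul_apply, smul_eq_mul,
    zsmul_eq_mul, ContinuousAlternatingMap.curryLeft_apply_apply]
  push_cast
  linear_combination -h

/-- Evaluating on (x, b₀, b₁, b₂) expresses L(x) through determinants that are complex linear in x.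
So L is both linear and conjugate-linear, hence zero. -/
theorem eq_zero_of_alternatizeUncurryFin_smulRight_volForm {L : E →L[ℝ] ℂ}
    (hL : ∀ (ζ : ℂ) v, L (ζ • v) = starRingEnd ℂ ζ • L v)
    (h : ContinuousAlternatingMap.alternatizeUncurryFin (L.smulRight (volForm b)) = 0) :
    L = 0 := by
  have e : ∀ x, L x + ∑ i : Fin 3, (-1) ^ (i.val + 1) *
      (L (b i) * b.det (Matrix.vecCons x (i.removeNth b))) = 0 := by
    intro x
    have := DFunLike.congr_fun h (Fin.cons x b)
    rw [ContinuousAlternatingMap.alternatizeUncurryFin_apply, Fin.sum_univ_succ] at this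
    have h2 : ∀ i : Fin 3, i.succ.removeNth (Fin.cons x b : Fin 4 → E)
        = Matrix.vecCons x (i.removeNth b) := by
      intro i
      ext j
      fin_cases i <;> fin_cases j <;> rfl
    simpa [h2, zsmul_eq_mul, b.det_self] using this
  refine ContinuousLinearMap.ext fun x => ?_
  have h1 := e (I • x)
  rw [hL] at h1
  have h3 : ∀ u : Fin 2 → E, b.det (Matrix.vecCons (I • x) u) = I * b.det (Matrix.vecCons x u) :=
    fun u => b.det.map_vecCons_smul u I x
  have h4 : ∑ i : Fin 3, (-1 : ℂ) ^ (i.val + 1) *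
      (L (b i) * b.det (Matrix.vecCons (I • x) (i.removeNth b))) =
      I * ∑ i : Fin 3, (-1) ^ (i.val + 1) *
      (L (b i) * b.det (Matrix.vecCons x (i.removeNth b))) := by
    rw [Finset.mul_sum]
    refine Finset.sum_congr rfl fun i _ => ?_
    rw [h3]; ring
  rw [h4] at h1
  have h0 := e x
  simp only [conj_I, smul_eq_mul] at h1
  have h5 : (2 * I) * L x = 0 := by linear_combination I * h0 - h1
  simpa using h5

/-- A form of type `(3, 0)` which is `∂̄`-closed at a point is closed there. -/
theorem extDeriv_eq_zero_of_dbarModel_eq_zero {θ : E → E [⋀^Fin 3]→L[ℝ] ℂ} {c : E → ℂ} {y : E}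
    (hc : DifferentiableAt ℝ c y) (hθ : θ =ᶠ[𝓝 y] fun z => c z • volForm b)
    (h : dbarModel θ y = 0) : extDeriv θ y = 0 := by
  rw [hθ.dbarModel_eq, dbarModel_smul_const hc] at h
  have h0 := eq_zero_of_alternatizeUncurryFin_smulRight_volForm b
    (antilinearPart_map_smul (fderiv ℝ c y)) h
  rw [hθ.extDeriv_eq, extDeriv, fderiv_smul_form hc]
  exact alternatizeUncurryFin_smulRight_volForm b (map_I_smul_of_antilinearPart_eq_zero h0)

end Model

end

end ComplexForms

/-! ### Forms on the manifold: change of charts, and extension by zero from a chart. -/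

namespace ComplexForms

open Complex Filter Topology Set

noncomputable section

theorem dbarModel_zero {E : Type*} [NormedAddCommGroup E] [NormedSpace ℂ E] {k : ℕ} (y : E) :
    dbarModel (fun _ : E => (0 : E [⋀^Fin k]→L[ℝ] ℂ)) y = 0 := by
  have h : antilinearPart (fderiv ℝ (fun _ : E => (0 : E [⋀^Fin k]→L[ℝ] ℂ)) y) = 0 :=
    antilinearPart_eq_zero fun v => by simp
  rw [dbarModel, h]
  exact (ContinuousAlternatingMap.alternatizeUncurryFinCLM ℝ E ℂ).map_zero

section FormCalculus

variable {U V W : Type*} [NormedAddCommGroup U] [NormedSpace ℝ U]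
  [NormedAddCommGroup V] [NormedSpace ℝ V] [FiniteDimensional ℝ V]
  [NormedAddCommGroup W] [NormedSpace ℝ W] [FiniteDimensional ℝ W] {k : ℕ} {n : WithTop ℕ∞}

/-- Regularity of a form-valued map can be tested on constant vectors. -/
theorem exists_linear_reconstruction (W : Type*) [NormedAddCommGroup W] [NormedSpace ℝ W]
    [FiniteDimensional ℝ W] (k : ℕ) :
    ∃ L : ((Fin k → Fin (Module.finrank ℝ W)) → ℂ) →L[ℝ] (W [⋀^Fin k]→L[ℝ] ℂ),
      ∀ f : W [⋀^Fin k]→L[ℝ] ℂ, L (fun j => f (fun i => Module.finBasis ℝ W (j i))) = f := by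
  let ev : (W [⋀^Fin k]→L[ℝ] ℂ) →ₗ[ℝ] ((Fin k → Fin (Module.finrank ℝ W)) → ℂ) :=
    { toFun := fun f j => f (fun i => Module.finBasis ℝ W (j i))
      map_add' := fun _ _ => rfl
      map_smul' := fun _ _ => rfl }
  have hinj : LinearMap.ker ev = ⊥ := by
    rw [LinearMap.ker_eq_bot]
    intro f g hfg
    have : f.toMultilinearMap = g.toMultilinearMap :=
      Module.Basis.ext_multilinear (fun _ => Module.finBasis ℝ W) fun v => congrFun hfg v
    ext v
    exact DFunLike.congr_fun this v
  obtain ⟨L, hL⟩ := LinearMap.exists_leftInverse_of_injective ev hinj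
  exact ⟨LinearMap.toContinuousLinearMap L, fun f => LinearMap.congr_fun hL f⟩

/-- A form depends linearly on its finitely many values on basis vectors, so smoothness of these
values suffices. -/
theorem contDiffAt_form_of_apply {f : U → W [⋀^Fin k]→L[ℝ] ℂ} {y : U}
    (h : ∀ v, ContDiffAt ℝ n (fun z => f z v) y) : ContDiffAt ℝ n f y := by
  obtain ⟨L, hL⟩ := exists_linear_reconstruction W k
  have : f = fun z => L (fun j => f z (fun i => Module.finBasis ℝ W (j i))) := by
    ext1 z; rw [hL]
  rw [this]
  exact L.contDiff.contDiffAt.comp y (contDiffAt_pi.2 fun j => h _)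

theorem form_apply_eq_sum (f : V [⋀^Fin k]→L[ℝ] ℂ) (w : Fin k → V) :
    f w = ∑ j : Fin k → Fin (Module.finrank ℝ V),
      (∏ i, (Module.finBasis ℝ V).repr (w i) (j i)) • f (fun i => Module.finBasis ℝ V (j i)) := by
  conv_lhs => rw [show w = fun i => ∑ l, (Module.finBasis ℝ V).repr (w i) l •
    Module.finBasis ℝ V l from funext fun i => ((Module.finBasis ℝ V).sum_repr (w i)).symm]
  have := f.toMultilinearMap.map_sum
    (fun i l => (Module.finBasis ℝ V).repr (w i) l • Module.finBasis ℝ V l)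
  refine this.trans (Finset.sum_congr rfl fun j _ => ?_)
  exact f.toMultilinearMap.map_smul_univ (fun i => (Module.finBasis ℝ V).repr (w i) (j i))
    (fun i => Module.finBasis ℝ V (j i))

theorem _root_.ContDiffAt.form_apply {f : U → V [⋀^Fin k]→L[ℝ] ℂ} {w : Fin k → U → V} {y : U}
    (hf : ContDiffAt ℝ n f y) (hw : ∀ i, ContDiffAt ℝ n (w i) y) :
    ContDiffAt ℝ n (fun z => f z (fun i => w i z)) y := by
  have hsum : (fun z => f z (fun i => w i z)) = fun z => ∑ j : Fin k → Fin (Module.finrank ℝ V),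
      (∏ i, (Module.finBasis ℝ V).repr (w i z) (j i)) •
        f z (fun i => Module.finBasis ℝ V (j i)) := funext fun z => form_apply_eq_sum _ _
  rw [hsum]
  refine ContDiffAt.sum fun j _ => ContDiffAt.fun_smul (contDiffAt_prod fun i _ => ?_) ?_
  · exact (LinearMap.toContinuousLinearMap ((Module.finBasis ℝ V).coord (j i))).contDiff.contDiffAt.comp
      y (hw i)
  · exact (ContinuousAlternatingMap.apply ℝ V ℂ
      (fun i => Module.finBasis ℝ V (j i))).contDiff.contDiffAt.comp y hf

theorem _root_.ContDiffAt.form_pullback {f : U → V [⋀^Fin k]→L[ℝ] ℂ} {g : U → W →L[ℝ] V} {y : U}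
    (hf : ContDiffAt ℝ n f y) (hg : ContDiffAt ℝ n g y) :
    ContDiffAt ℝ n (fun z => (f z).compContinuousLinearMap (g z)) y :=
  contDiffAt_form_of_apply fun _ => hf.form_apply fun _ => hg.clm_apply contDiffAt_const

end FormCalculus

section Charts

variable {E : Type*} [NormedAddCommGroup E] [NormedSpace ℂ E]
variable {X : Type*} [TopologicalSpace X] [ChartedSpace E X]

/-- The value of a form at a point, as a form on the model space (to which all tangent spaces are
equal by definition). -/
def CForm.valueAt {k : ℕ} (α : CForm E X k) (x : X) : E [⋀^Fin k]→L[ℝ] ℂ := α x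

/-- The derivative of the change of coordinates from the preferred chart at `e.symm y` to `e`. -/
def chartDeriv (e : OpenPartialHomeomorph X E) (y : E) : E →L[ℂ] E :=
  fderiv ℂ (chartAt E (e.symm y) ∘ e.symm) y


theorem eventually_mem_source_of_mem {E X : Type*} [TopologicalSpace E] [TopologicalSpace X]
    {e e' : OpenPartialHomeomorph X E} {y : E}
    (hy : y ∈ e.target) (hy' : e.symm y ∈ e'.source) :
    ∀ᶠ z in 𝓝 y, z ∈ e.target ∧ e.symm z ∈ e'.source := by
  have := (e.symm.trans e').open_source.mem_nhds (x := y) (by simp [hy, hy'])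
  filter_upwards [this] with z hz
  simpa using hz

theorem fderiv_transition_self {E X : Type*} [NormedAddCommGroup E] [NormedSpace ℂ E]
    [TopologicalSpace X] (e : OpenPartialHomeomorph X E) {y : E} (hy : y ∈ e.target) :
    fderiv ℂ (e ∘ e.symm) y = ContinuousLinearMap.id ℂ E := by
  rw [← fderiv_id (x := y) (𝕜 := ℂ)]
  refine Filter.EventuallyEq.fderiv_eq ?_
  filter_upwards [e.open_target.mem_nhds hy] with z hz
  simp [e.right_inv hz]

variable [IsManifold 𝓘(ℂ, E) ω X]

theorem contDiffOn_transition {e e' : OpenPartialHomeomorph X E} (he : e ∈ atlas E X)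
    (he' : e' ∈ atlas E X) : ContDiffOn ℂ ω (e' ∘ e.symm) (e.symm.trans e').source := by
  have h := (contDiffGroupoid ω 𝓘(ℂ, E)).compatible he he'
  rw [contDiffGroupoid, mem_groupoid_of_pregroupoid] at h
  simpa [contDiffPregroupoid] using h.1

theorem contDiffAt_transition {e e' : OpenPartialHomeomorph X E} (he : e ∈ atlas E X)
    (he' : e' ∈ atlas E X) {y : E} (hy : y ∈ e.target) (hy' : e.symm y ∈ e'.source) :
    ContDiffAt ℂ ω (e' ∘ e.symm) y :=
  (contDiffOn_transition he he').contDiffAt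
    ((e.symm.trans e').open_source.mem_nhds (by simp [hy, hy']))

theorem fderiv_transition_comp {e e' e'' : OpenPartialHomeomorph X E} (he : e ∈ atlas E X)
    (he' : e' ∈ atlas E X) (he'' : e'' ∈ atlas E X) {y : E} (hy : y ∈ e.target)
    (hy' : e.symm y ∈ e'.source) (hy'' : e.symm y ∈ e''.source) :
    (fderiv ℂ (e'' ∘ e'.symm) (e' (e.symm y))).comp (fderiv ℂ (e' ∘ e.symm) y) =
      fderiv ℂ (e'' ∘ e.symm) y := by
  have h1 : DifferentiableAt ℂ (e' ∘ e.symm) y :=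
    (contDiffAt_transition he he' hy hy').differentiableAt (by simp)
  have h2 : DifferentiableAt ℂ (e'' ∘ e'.symm) ((e' ∘ e.symm) y) :=
    (contDiffAt_transition he' he'' (e'.map_source hy')
      (by simpa [e'.left_inv hy'] using hy'')).differentiableAt (by simp)
  rw [show e' (e.symm y) = (e' ∘ e.symm) y from rfl, ← fderiv_comp y h2 h1]
  refine Filter.EventuallyEq.fderiv_eq ?_
  filter_upwards [eventually_mem_source_of_mem hy hy'] with z hz
  simp [e'.left_inv hz.2]

/-- The tangent space at a point is the model space seen through the preferred chart there. The
manifold derivative is therefore an ordinary derivative of a transition map, and the later chart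
computations become calculus on E. -/
theorem mfderiv_chart_symm {e : OpenPartialHomeomorph X E} (he : e ∈ atlas E X) {y : E}
    (hy : y ∈ e.target) :
    (mfderiv 𝓘(ℂ, E) 𝓘(ℂ, E) e.symm y : E →L[ℂ] E) = chartDeriv e y := by
  have h : MDifferentiableAt 𝓘(ℂ, E) 𝓘(ℂ, E) e.symm y :=
    ((contMDiffOn_symm_of_mem_maximalAtlas (n := ω)
      (IsManifold.subset_maximalAtlas he)).contMDiffAt
      (e.open_target.mem_nhds hy)).mdifferentiableAt (by simp)
  refine (if_pos h).trans ?_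
  change fderivWithin ℂ (writtenInExtChartAt 𝓘(ℂ, E) 𝓘(ℂ, E) y e.symm) (range 𝓘(ℂ, E))
    (extChartAt 𝓘(ℂ, E) y y) = _
  simp [writtenInExtChartAt, chartDeriv, fderivWithin_univ, Function.comp_def, chartAt_self_eq]

theorem mfderiv_chart {e : OpenPartialHomeomorph X E} (he : e ∈ atlas E X) {x : X}
    (hx : x ∈ e.source) :
    (mfderiv 𝓘(ℂ, E) 𝓘(ℂ, E) e x : E →L[ℂ] E) =
      fderiv ℂ (e ∘ (chartAt E x).symm) (chartAt E x x) := by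
  have h : MDifferentiableAt 𝓘(ℂ, E) 𝓘(ℂ, E) e x :=
    ((contMDiffOn_of_mem_maximalAtlas (n := ω)
      (IsManifold.subset_maximalAtlas he)).contMDiffAt
      (e.open_source.mem_nhds hx)).mdifferentiableAt (by simp)
  refine (if_pos h).trans ?_
  change fderivWithin ℂ (writtenInExtChartAt 𝓘(ℂ, E) 𝓘(ℂ, E) x e) (range 𝓘(ℂ, E))
    (extChartAt 𝓘(ℂ, E) x x) = _
  simp [writtenInExtChartAt, fderivWithin_univ, Function.comp_def, chartAt_self_eq]

theorem CForm.inChart_apply {k : ℕ} (α : CForm E X k) {e : OpenPartialHomeomorph X E}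
    (he : e ∈ atlas E X) {y : E} (hy : y ∈ e.target) :
    α.inChart e y = (α.valueAt (e.symm y)).compContinuousLinearMap
      ((chartDeriv e y).restrictScalars ℝ) := by
  rw [← mfderiv_chart_symm he hy]
  rfl

/-- The transformation rule for the expressions of a form in two charts. -/
theorem CForm.inChart_eq_pullback {k : ℕ} (α : CForm E X k) {e e' : OpenPartialHomeomorph X E}
    (he : e ∈ atlas E X) (he' : e' ∈ atlas E X) {y : E} (hy : y ∈ e.target)
    (hy' : e.symm y ∈ e'.source) :
    α.inChart e y = (α.inChart e' (e' (e.symm y))).compContinuousLinearMap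
      ((fderiv ℂ (e' ∘ e.symm) y).restrictScalars ℝ) := by
  rw [α.inChart_apply he hy, α.inChart_apply he' (e'.map_source hy'), chartDeriv, chartDeriv,
    e'.left_inv hy', ← fderiv_transition_comp he he' (chart_mem_atlas E _) hy hy'
      (mem_chart_source E _)]
  rfl

/-- The inverse of `CForm.inChart_apply`: a form is recovered at each point of a chart domain from
its expression there, so identities can be verified in any one chart. -/
theorem CForm.valueAt_eq {k : ℕ} (α : CForm E X k) {e : OpenPartialHomeomorph X E}
    (he : e ∈ atlas E X) {x : X} (hx : x ∈ e.source) :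
    α.valueAt x = (α.inChart e (e x)).compContinuousLinearMap
      ((fderiv ℂ (e ∘ (chartAt E x).symm) (chartAt E x x)).restrictScalars ℝ) := by
  have hc := mem_chart_source E x
  have h := α.inChart_eq_pullback (chart_mem_atlas E x) he (mem_chart_target E x)
    (by simpa [(chartAt E x).left_inv hc] using hx)
  rw [(chartAt E x).left_inv hc] at h
  rw [← h, α.inChart_apply (chart_mem_atlas E x) (mem_chart_target E x), chartDeriv,
    (chartAt E x).left_inv hc, fderiv_transition_self _ (mem_chart_target E x)]
  rfl

theorem CForm.valueAt_eq_of_inChart_eq {k : ℕ} {α β : CForm E X k} {e : OpenPartialHomeomorph X E}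
    (he : e ∈ atlas E X) {x : X} (hx : x ∈ e.source) (h : α.inChart e (e x) = β.inChart e (e x)) :
    α x = β x := by
  change α.valueAt x = β.valueAt x
  rw [α.valueAt_eq he hx, β.valueAt_eq he hx, h]

theorem CForm.dbar_valueAt {k : ℕ} (α : CForm E X k) (x : X) :
    α.dbar.valueAt x = dbarModel (α.inChart (chartAt E x)) (chartAt E x x) := by
  have h := mfderiv_chart (chart_mem_atlas E x) (mem_chart_source E x)
  rw [fderiv_transition_self _ (mem_chart_target E x)] at h
  change (dbarModel (α.inChart (chartAt E x)) (chartAt E x x)).compContinuousLinearMap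
    ((mfderiv 𝓘(ℂ, E) 𝓘(ℂ, E) (chartAt E x) x : E →L[ℂ] E).restrictScalars ℝ) = _
  rw [h]
  rfl

/-- The operator `∂̄` is computed by the same formula in every chart. -/
theorem CForm.dbar_inChart {k : ℕ} {α : CForm E X k} (hα : α.IsSmooth)
    {e : OpenPartialHomeomorph X E} (he : e ∈ atlas E X) {y : E} (hy : y ∈ e.target) :
    α.dbar.inChart e y = dbarModel (α.inChart e) y := by
  rw [α.dbar.inChart_apply he hy, CForm.dbar_valueAt, chartDeriv]
  set c := chartAt E (e.symm y) with hc
  have hcs : e.symm y ∈ c.source := mem_chart_source E _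
  have hloc : α.inChart e =ᶠ[𝓝 y] fun z => (α.inChart c ((c ∘ e.symm) z)).compContinuousLinearMap
      ((fderiv ℂ (c ∘ e.symm) z).restrictScalars ℝ) := by
    filter_upwards [eventually_mem_source_of_mem hy hcs] with z hz
    exact α.inChart_eq_pullback he (chart_mem_atlas E _) hz.1 hz.2
  rw [hloc.dbarModel_eq, dbarModel_pullback]
  · rfl
  · exact hα.differentiableAt _
  · exact (contDiffAt_transition he (chart_mem_atlas E _) hy hcs).of_le le_top

theorem contDiffAt_fderiv_restrictScalars {τ : E → E} {y : E} (h : ContDiffAt ℂ ω τ y) :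
    ContDiffAt ℝ ∞ (fun z => (fderiv ℂ τ z).restrictScalars ℝ) y := by
  have h1 : ContDiffAt ℂ ω (fderiv ℂ τ) y := h.fderiv_right le_top
  have h2 : ContDiffAt ℝ ∞ (fderiv ℂ τ) y := (h1.restrict_scalars ℝ).of_le le_top
  exact (ContinuousLinearMap.restrictScalarsL ℂ E E ℝ ℝ).contDiff.contDiffAt.comp y h2

theorem CForm.inChart_contDiffAt_of_contDiffAt [FiniteDimensional ℂ E] {k : ℕ} {α : CForm E X k}
    {e e' : OpenPartialHomeomorph X E} (he : e ∈ atlas E X) (he' : e' ∈ atlas E X) {x : X}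
    (hx : x ∈ e.source) (hx' : x ∈ e'.source) (h : ContDiffAt ℝ ∞ (α.inChart e) (e x)) :
    ContDiffAt ℝ ∞ (α.inChart e') (e' x) := by
  have hy : e' x ∈ e'.target := e'.map_source hx'
  have hy' : e'.symm (e' x) ∈ e.source := by rwa [e'.left_inv hx']
  have : FiniteDimensional ℝ E := FiniteDimensional.complexToReal E
  have hloc : α.inChart e' =ᶠ[𝓝 (e' x)] fun z =>
      (α.inChart e ((e ∘ e'.symm) z)).compContinuousLinearMap
      ((fderiv ℂ (e ∘ e'.symm) z).restrictScalars ℝ) := by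
    filter_upwards [eventually_mem_source_of_mem hy hy'] with z hz
    exact α.inChart_eq_pullback he' he hz.1 hz.2
  refine ContDiffAt.congr_of_eventuallyEq ?_ hloc
  have hτ := contDiffAt_transition he' he hy hy'
  refine ContDiffAt.form_pullback ?_ (contDiffAt_fderiv_restrictScalars hτ)
  refine ContDiffAt.comp (g := α.inChart e) (f := e ∘ e'.symm) (e' x) ?_ ((hτ.restrict_scalars ℝ).of_le le_top)
  simpa [e'.left_inv hx'] using h

/-- Smoothness can be checked in one chart around each point. -/
theorem CForm.isSmooth_of_contDiffAt [FiniteDimensional ℂ E] {k : ℕ} {α : CForm E X k}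
    (h : ∀ x, ∃ e ∈ atlas E X, x ∈ e.source ∧ ContDiffAt ℝ ∞ (α.inChart e) (e x)) :
    α.IsSmooth := by
  intro e' he' y hy
  obtain ⟨e, he, hx, hc⟩ := h (e'.symm y)
  have := CForm.inChart_contDiffAt_of_contDiffAt he he' hx (e'.map_target hy) hc
  rw [e'.right_inv hy] at this
  exact this.contDiffWithinAt

theorem CForm.inChart_eventuallyEq_zero {k : ℕ} {α : CForm E X k} {x : X}
    (h : ∀ᶠ z in 𝓝 x, α z = 0) {e : OpenPartialHomeomorph X E} (he : e ∈ atlas E X)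
    (hx : x ∈ e.source) : α.inChart e =ᶠ[𝓝 (e x)] fun _ => 0 := by
  have h1 : ContinuousAt e.symm (e x) := e.continuousAt_symm (e.map_source hx)
  rw [ContinuousAt, e.left_inv hx] at h1
  filter_upwards [h1.eventually h, e.open_target.mem_nhds (e.map_source hx)] with z hz hz'
  rw [α.inChart_apply he hz']
  have : α.valueAt (e.symm z) = 0 := hz
  rw [this]
  rfl

open scoped Classical in
/-- The form on `X` which is given by `θ` in the chart `e` and vanishes outside the domain of
`e`. -/
def push {k : ℕ} (e : OpenPartialHomeomorph X E) (θ : E → E [⋀^Fin k]→L[ℝ] ℂ) : CForm E X k :=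
  fun x => if x ∈ e.source then ((θ (e x)).compContinuousLinearMap
    ((fderiv ℂ (e ∘ (chartAt E x).symm) (chartAt E x x)).restrictScalars ℝ) :
      E [⋀^Fin k]→L[ℝ] ℂ) else 0

section Push

variable {k : ℕ} {e : OpenPartialHomeomorph X E} {θ : E → E [⋀^Fin k]→L[ℝ] ℂ}

omit [IsManifold 𝓘(ℂ, E) ω X] in
theorem push_valueAt_of_mem {x : X} (hx : x ∈ e.source) :
    (push e θ).valueAt x = (θ (e x)).compContinuousLinearMap
      ((fderiv ℂ (e ∘ (chartAt E x).symm) (chartAt E x x)).restrictScalars ℝ) :=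
  if_pos hx

omit [IsManifold 𝓘(ℂ, E) ω X] in
theorem push_apply_of_notMem {x : X} (hx : x ∉ e.source) : push e θ x = 0 := if_neg hx

theorem push_inChart (he : e ∈ atlas E X) {y : E} (hy : y ∈ e.target) :
    (push e θ).inChart e y = θ y := by
  set x := e.symm y with hx
  have hxs : x ∈ e.source := e.map_target hy
  have h1 := fderiv_transition_comp he (chart_mem_atlas E x) he hy (mem_chart_source E x) hxs
  rw [fderiv_transition_self e hy] at h1
  rw [CForm.inChart_apply _ he hy, push_valueAt_of_mem hxs, chartDeriv, e.right_inv hy]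
  ext v
  simp only [ContinuousAlternatingMap.compContinuousLinearMap_apply]
  congr 1
  ext i
  exact congrArg (fun L : E →L[ℂ] E => L (v i)) h1

theorem push_inChart_transition (he : e ∈ atlas E X) {e' : OpenPartialHomeomorph X E}
    (he' : e' ∈ atlas E X) {y : E} (hy : y ∈ e'.target) (hy' : e'.symm y ∈ e.source) :
    (push e θ).inChart e' y = (θ (e (e'.symm y))).compContinuousLinearMap
      ((fderiv ℂ (e ∘ e'.symm) y).restrictScalars ℝ) := by
  rw [CForm.inChart_eq_pullback _ he' he hy hy', push_inChart he (e.map_source hy')]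

omit [IsManifold 𝓘(ℂ, E) ω X] in
theorem push_apply_eq_zero {x : X} (hx : x ∉ e.symm '' tsupport θ) : push e θ x = 0 := by
  by_cases h : x ∈ e.source
  · have h0 : θ (e x) = 0 := image_eq_zero_of_notMem_tsupport fun hmem =>
      hx ⟨e x, hmem, e.left_inv h⟩
    change (push e θ).valueAt x = 0
    rw [push_valueAt_of_mem h, h0]
    rfl
  · exact push_apply_of_notMem h

omit [IsManifold 𝓘(ℂ, E) ω X] in
-- The image in X of the compact support is compact, hence closed since X is Hausdorff. This makes
-- extension by zero smooth across the boundary of the chart domain.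
theorem push_eventually_eq_zero [T2Space X] (hθ : HasCompactSupport θ)
    (hs : tsupport θ ⊆ e.target) {x : X} (hx : x ∉ e.source) : ∀ᶠ z in 𝓝 x, push e θ z = 0 := by
  have hc : IsClosed (e.symm '' tsupport θ) :=
    (IsCompact.image_of_continuousOn hθ (e.continuousOn_symm.mono hs)).isClosed
  have hx' : x ∉ e.symm '' tsupport θ := by
    rintro ⟨y, hy, rfl⟩
    exact hx (e.map_target (hs hy))
  filter_upwards [hc.isOpen_compl.mem_nhds hx'] with z hz
  exact push_apply_eq_zero hz

theorem push_isSmooth [T2Space X] [FiniteDimensional ℂ E] (he : e ∈ atlas E X)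
    (hd : ContDiff ℝ ∞ θ) (hθ : HasCompactSupport θ) (hs : tsupport θ ⊆ e.target) :
    (push e θ).IsSmooth := by
  refine CForm.isSmooth_of_contDiffAt fun x => ?_
  by_cases hx : x ∈ e.source
  · refine ⟨e, he, hx, hd.contDiffAt.congr_of_eventuallyEq ?_⟩
    filter_upwards [e.open_target.mem_nhds (e.map_source hx)] with z hz
    exact push_inChart he hz
  · refine ⟨chartAt E x, chart_mem_atlas E x, mem_chart_source E x, ?_⟩
    exact contDiffAt_const.congr_of_eventuallyEq (CForm.inChart_eventuallyEq_zero
      (push_eventually_eq_zero hθ hs hx) (chart_mem_atlas E x) (mem_chart_source E x))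

/-- Inside the chart this is the chart independence of ∂̄; outside, the form vanishes on a
neighbourhood. -/
theorem dbar_push [T2Space X] [FiniteDimensional ℂ E] (he : e ∈ atlas E X)
    (hd : ContDiff ℝ ∞ θ) (hθ : HasCompactSupport θ) (hs : tsupport θ ⊆ e.target) :
    (push e θ).dbar = push e (dbarModel θ) := by
  funext x
  by_cases hx : x ∈ e.source
  · refine CForm.valueAt_eq_of_inChart_eq he hx ?_
    have hy := e.map_source hx
    rw [CForm.dbar_inChart (push_isSmooth he hd hθ hs) he hy, push_inChart he hy]
    refine Filter.EventuallyEq.dbarModel_eq ?_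
    filter_upwards [e.open_target.mem_nhds hy] with z hz
    exact push_inChart he hz
  · rw [push_apply_of_notMem hx]
    change (push e θ).dbar.valueAt x = 0
    rw [CForm.dbar_valueAt, (CForm.inChart_eventuallyEq_zero
      (push_eventually_eq_zero hθ hs hx) (chart_mem_atlas E x) (mem_chart_source E x)).dbarModel_eq]
    exact dbarModel_zero _

omit [IsManifold 𝓘(ℂ, E) ω X] in
theorem push_hasBidegree {p q : ℕ} {θ : E → E [⋀^Fin (p + q)]→L[ℝ] ℂ}
    (h : ∀ (y : E) (ζ : ℂ) (v : Fin (p + q) → E),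
      θ y (fun i => ζ • v i) = ζ ^ p * (starRingEnd ℂ ζ) ^ q * θ y v) :
    (push e θ).HasBidegree p q := by
  intro x ζ v
  by_cases hx : x ∈ e.source
  · have h1 := push_valueAt_of_mem (θ := θ) hx
    change (push e θ).valueAt x (fun i => ζ • v i) = _ * (push e θ).valueAt x v
    rw [h1]
    have h2 := h (e x) ζ (fun i => fderiv ℂ (e ∘ (chartAt E x).symm) (chartAt E x x) (v i))
    refine Eq.trans ?_ h2
    change θ (e x) _ = θ (e x) _
    congr 1
    ext i
    exact (fderiv ℂ (e ∘ (chartAt E x).symm) (chartAt E x x)).map_smul ζ (v i)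
  · rw [push_apply_of_notMem hx]
    change (0 : ℂ) = _ * (0 : ℂ)
    rw [mul_zero]

end Push

theorem CForm.HasBidegree.inChart {p q : ℕ} {α : CForm E X (p + q)} (hα : α.HasBidegree p q)
    {e : OpenPartialHomeomorph X E} (he : e ∈ atlas E X) {y : E} (hy : y ∈ e.target) (ζ : ℂ)
    (v : Fin (p + q) → E) :
    α.inChart e y (fun i => ζ • v i) = ζ ^ p * (starRingEnd ℂ ζ) ^ q * α.inChart e y v := by
  rw [α.inChart_apply he hy]
  have h2 := hα (e.symm y) ζ (fun i => chartDeriv e y (v i))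
  refine Eq.trans ?_ h2
  change α.valueAt _ _ = α.valueAt _ _
  congr 1
  ext i
  exact (chartDeriv e y).map_smul ζ (v i)

end Charts

end

end ComplexForms

/-! ### Integrals with parameters and averaging over rotations. -/

namespace ComplexForms

open Complex Filter Topology Set MeasureTheory

noncomputable section

section Parametric

variable {P G W : Type*} [NormedAddCommGroup P] [NormedSpace ℝ P] [FiniteDimensional ℝ P]
  [NormedAddCommGroup G] [NormedSpace ℝ G] [FiniteDimensional ℝ G] [MeasurableSpace G]
  [BorelSpace G] [NormedAddCommGroup W] [NormedSpace ℝ W]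
  {μ : Measure G} [IsLocallyFiniteMeasure μ] {F : P → G → W} {K : Set G}

omit [FiniteDimensional ℝ P] in
-- The integral is the value at 0 of the convolution of the indicator function of K with x ↦ F(p,
-- -x), so smoothness of convolutions depending on a parameter applies.
theorem contDiff_setIntegral [SigmaFinite μ] (hK : IsCompact K)
    (hF : ContDiff ℝ ∞ fun q : P × G => F q.1 q.2) :
    ContDiff ℝ ∞ fun p => ∫ t in K, F p t ∂μ := by
  obtain ⟨R, hR0, hR⟩ : ∃ R > 0, K ⊆ Metric.closedBall (0 : G) R := by
    obtain ⟨R, hR⟩ := hK.isBounded.subset_closedBall (0 : G)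
    exact ⟨max R 1, by positivity, hR.trans (Metric.closedBall_subset_closedBall (le_max_left _ _))⟩
  -- The convolution theorem needs a compactly supported second factor; χ supplies the support and
  -- equals 1 on K.
  let χ : ContDiffBump (0 : G) := ⟨R, R + 1, hR0, by linarith⟩
  let g : P → G → W := fun p x => χ (-x) • F p (-x)
  have h := contDiffOn_convolution_right_with_param (n := (⊤ : ℕ∞)) (μ := μ)
    (f := K.indicator fun _ => (1 : ℝ))
    (ContinuousLinearMap.lsmul ℝ ℝ) (g := g) (s := univ) (k := Metric.closedBall 0 (R + 1))
    isOpen_univ (isCompact_closedBall _ _) ?_ ?_ ?_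
  · have h2 := h.comp (s := univ) (f := fun p : P => (p, (0 : G)))
      (contDiff_id.prodMk contDiff_const).contDiffOn (by intro; simp)
    rw [contDiffOn_univ] at h2
    convert h2 using 1
    ext p
    simp only [Function.comp_apply, convolution_def, zero_sub, g, neg_neg,
      ContinuousLinearMap.lsmul_apply]
    rw [← integral_indicator hK.measurableSet]
    congr 1
    ext t
    by_cases ht : t ∈ K
    · simp [ht, χ.one_of_mem_closedBall (hR ht)]
    · simp [ht]
  · intro p x _ hx
    have : χ (-x) = 0 := by
      apply χ.zero_of_le_dist
      rw [dist_zero_right, norm_neg]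
      simp only [Metric.mem_closedBall, dist_zero_right, not_le] at hx
      exact hx.le
    simp [g, this]
  · exact ((integrable_indicator_iff hK.measurableSet).2
      (integrableOn_const hK.measure_lt_top.ne)).locallyIntegrable
  · refine ContDiff.contDiffOn ?_
    refine ContDiff.smul (χ.contDiff.comp contDiff_snd.neg) ?_
    exact hF.comp (contDiff_fst.prodMk contDiff_snd.neg)

omit [FiniteDimensional ℝ P] [FiniteDimensional ℝ G] [MeasurableSpace G] [BorelSpace G] in
theorem continuous_fderiv_param (hF : ContDiff ℝ 1 fun q : P × G => F q.1 q.2) (p : P) :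
    Continuous fun t => fderiv ℝ (fun p => F p t) p := by
  have heq : ∀ t : G, fderiv ℝ (fun p => F p t) p =
      (fderiv ℝ (fun q : P × G => F q.1 q.2) (p, t)).comp (ContinuousLinearMap.inl ℝ P G) :=
    fun t => (HasFDerivAt.comp (g := fun q : P × G => F q.1 q.2) (f := fun p => (p, t)) p
      (hF.differentiable one_ne_zero (p, t)).hasFDerivAt (hasFDerivAt_prodMk_left p t)).fderiv
  simp only [heq]
  exact ((hF.continuous_fderiv one_ne_zero).comp (Continuous.prodMk_right p)).clm_comp
    continuous_const

theorem one_le_infty : (1 : WithTop ℕ∞) ≤ ∞ := by exact_mod_cast le_top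

theorem hasFDerivAt_setIntegral (hK : IsCompact K)
    (hF : ContDiff ℝ 1 fun q : P × G => F q.1 q.2) (p : P) :
    HasFDerivAt (fun p => ∫ t in K, F p t ∂μ) (∫ t in K, fderiv ℝ (fun p => F p t) p ∂μ) p := by
  have hd : ∀ (p : P) (t : G), HasFDerivAt (fun p => F p t)
      ((fderiv ℝ (fun q : P × G => F q.1 q.2) (p, t)).comp (ContinuousLinearMap.inl ℝ P G)) p := by
    intro p t
    exact HasFDerivAt.comp (g := fun q : P × G => F q.1 q.2) (f := fun p => (p, t)) p
      (hF.differentiable one_ne_zero (p, t)).hasFDerivAt (hasFDerivAt_prodMk_left p t)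
  have hc : Continuous fun q : P × G =>
      (fderiv ℝ (fun q : P × G => F q.1 q.2) q).comp (ContinuousLinearMap.inl ℝ P G) :=
    (hF.continuous_fderiv one_ne_zero).clm_comp continuous_const
  obtain ⟨C, hC⟩ := ((isCompact_closedBall p 1).prod hK).exists_bound_of_continuousOn hc.continuousOn
  have hfin : IsFiniteMeasure (μ.restrict K) := ⟨by simpa using hK.measure_lt_top⟩
  have hcont : ∀ p, Continuous (F p) := fun p => hF.continuous.comp (Continuous.prodMk_right p)
  have heq : ∀ p t, fderiv ℝ (fun p => F p t) p = _ := fun p t => (hd p t).fderiv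
  refine hasFDerivAt_integral_of_dominated_of_fderiv_le (μ := μ.restrict K) (bound := fun _ => C)
    (s := Metric.closedBall p 1) (F := F) (F' := fun p t => fderiv ℝ (fun p => F p t) p)
    (Metric.closedBall_mem_nhds p one_pos) ?_ ?_ ?_ ?_ ?_ ?_
  · exact Eventually.of_forall fun q => (hcont q).aestronglyMeasurable
  · exact (hcont p).continuousOn.integrableOn_compact hK
  · exact (continuous_fderiv_param hF p).aestronglyMeasurable
  · refine (ae_restrict_mem hK.measurableSet).mono fun t ht q hq => ?_
    rw [heq]
    exact hC (q, t) ⟨hq, ht⟩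
  · exact integrable_const C
  · refine Eventually.of_forall fun t q _ => ?_
    exact (hd q t).differentiableAt.hasFDerivAt

end Parametric

section Rotation

variable {E : Type*} [NormedAddCommGroup E] [NormedSpace ℂ E] [FiniteDimensional ℂ E]
  [MeasurableSpace E] [BorelSpace E] (μ : Measure E) [μ.IsAddHaarMeasure]

/-- The real determinant of a complex linear map is the squared modulus of its complex determinant,
which is 1 for multiplication by a number of modulus one. -/
theorem integral_comp_complex_smul {W : Type*} [NormedAddCommGroup W] [NormedSpace ℝ W] {ζ : ℂ}
    (hζ : ‖ζ‖ = 1) (f : E → W) : ∫ w, f (ζ • w) ∂μ = ∫ w, f w ∂μ := by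
  have : FiniteDimensional ℝ E := FiniteDimensional.complexToReal E
  let A : E →ₗ[ℂ] E := ζ • LinearMap.id
  have hdet : LinearMap.det (A.restrictScalars ℝ) = 1 := by
    rw [LinearMap.det_restrictScalars, Algebra.norm_complex_apply]
    simp [A, LinearMap.det_smul, Complex.normSq_eq_norm_sq, hζ]
  have hmap := Measure.map_linearMap_addHaar_eq_smul_addHaar μ (f := A.restrictScalars ℝ)
    (by rw [hdet]; exact one_ne_zero)
  rw [hdet] at hmap
  simp only [inv_one, abs_one, ENNReal.ofReal_one, one_smul] at hmap
  have hζ0 : ζ ≠ 0 := by rintro rfl; simp at hζ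
  have hemb : MeasurableEmbedding (fun w : E => ζ • w) :=
    (Homeomorph.smulOfNeZero ζ hζ0).measurableEmbedding
  have := hemb.integral_map (μ := μ) f
  rw [← this]
  exact congrArg (fun ν => ∫ w, f w ∂ν) hmap

/-- There are arbitrarily concentrated smooth bump functions invariant under multiplication by
complex numbers of modulus one. -/
theorem exists_rotation_invariant_bump {ε : ℝ} (hε : 0 < ε) :
    ∃ ρ : E → ℝ, ContDiff ℝ ∞ ρ ∧ (∀ w, ε < ‖w‖ → ρ w = 0) ∧
      (∀ (ζ : ℂ) w, ‖ζ‖ = 1 → ρ (ζ • w) = ρ w) ∧ ∫ w, ρ w ∂μ = 1 := by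
  have : FiniteDimensional ℝ E := FiniteDimensional.complexToReal E
  -- The norm of E need not be smooth away from 0. The squared Euclidean norm transported by a
  -- complex linear isomorphism is smooth and still invariant under multiplication by unit complex
  -- numbers.
  let L : E ≃L[ℂ] EuclideanSpace ℂ (Fin (Module.finrank ℂ E)) :=
    ContinuousLinearEquiv.ofFinrankEq (by simp)
  obtain ⟨r, hr, hrε⟩ : ∃ r > 0, ∀ w : E, ‖L w‖ ≤ r → ‖w‖ ≤ ε := by
    refine ⟨ε / (‖(L.symm : EuclideanSpace ℂ (Fin (Module.finrank ℂ E)) →L[ℂ] E)‖ + 1), by positivity, fun w hw => ?_⟩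
    have h1 : ‖w‖ ≤ ‖(L.symm : EuclideanSpace ℂ (Fin (Module.finrank ℂ E)) →L[ℂ] E)‖ * ‖L w‖ := by
      simpa using (L.symm : EuclideanSpace ℂ (Fin (Module.finrank ℂ E)) →L[ℂ] E).le_opNorm (L w)
    have h2 : ‖(L.symm : EuclideanSpace ℂ (Fin (Module.finrank ℂ E)) →L[ℂ] E)‖ * ‖L w‖ ≤ (‖(L.symm : EuclideanSpace ℂ (Fin (Module.finrank ℂ E)) →L[ℂ] E)‖ + 1) *
        (ε / (‖(L.symm : EuclideanSpace ℂ (Fin (Module.finrank ℂ E)) →L[ℂ] E)‖ + 1)) := by gcongr; linarith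
    rw [mul_div_cancel₀ _ (by positivity)] at h2
    exact h1.trans h2
  let ρ₀ : E → ℝ := fun w => Real.smoothTransition (1 - ‖L w‖ ^ 2 / r ^ 2)
  have hd : ContDiff ℝ ∞ ρ₀ := by
    refine Real.smoothTransition.contDiff.comp (contDiff_const.sub (ContDiff.div_const ?_ _))
    exact ((L : E →L[ℂ] EuclideanSpace ℂ (Fin (Module.finrank ℂ E))).restrictScalars ℝ).contDiff.norm_sq ℝ
  have hz : ∀ w, ε < ‖w‖ → ρ₀ w = 0 := by
    intro w hw
    refine Real.smoothTransition.zero_of_nonpos ?_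
    have h1 : r < ‖L w‖ := by
      by_contra h
      exact absurd (hrε w (not_lt.1 h)) (not_le.2 hw)
    rw [sub_nonpos, one_le_div (by positivity)]
    gcongr
  have hinv : ∀ (ζ : ℂ) w, ‖ζ‖ = 1 → ρ₀ (ζ • w) = ρ₀ w := by
    intro ζ w hζ
    simp [ρ₀, norm_smul, hζ]
  have hcs : HasCompactSupport ρ₀ := by
    refine HasCompactSupport.intro (isCompact_closedBall (0 : E) ε) fun w hw => hz w ?_
    simpa using hw
  have hpos : 0 < ∫ w, ρ₀ w ∂μ := by
    refine hd.continuous.integral_pos_of_hasCompactSupport_nonneg_nonzero hcs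
      (fun w => Real.smoothTransition.nonneg _) (x := 0) ?_
    simp [ρ₀, Real.smoothTransition.one]
  refine ⟨fun w => (∫ w, ρ₀ w ∂μ)⁻¹ * ρ₀ w, contDiff_const.mul hd, fun w hw => ?_,
    fun ζ w hζ => ?_, ?_⟩
  · simp [hz w hw]
  · simp [hinv ζ w hζ]
  · rw [integral_const_mul, inv_mul_cancel₀ hpos.ne']

end Rotation

end

end ComplexForms

/-! ### A homotopy formula: mollification changes (0,3)-forms by exact forms. -/

namespace ComplexForms

open Complex Filter Topology Set MeasureTheory
open scoped Pointwise

noncomputable section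

section Homotopy

variable {E : Type*} [NormedAddCommGroup E] [NormedSpace ℂ E]

/-- The linear map sending the derivative of a form to its `∂̄`. -/
def dbarSymbol (E : Type*) [NormedAddCommGroup E] [NormedSpace ℂ E] (k : ℕ) :
    (E →L[ℝ] E [⋀^Fin k]→L[ℝ] ℂ) →L[ℝ] E [⋀^Fin (k + 1)]→L[ℝ] ℂ :=
  (ContinuousAlternatingMap.alternatizeUncurryFinCLM ℝ E ℂ).comp
    ((1 / 2 : ℂ) • (ContinuousLinearMap.id ℝ _ + I •
      (ContinuousLinearMap.compL ℝ E E (E [⋀^Fin k]→L[ℝ] ℂ)).flip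
        (I • ContinuousLinearMap.id ℝ E)))

theorem dbarSymbol_apply {k : ℕ} (L : E →L[ℝ] E [⋀^Fin k]→L[ℝ] ℂ) :
    dbarSymbol E k L = ContinuousAlternatingMap.alternatizeUncurryFin (antilinearPart L) := rfl

omit [NormedSpace ℂ E] in
theorem map_fderiv_setIntegral [NormedSpace ℝ E] [FiniteDimensional ℝ E] {G F W : Type*} [NormedAddCommGroup G]
    [NormedSpace ℝ G] [FiniteDimensional ℝ G] [MeasurableSpace G] [BorelSpace G]
    [NormedAddCommGroup F] [NormedSpace ℝ F] [CompleteSpace F]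
    [NormedAddCommGroup W] [NormedSpace ℝ W] [CompleteSpace W] {ν : Measure G}
    [SigmaFinite ν] [IsLocallyFiniteMeasure ν] {K : Set G} (hK : IsCompact K) {f : E → G → F}
    (hf : ContDiff ℝ 1 fun q : E × G => f q.1 q.2) (T : (E →L[ℝ] F) →L[ℝ] W) (z : E) :
    T (fderiv ℝ (fun z => ∫ t in K, f z t ∂ν) z) = ∫ t in K, T (fderiv ℝ (fun z => f z t) z) ∂ν := by
  rw [(hasFDerivAt_setIntegral hK hf z).fderiv]
  exact (T.integral_comp_comm
    ((continuous_fderiv_param hf z).continuousOn.integrableOn_compact hK)).symm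

variable [FiniteDimensional ℂ E] [MeasurableSpace E] [BorelSpace E] (μ : Measure E)
  [μ.IsAddHaarMeasure] (b : Module.Basis (Fin 3) ℂ E) {ρ : E → ℝ} {ε : ℝ} {g : E → ℂ}

/-- The `(0, 2)`-form whose `∂̄` is the difference between `g dz̄₁ ∧ dz̄₂ ∧ dz̄₃` and its
mollification by `ρ`. -/
def mollifyHomotopy (ρ : E → ℝ) (ε : ℝ) (g : E → ℂ) (z : E) : E [⋀^Fin 2]→L[ℝ] ℂ :=
  ∫ t in Icc (0 : ℝ) 1 ×ˢ Metric.closedBall (0 : E) ε,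
    g (z - t.1 • t.2) • ((2 * ρ t.2 : ℂ) • (conjVolForm b).curryLeft t.2) ∂(volume.prod μ)

include μ in
-- By rotation invariance of ρ, the integral of ρ(w) g(z - s e^{iθ} w) over w does not depend on θ.
-- Its derivative at θ = 0 is -s times the integral in question.
theorem integral_rotation_derivative (hρ : ContDiff ℝ ∞ ρ) (hsupp : ∀ w, ε < ‖w‖ → ρ w = 0)
    (hinv : ∀ (ζ : ℂ) w, ‖ζ‖ = 1 → ρ (ζ • w) = ρ w) (hg : ContDiff ℝ ∞ g) (z : E) {s : ℝ}
    (hs : s ≠ 0) :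
    ∫ w in Metric.closedBall (0 : E) ε, (ρ w : ℂ) * fderiv ℝ g (z - s • w) (I • w) ∂μ = 0 := by
  have : FiniteDimensional ℝ E := FiniteDimensional.complexToReal E
  let F : ℝ → E → ℂ := fun θ w => (ρ w : ℂ) * g (z - s • (exp (θ * I) • w))
  have hexp : ContDiff ℝ ∞ fun θ : ℝ => exp (θ * I) :=
    (ofRealCLM.contDiff.mul contDiff_const).cexp
  have hF : ContDiff ℝ ∞ fun q : ℝ × E => F q.1 q.2 := by
    refine ContDiff.mul (ofRealCLM.contDiff.comp (hρ.comp contDiff_snd)) (hg.comp ?_)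
    exact contDiff_const.sub (((hexp.comp contDiff_fst).smul contDiff_snd).const_smul s)
  have hder := hasFDerivAt_setIntegral (μ := μ) (isCompact_closedBall (0 : E) ε)
    (hF.of_le one_le_infty) 0
  have hconst : (fun θ => ∫ w in Metric.closedBall (0 : E) ε, F θ w ∂μ) =
      fun _ => ∫ w, (ρ w : ℂ) * g (z - s • w) ∂μ := by
    ext1 θ
    rw [setIntegral_eq_integral_of_forall_compl_eq_zero]
    · rw [← integral_comp_complex_smul μ (norm_exp_ofReal_mul_I θ)
        (fun w => (ρ w : ℂ) * g (z - s • w))]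
      simp only [hinv _ _ (norm_exp_ofReal_mul_I θ), F]
    · intro w hw
      simp [F, hsupp w (by simpa using hw)]
  rw [hconst] at hder
  have h0 := hder.unique (hasFDerivAt_const _ _)
  have hFd : ∀ w, HasDerivAt (fun θ => F θ w) ((ρ w : ℂ) * fderiv ℝ g (z - s • w) (-(s • (I • w)))) 0 := by
    intro w
    have h1 : HasDerivAt (fun θ : ℝ => exp (θ * I)) I 0 := by
      have := ((hasDerivAt_exp ((0 : ℝ) * I)).comp (0 : ℝ)
        (((hasDerivAt_id (0 : ℝ)).ofReal_comp).mul_const I))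
      simpa [Function.comp_def] using this
    have h2 : HasDerivAt (fun θ : ℝ => z - s • (exp (θ * I) • w)) (-(s • (I • w))) 0 := by
      simpa using ((h1.smul_const w).const_smul s).const_sub z
    have h3 : HasFDerivAt g (fderiv ℝ g (z - s • w)) (z - s • (exp ((0 : ℝ) * I) • w)) := by
      simpa using (hg.differentiable (by simp) (z - s • w)).hasFDerivAt
    exact (h3.comp_hasDerivAt 0 h2).const_mul _
  have h4 : ∫ w in Metric.closedBall (0 : E) ε,
      (fderiv ℝ (fun θ => F θ w) 0) 1 ∂μ = 0 := by
    rw [← ContinuousLinearMap.integral_apply, h0]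
    · rfl
    · exact (continuous_fderiv_param (hF.of_le one_le_infty) 0).continuousOn.integrableOn_compact
        (isCompact_closedBall _ _)
  have h5 : ∀ w, (fderiv ℝ (fun θ => F θ w) 0) 1 =
      (-s : ℂ) * ((ρ w : ℂ) * fderiv ℝ g (z - s • w) (I • w)) := by
    intro w
    rw [fderiv_apply_one_eq_deriv, (hFd w).deriv, map_neg, map_smul, real_smul]
    ring
  simp only [h5] at h4
  rw [integral_const_mul] at h4
  simpa [hs] using h4

/-- Twice the conjugate-linear part of Dg at w is Dg(w) + I Dg(Iw). The first term is minus the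
s-derivative of g(z - s w) and integrates over [0,1] to g(z) - g(z - w). The second averages to 0 by
rotation invariance. -/
theorem setIntegral_homotopy (hρ : ContDiff ℝ ∞ ρ) (hsupp : ∀ w, ε < ‖w‖ → ρ w = 0)
    (hinv : ∀ (ζ : ℂ) w, ‖ζ‖ = 1 → ρ (ζ • w) = ρ w) (hint : ∫ w, ρ w ∂μ = 1)
    (hg : ContDiff ℝ ∞ g) (z : E) :
    ∫ t in Icc (0 : ℝ) 1 ×ˢ Metric.closedBall (0 : E) ε,
      (2 * ρ t.2 : ℂ) * antilinearPart (fderiv ℝ g (z - t.1 • t.2)) t.2 ∂(volume.prod μ) =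
      g z - ∫ w, (ρ w : ℂ) * g (z - w) ∂μ := by
  have : FiniteDimensional ℝ E := FiniteDimensional.complexToReal E
  have hρc : Continuous fun w => (ρ w : ℂ) := continuous_ofReal.comp hρ.continuous
  have hDc : Continuous (fderiv ℝ g) := hg.continuous_fderiv (by simp)
  have hcs : HasCompactSupport fun w => (ρ w : ℂ) :=
    HasCompactSupport.intro (isCompact_closedBall (0 : E) ε) fun w hw => by
      simp [hsupp w (by simpa using hw)]
  have hK : IsCompact (Icc (0 : ℝ) 1 ×ˢ Metric.closedBall (0 : E) ε) :=
    isCompact_Icc.prod (isCompact_closedBall _ _)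
  have hc1 : Continuous fun t : ℝ × E => (ρ t.2 : ℂ) * fderiv ℝ g (z - t.1 • t.2) t.2 :=
    (hρc.comp continuous_snd).mul ((hDc.comp (by fun_prop)).clm_apply continuous_snd)
  have hc2 : Continuous fun t : ℝ × E => (ρ t.2 : ℂ) * fderiv ℝ g (z - t.1 • t.2) (I • t.2) :=
    (hρc.comp continuous_snd).mul ((hDc.comp (by fun_prop)).clm_apply (continuous_snd.const_smul I))
  have hi1 := hc1.continuousOn.integrableOn_compact (μ := (volume : Measure ℝ).prod μ) hK
  have hi2 := hc2.continuousOn.integrableOn_compact (μ := (volume : Measure ℝ).prod μ) hK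
  have hsplit : ∀ t : ℝ × E, (2 * ρ t.2 : ℂ) * antilinearPart (fderiv ℝ g (z - t.1 • t.2)) t.2 =
      (ρ t.2 : ℂ) * fderiv ℝ g (z - t.1 • t.2) t.2 +
        I * ((ρ t.2 : ℂ) * fderiv ℝ g (z - t.1 • t.2) (I • t.2)) := by
    intro t
    rw [antilinearPart_apply]
    simp only [smul_eq_mul]
    ring
  simp only [hsplit]
  rw [integral_add hi1 (hi2.const_mul I), integral_const_mul]
  -- The rotation argument divides by s, so the null set s = 0 is discarded.
  have e2 : ∫ t in Icc (0 : ℝ) 1 ×ˢ Metric.closedBall (0 : E) ε,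
      (ρ t.2 : ℂ) * fderiv ℝ g (z - t.1 • t.2) (I • t.2) ∂(volume.prod μ) = 0 := by
    rw [setIntegral_prod _ hi2]
    refine integral_eq_zero_of_ae (ae_restrict_of_ae ?_)
    have : ∀ᵐ s : ℝ, s ≠ 0 := by simp [ae_iff]
    filter_upwards [this] with s hs
    exact integral_rotation_derivative μ hρ hsupp hinv hg z hs
  have e1 : ∫ t in Icc (0 : ℝ) 1 ×ˢ Metric.closedBall (0 : E) ε,
      (ρ t.2 : ℂ) * fderiv ℝ g (z - t.1 • t.2) t.2 ∂(volume.prod μ) =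
      g z - ∫ w, (ρ w : ℂ) * g (z - w) ∂μ := by
    rw [setIntegral_prod _ hi1]
    have hi1' := hi1
    rw [IntegrableOn, ← Measure.prod_restrict] at hi1'
    rw [integral_integral_swap hi1']
    have hinner : ∀ w : E, ∫ s in Icc (0 : ℝ) 1, (ρ w : ℂ) * fderiv ℝ g (z - s • w) w =
        (ρ w : ℂ) * g z - (ρ w : ℂ) * g (z - w) := by
      intro w
      rw [integral_const_mul, integral_Icc_eq_integral_Ioc, ← intervalIntegral.integral_of_le zero_le_one]
      have hd : ∀ s ∈ uIcc (0 : ℝ) 1, HasDerivAt (fun s : ℝ => - g (z - s • w))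
          (fderiv ℝ g (z - s • w) w) s := by
        intro s _
        have h2 : HasDerivAt (fun s : ℝ => z - s • w) (-w) s := by
          simpa using ((hasDerivAt_id s).smul_const w).const_sub z
        have h3 := ((hg.differentiable (by simp) (z - s • w)).hasFDerivAt.comp_hasDerivAt s h2).fun_neg
        simpa using h3
      rw [intervalIntegral.integral_eq_sub_of_hasDerivAt hd]
      · simp
        ring
      · exact ((hDc.comp (by fun_prop)).clm_apply continuous_const).intervalIntegrable _ _
    simp only [hinner]
    rw [setIntegral_eq_integral_of_forall_compl_eq_zero]
    · have hint' : ∫ w, (ρ w : ℂ) ∂μ = ((∫ w, ρ w ∂μ : ℝ) : ℂ) := integral_ofReal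
      rw [integral_sub, integral_mul_const, hint', hint]
      · simp
      · exact (hρc.integrable_of_hasCompactSupport hcs).mul_const _
      · exact (hρc.mul (hg.continuous.comp (by fun_prop))).integrable_of_hasCompactSupport hcs.mul_right
    · intro w hw
      simp [hsupp w (by simpa using hw)]
  rw [e1, e2, mul_zero, add_zero]

omit [FiniteDimensional ℂ E] [MeasurableSpace E] [BorelSpace E] in
theorem contDiff_mollifyHomotopy_integrand (hρ : ContDiff ℝ ∞ ρ) (hg : ContDiff ℝ ∞ g) :
    ContDiff ℝ ∞ fun q : E × ℝ × E => g (q.1 - q.2.1 • q.2.2) •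
      ((2 * ρ q.2.2 : ℂ) • (conjVolForm b).curryLeft q.2.2) := by
  refine ContDiff.fun_smul (hg.comp (by fun_prop)) (ContDiff.fun_smul ?_ ?_)
  · exact contDiff_const.mul (ofRealCLM.contDiff.comp (hρ.comp (by fun_prop)))
  · exact (conjVolForm b).curryLeft.contDiff.comp (by fun_prop)

theorem contDiff_mollifyHomotopy (hρ : ContDiff ℝ ∞ ρ) (hg : ContDiff ℝ ∞ g) :
    ContDiff ℝ ∞ (mollifyHomotopy μ b ρ ε g) := by
  have : FiniteDimensional ℝ E := FiniteDimensional.complexToReal E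
  exact contDiff_setIntegral (isCompact_Icc.prod (isCompact_closedBall _ _))
    (contDiff_mollifyHomotopy_integrand b hρ hg)

/-- Differentiation passes under the integral, and ∂̄ of each integrand is 2ρ(w) times ∂̄g at z - s
w, applied to w, times dz̄₁∧dz̄₂∧dz̄₃. The contraction with w was chosen for this purpose, and the
scalar integral is `setIntegral_homotopy`. -/
theorem dbarModel_mollifyHomotopy (hρ : ContDiff ℝ ∞ ρ) (hsupp : ∀ w, ε < ‖w‖ → ρ w = 0)
    (hinv : ∀ (ζ : ℂ) w, ‖ζ‖ = 1 → ρ (ζ • w) = ρ w) (hint : ∫ w, ρ w ∂μ = 1)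
    (hg : ContDiff ℝ ∞ g) (z : E) :
    dbarModel (mollifyHomotopy μ b ρ ε g) z =
      (g z - ∫ w, (ρ w : ℂ) * g (z - w) ∂μ) • conjVolForm b := by
  have : FiniteDimensional ℝ E := FiniteDimensional.complexToReal E
  have hK : IsCompact (Icc (0 : ℝ) 1 ×ˢ Metric.closedBall (0 : E) ε) :=
    isCompact_Icc.prod (isCompact_closedBall _ _)
  have hDc : Continuous (fderiv ℝ g) := hg.continuous_fderiv (by simp)
  have hρc : Continuous fun w => (ρ w : ℂ) := continuous_ofReal.comp hρ.continuous
  have hF : ∀ t : ℝ × E, fderiv ℝ (fun z => g (z - t.1 • t.2) •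
      ((2 * ρ t.2 : ℂ) • (conjVolForm b).curryLeft t.2)) z =
      (fderiv ℝ g (z - t.1 • t.2)).smulRight
        ((2 * ρ t.2 : ℂ) • (conjVolForm b).curryLeft t.2) := by
    intro t
    rw [fderiv_smul_form, fderiv_comp_sub]
    exact (hg.differentiable (by simp) _).comp z (differentiableAt_id.sub_const _)
  rw [← setIntegral_homotopy μ hρ hsupp hinv hint hg z]
  have hint2 : IntegrableOn (fun t : ℝ × E => (2 * ρ t.2 : ℂ) *
      antilinearPart (fderiv ℝ g (z - t.1 • t.2)) t.2)
      (Icc (0 : ℝ) 1 ×ˢ Metric.closedBall (0 : E) ε) ((volume : Measure ℝ).prod μ) := by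
    refine ContinuousOn.integrableOn_compact hK (Continuous.continuousOn ?_)
    simp only [antilinearPart_apply]
    have h1 : Continuous fun t : ℝ × E => fderiv ℝ g (z - t.1 • t.2) := hDc.comp (by fun_prop)
    have h2 : Continuous fun t : ℝ × E => (ρ t.2 : ℂ) := hρc.comp continuous_snd
    fun_prop
  refine Eq.trans ?_ (((ContinuousLinearMap.id ℝ ℂ).smulRight
    (conjVolForm b)).integral_comp_comm hint2)
  rw [dbarModel, ← dbarSymbol_apply]
  refine (map_fderiv_setIntegral hK ((contDiff_mollifyHomotopy_integrand b hρ hg).of_le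
    one_le_infty) (dbarSymbol E 2) z).trans ?_
  simp only [hF]
  congr 1
  ext1 t
  rw [dbarSymbol_apply, antilinearPart_smulRight]
  have h1 := alternatizeUncurryFin_smulRight_curryLeft_conjVolForm b
    (L := (2 * ρ t.2 : ℂ) • antilinearPart (fderiv ℝ g (z - t.1 • t.2)))
    (fun ζ v => by
      have := antilinearPart_map_smul (fderiv ℝ g (z - t.1 • t.2)) ζ v
      simp only [smul_apply, this, smul_eq_mul]
      ring) t.2
  refine Eq.trans ?_ h1
  congr 1
  ext v u
  simp
  ring

theorem mollifyHomotopy_apply (hρ : ContDiff ℝ ∞ ρ) (hg : ContDiff ℝ ∞ g) (z : E)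
    (v : Fin 2 → E) : mollifyHomotopy μ b ρ ε g z v =
      ∫ t in Icc (0 : ℝ) 1 ×ˢ Metric.closedBall (0 : E) ε, g (z - t.1 • t.2) *
        ((2 * ρ t.2 : ℂ) * conjVolForm b (Matrix.vecCons t.2 v)) ∂(volume.prod μ) := by
  have : FiniteDimensional ℝ E := FiniteDimensional.complexToReal E
  have hK : IsCompact (Icc (0 : ℝ) 1 ×ˢ Metric.closedBall (0 : E) ε) :=
    isCompact_Icc.prod (isCompact_closedBall _ _)
  have hi := ((contDiff_mollifyHomotopy_integrand b hρ hg).continuous.comp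
    (Continuous.prodMk_right z)).continuousOn.integrableOn_compact
    (μ := (volume : Measure ℝ).prod μ) hK
  exact ((ContinuousAlternatingMap.apply ℝ E ℂ v).integral_comp_comm hi).symm

omit [FiniteDimensional ℂ E] [MeasurableSpace E] [BorelSpace E] in
theorem det_vecCons_smul (ζ : ℂ) (w : E) (v : Fin 2 → E) :
    b.det (Matrix.vecCons w fun i => ζ • v i) = ζ ^ 2 * b.det (Matrix.vecCons w v) := by
  have := b.det.map_smul_univ (![1, ζ, ζ]) (Matrix.vecCons w v)
  have h2 : (fun i => (![1, ζ, ζ] : Fin 3 → ℂ) i • (Matrix.vecCons w v : Fin 3 → E) i) =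
      Matrix.vecCons w fun i => ζ • v i := by
    ext i
    fin_cases i <;> simp
  rw [h2] at this
  rw [this]
  simp [Fin.prod_univ_three, pow_two]

theorem mollifyHomotopy_smul (hρ : ContDiff ℝ ∞ ρ) (hg : ContDiff ℝ ∞ g) (z : E) (ζ : ℂ) (v : Fin 2 → E) :
    mollifyHomotopy μ b ρ ε g z (fun i => ζ • v i) =
      (starRingEnd ℂ ζ) ^ 2 * mollifyHomotopy μ b ρ ε g z v := by
  rw [mollifyHomotopy_apply μ b hρ hg, mollifyHomotopy_apply μ b hρ hg, ← integral_const_mul]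
  congr 1
  ext1 t
  rw [conjVolForm_apply, conjVolForm_apply, det_vecCons_smul, map_mul, map_pow]
  ring

omit [BorelSpace E] [μ.IsAddHaarMeasure] in
theorem tsupport_mollifyHomotopy (hg : HasCompactSupport g) :
    tsupport (mollifyHomotopy μ b ρ ε g) ⊆ tsupport g + Metric.closedBall 0 ε := by
  have : FiniteDimensional ℝ E := FiniteDimensional.complexToReal E
  refine closure_minimal ?_ (IsCompact.add hg (isCompact_closedBall _ _)).isClosed
  intro z hz
  by_contra hn
  apply hz
  refine setIntegral_eq_zero_of_forall_eq_zero fun t ht => ?_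
  have : g (z - t.1 • t.2) = 0 := by
    by_contra h0
    refine hn ⟨z - t.1 • t.2, subset_tsupport _ h0, t.1 • t.2, ?_, by simp⟩
    simp only [mem_prod, mem_Icc, Metric.mem_closedBall, dist_zero_right] at ht ⊢
    rw [norm_smul, Real.norm_of_nonneg ht.1.1]
    nlinarith [norm_nonneg t.2, ht.1.2, ht.2]
  rw [this, zero_smul]

end Homotopy

end

end ComplexForms

/-! ### Automatic continuity of functionals invariant under an integral operator. -/

namespace ComplexForms

open Complex Filter Topology Set MeasureTheory

noncomputable section

section Fredholm

variable {V : Type*} [NormedAddCommGroup V] [NormedSpace ℂ V]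

/-- A linear functional which is invariant under an operator that is close to a finite rank
operator is automatically continuous. -/
theorem continuous_of_comp_eq_of_norm_sub_lt_one [CompleteSpace V] {S F : V →L[ℂ] V}
    [FiniteDimensional ℂ (LinearMap.range (F : V →ₗ[ℂ] V))] (h : ‖S - F‖ < 1) {τ : V →ₗ[ℂ] ℂ}
    (hτ : ∀ v, τ (S v) = τ v) : Continuous τ := by
  -- With U = 1 - (S - F), invariance under S gives τ ∘ U = τ ∘ F. The right side is continuous
  -- because τ is restricted to the finite-dimensional range of F, and U is invertible.
  obtain ⟨U, hU⟩ := isUnit_one_sub_of_norm_lt_one h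
  let F' : V →L[ℂ] LinearMap.range (F : V →ₗ[ℂ] V) :=
    F.codRestrict _ fun v => LinearMap.mem_range_self _ v
  let τ' : LinearMap.range (F : V →ₗ[ℂ] V) →ₗ[ℂ] ℂ := τ.comp (Submodule.subtype _)
  have h1 : ∀ v, τ ((U : V →L[ℂ] V) v) = τ' (F' v) := by
    intro v
    rw [hU]
    change τ (v - (S v - F v)) = τ (F v)
    rw [map_sub, map_sub, hτ]
    ring
  have h2 : (τ : V → ℂ) = fun v => τ' (F' ((↑U⁻¹ : V →L[ℂ] V) v)) := by
    ext v
    rw [← h1]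
    congr 1
    exact (DFunLike.congr_fun U.mul_inv v).symm
  rw [h2]
  exact (LinearMap.continuous_of_finiteDimensional τ').comp
    (F'.continuous.comp (ContinuousLinearMap.continuous _))

variable {K : Type*} [TopologicalSpace K] [CompactSpace K] [MeasurableSpace K] [BorelSpace K]
  (ν : Measure K) [IsFiniteMeasure ν]

omit [NormedSpace ℂ V] in
theorem integrable_continuous_of_compactSpace
    [SecondCountableTopology K] {f : K → V} (hf : Continuous f) : Integrable f ν := by
  obtain ⟨C, hC⟩ := isCompact_univ.exists_bound_of_continuousOn hf.continuousOn
  exact Integrable.of_bound hf.aestronglyMeasurable C (Eventually.of_forall fun x => hC x trivial)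

variable [SecondCountableTopology K]

/-- The integral operator with kernel `κ`. -/
def kernelOp (κ : C(K, V)) : C(K, ℂ) →L[ℂ] V :=
  LinearMap.mkContinuous
    { toFun := fun g => ∫ y, g y • κ y ∂ν
      map_add' := fun g g' => by
        simp only [ContinuousMap.add_apply, add_smul]
        exact integral_add (integrable_continuous_of_compactSpace ν (by fun_prop))
          (integrable_continuous_of_compactSpace ν (by fun_prop))
      map_smul' := fun c g => by
        simp only [ContinuousMap.smul_apply, smul_assoc, RingHom.id_apply]
        exact integral_smul c _ }
    (‖κ‖ * ν.real univ) fun g => by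
      refine (norm_integral_le_of_norm_le_const (C := ‖g‖ * ‖κ‖) (Eventually.of_forall fun y => ?_)).trans
        (le_of_eq (by ring))
      rw [norm_smul]
      exact mul_le_mul (g.norm_coe_le_norm y) (κ.norm_coe_le_norm y) (norm_nonneg _) (norm_nonneg _)

theorem kernelOp_apply (κ : C(K, V)) (g : C(K, ℂ)) : kernelOp ν κ g = ∫ y, g y • κ y ∂ν := rfl

theorem norm_kernelOp_le (κ : C(K, V)) : ‖kernelOp ν κ‖ ≤ ‖κ‖ * ν.real univ :=
  LinearMap.mkContinuous_norm_le _ (by positivity) _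

theorem kernelOp_sub (κ κ' : C(K, V)) : kernelOp ν (κ - κ') = kernelOp ν κ - kernelOp ν κ' := by
  ext g
  simp only [kernelOp_apply, ContinuousMap.sub_apply, smul_sub, sub_apply]
  exact integral_sub (integrable_continuous_of_compactSpace ν (by fun_prop))
    (integrable_continuous_of_compactSpace ν (by fun_prop))

omit [MeasurableSpace K] [BorelSpace K] [SecondCountableTopology K] in
/-- Continuous maps from a compact space are uniform limits of maps with values in a
finite-dimensional subspace. -/
theorem exists_finite_range_approx [T2Space K] (κ : C(K, V)) {δ : ℝ} (hδ : 0 < δ) :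
    ∃ κ' : C(K, V), ∃ W : Submodule ℂ V, FiniteDimensional ℂ W ∧ (∀ x, κ' x ∈ W) ∧ ‖κ - κ'‖ ≤ δ := by
  obtain ⟨t, ht⟩ := isCompact_univ.elim_finite_subcover (fun x : K => κ ⁻¹' Metric.ball (κ x) δ)
    (fun x => Metric.isOpen_ball.preimage κ.continuous) fun x _ => mem_iUnion.2 ⟨x, by simp [hδ]⟩
  obtain ⟨f, hf⟩ := PartitionOfUnity.exists_isSubordinate (isClosed_univ (X := K))
    (fun x : t => κ ⁻¹' Metric.ball (κ x) δ) (fun x => Metric.isOpen_ball.preimage κ.continuous)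
    (fun x hx => by simpa using ht hx)
  have hsum : ∀ x, ∑ i : t, f i x = 1 := fun x => by
    rw [← finsum_eq_sum_of_fintype]; exact f.sum_eq_one trivial
  refine ⟨⟨fun x => ∑ i : t, (f i x : ℂ) • κ i, by fun_prop⟩,
    Submodule.span ℂ (range fun i : t => κ i), FiniteDimensional.span_of_finite ℂ (finite_range _),
    fun x => Submodule.sum_mem _ fun i _ => Submodule.smul_mem _ _ (Submodule.subset_span ⟨i, rfl⟩), ?_⟩
  refine (ContinuousMap.norm_le _ hδ.le).2 fun x => ?_
  have h1 : (κ - ⟨fun x => ∑ i : t, (f i x : ℂ) • κ i, by fun_prop⟩ : C(K, V)) x =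
      ∑ i : t, (f i x : ℂ) • (κ x - κ i) := by
    simp only [smul_sub, Finset.sum_sub_distrib, ← Finset.sum_smul]
    rw [← ofReal_sum, hsum]
    simp
  rw [h1]
  calc ‖∑ i : t, (f i x : ℂ) • (κ x - κ i)‖ ≤ ∑ i : t, f i x * δ := by
        refine norm_sum_le_of_le _ fun i _ => ?_
        rw [norm_smul, norm_real, Real.norm_of_nonneg (f.nonneg i x)]
        by_cases h0 : f i x = 0
        · simp [h0]
        · refine mul_le_mul_of_nonneg_left ?_ (f.nonneg i x)
          have := hf i (subset_tsupport _ h0)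
          rw [mem_preimage, Metric.mem_ball, dist_eq_norm] at this
          exact this.le
    _ = δ := by rw [← Finset.sum_mul, hsum, one_mul]

/-- Approximating the kernels by finite-dimensional ones puts the operator within distance less than
1 of finite rank, so τ is continuous. Then τ may be moved under the integral, and the densities are
φᵢ(y) = τ(κᵢ(y)). -/
theorem exists_representation_of_kernel_invariant [CompleteSpace V] [T2Space K] {ι : Type*}
    [Fintype ι] (κ : ι → C(K, V)) (p : ι → V →L[ℂ] C(K, ℂ)) {τ : V →ₗ[ℂ] ℂ}
    (hτ : ∀ v, τ (∑ i, ∫ y, p i v y • κ i y ∂ν) = τ v) :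
    ∃ φ : ι → C(K, ℂ), ∀ v, τ v = ∑ i, ∫ y, p i v y * φ i y ∂ν := by
  let S : V →L[ℂ] V := ∑ i, (kernelOp ν (κ i)).comp (p i)
  have hS : ∀ v, S v = ∑ i, ∫ y, p i v y • κ i y ∂ν := fun v => by
    simp only [S, sum_apply]; rfl
  set B : ℝ := ∑ i, ν.real univ * ‖p i‖ with hB
  have hB0 : 0 ≤ B := Finset.sum_nonneg fun i _ => by positivity
  -- With kernels approximated to within 1/(B+1), the operators differ by at most B/(B+1) < 1.
  have hδ : 0 < 1 / (B + 1) := by positivity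
  choose κ' W hW hκW hκ using fun i => exists_finite_range_approx (κ i) hδ
  let F : V →L[ℂ] V := ∑ i, (kernelOp ν (κ' i)).comp (p i)
  have hF : LinearMap.range (F : V →ₗ[ℂ] V) ≤ ⨆ i, W i := by
    rintro _ ⟨v, rfl⟩
    simp only [F, ContinuousLinearMap.coe_coe, sum_apply]
    refine Submodule.sum_mem _ fun i _ => Submodule.mem_iSup_of_mem i ?_
    let c : K → W i := fun y => p i v y • ⟨κ' i y, hκW i y⟩
    have hc : Continuous c :=
      (p i v).continuous.smul ((κ' i).continuous.subtype_mk fun y => hκW i y)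
    have h := (W i).subtypeL.integral_comp_comm (integrable_continuous_of_compactSpace ν hc)
    change (∫ y, (W i).subtypeL (c y) ∂ν) ∈ W i
    rw [h]
    exact (∫ y, c y ∂ν).2
  have : FiniteDimensional ℂ (LinearMap.range (F : V →ₗ[ℂ] V)) :=
    Submodule.finiteDimensional_of_le hF
  have hSF : ‖S - F‖ < 1 := by
    have h1 : S - F = ∑ i, (kernelOp ν (κ i - κ' i)).comp (p i) := by
      simp only [S, F, ← Finset.sum_sub_distrib, kernelOp_sub, ContinuousLinearMap.sub_comp]
    rw [h1]
    calc ‖∑ i, (kernelOp ν (κ i - κ' i)).comp (p i)‖ ≤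
        ∑ i, 1 / (B + 1) * (ν.real univ * ‖p i‖) := by
          refine norm_sum_le_of_le _ fun i _ => ?_
          refine (ContinuousLinearMap.opNorm_comp_le _ _).trans ?_
          rw [← mul_assoc]
          refine mul_le_mul_of_nonneg_right ?_ (norm_nonneg _)
          exact (norm_kernelOp_le ν _).trans
            (mul_le_mul_of_nonneg_right (hκ i) measureReal_nonneg)
      _ = B / (B + 1) := by rw [← Finset.mul_sum, ← hB]; ring
      _ < 1 := by rw [div_lt_one (by positivity)]; linarith
  have hc : Continuous τ := continuous_of_comp_eq_of_norm_sub_lt_one hSF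
    fun v => by rw [hS, hτ]
  let T : V →L[ℂ] ℂ := ⟨τ, hc⟩
  refine ⟨fun i => ⟨fun y => τ (κ i y), hc.comp (κ i).continuous⟩, fun v => ?_⟩
  rw [← hτ v]
  change T _ = _
  rw [map_sum]
  refine Finset.sum_congr rfl fun i _ => ?_
  rw [← T.integral_comp_comm (integrable_continuous_of_compactSpace ν (by fun_prop))]
  simp only [map_smul, smul_eq_mul]
  rfl

end Fredholm

end

end ComplexForms

/-! ### Mollification of (0,3)-forms supported in one chart. -/

namespace ComplexForms

open Complex Filter Topology Set MeasureTheory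
open scoped Pointwise

noncomputable section

section Cutoff

variable {E : Type*} [NormedAddCommGroup E] [NormedSpace ℝ E] [FiniteDimensional ℝ E]

theorem exists_smooth_cutoff {K U : Set E} (hK : IsCompact K) (hU : IsOpen U) (hKU : K ⊆ U) :
    ∃ f : E → ℝ, ContDiff ℝ ∞ f ∧ HasCompactSupport f ∧ tsupport f ⊆ U ∧ ∀ x ∈ K, f x = 1 := by
  obtain ⟨K', hK', h1, h2⟩ := exists_compact_between hK hU hKU
  obtain ⟨f, h0, hf1, -⟩ := exists_contMDiffMap_zero_one_of_isClosed (n := (⊤ : ℕ∞)) 𝓘(ℝ, E)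
    isOpen_interior.isClosed_compl hK.isClosed (disjoint_compl_left_iff_subset.2 h1)
  have hs : tsupport f ⊆ K' := by
    refine closure_minimal (fun x hx => ?_) hK'.isClosed
    by_contra hn
    exact hx (h0 fun h => hn (interior_subset h))
  exact ⟨f, contMDiff_iff_contDiff.1 f.contMDiff, HasCompactSupport.of_support_subset_isCompact hK'
    ((subset_tsupport _).trans hs), hs.trans h2, hf1⟩

variable [MeasurableSpace E] [BorelSpace E] {μ : Measure E} [IsLocallyFiniteMeasure μ]

theorem contDiff_setIntegral_translate {ρ : E → ℝ} (hρ : ContDiff ℝ ∞ ρ) (hρc : HasCompactSupport ρ)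
    {K : Set E} (hK : IsCompact K) {u : E → ℂ} (hu : ContinuousOn u K) :
    ContDiff ℝ ∞ fun z => ∫ w in K, (ρ (z - w) : ℂ) * u w ∂μ := by
  have hi : Integrable (K.indicator u) μ :=
    (hu.integrableOn_compact hK).integrable_indicator hK.measurableSet
  have h := HasCompactSupport.contDiff_convolution_right (n := (⊤ : ℕ∞))
    ((ContinuousLinearMap.lsmul ℝ ℝ (E := ℂ)).flip) hρc hi.locallyIntegrable hρ
  convert! h using 1
  ext z
  rw [← integral_indicator hK.measurableSet]
  refine integral_congr_ae (Eventually.of_forall fun w => ?_)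
  by_cases hw : w ∈ K
  · simp [hw]
  · simp [hw]

omit [NormedSpace ℝ E] [FiniteDimensional ℝ E] [IsLocallyFiniteMeasure μ] [BorelSpace E] in
theorem tsupport_mollify_subset {ρ : E → ℝ} {ε : ℝ} (hρ : ∀ w, ε < ‖w‖ → ρ w = 0) {g : E → ℂ} :
    tsupport (fun z => ∫ w, (ρ (z - w) : ℂ) * g w ∂μ) ⊆ Metric.cthickening ε (tsupport g) := by
  refine closure_minimal (fun z hz => ?_) Metric.isClosed_cthickening
  by_contra hn
  refine hz (integral_eq_zero_of_ae (Eventually.of_forall fun w => ?_))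
  by_cases hw : w ∈ tsupport g
  · have : ε < ‖z - w‖ := by
      by_contra h
      exact hn (Metric.mem_cthickening_of_dist_le z w _ _ hw (by rw [dist_eq_norm]; linarith))
    simp [hρ _ this]
  · simp [image_eq_zero_of_notMem_tsupport hw]

theorem contDiff_mollify {ρ : E → ℝ} {ε : ℝ} (hρ : ContDiff ℝ ∞ ρ)
    (hρs : ∀ w, ε < ‖w‖ → ρ w = 0) {g : E → ℂ} (hg : ContDiff ℝ ∞ g) (hc : HasCompactSupport g) :
    ContDiff ℝ ∞ fun z => ∫ w, (ρ (z - w) : ℂ) * g w ∂μ := by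
  have : ProperSpace E := FiniteDimensional.proper ℝ E
  have hρc : HasCompactSupport ρ := HasCompactSupport.intro (isCompact_closedBall (0 : E) ε)
    fun w hw => hρs w (by simpa using hw)
  have := contDiff_setIntegral_translate (μ := μ) hρ hρc hc.isCompact hg.continuous.continuousOn
  convert! this using 2 with z
  rw [setIntegral_eq_integral_of_forall_compl_eq_zero]
  intro w hw
  rw [image_eq_zero_of_notMem_tsupport hw, mul_zero]

end Cutoff

section PushConj

variable {E : Type*} [NormedAddCommGroup E] [NormedSpace ℂ E]
  {X : Type*} [TopologicalSpace X] [ChartedSpace E X] (b : Module.Basis (Fin 3) ℂ E)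

omit b in
theorem push_apply_of_mem {k : ℕ} {e : OpenPartialHomeomorph X E} {θ : E → E [⋀^Fin k]→L[ℝ] ℂ}
    {x : X} (hx : x ∈ e.source) (v : Fin k → E) :
    push e θ x v = θ (e x) fun i => fderiv ℂ (e ∘ (chartAt E x).symm) (chartAt E x x) (v i) := by
  change (push e θ).valueAt x v = _
  rw [push_valueAt_of_mem hx]
  rfl

theorem push_smul_conjVolForm_apply {e : OpenPartialHomeomorph X E} (g : E → ℂ) {x : X}
    (hx : x ∈ e.source) (v : Fin 3 → E) : push e (fun z => g z • conjVolForm b) x v =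
      g (e x) * conjVolForm b fun i => fderiv ℂ (e ∘ (chartAt E x).symm) (chartAt E x x) (v i) :=
  push_apply_of_mem hx v

/-- The `(0, 3)`-form given by `g dz̄₁ ∧ dz̄₂ ∧ dz̄₃` in the chart `e`, and zero elsewhere. -/
def pushConj (e : OpenPartialHomeomorph X E) : (E → ℂ) →ₗ[ℂ] CForm E X (0 + 3) where
  toFun g := push e fun z => g z • conjVolForm b
  map_add' g g' := by
    funext x
    ext v
    change push e _ x v = push e _ x v + push e _ x v
    by_cases hx : x ∈ e.source
    · exact (push_smul_conjVolForm_apply b (g + g') hx v).trans ((add_mul _ _ _).trans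
        (congrArg₂ (· + ·) (push_smul_conjVolForm_apply b g hx v)
          (push_smul_conjVolForm_apply b g' hx v)).symm)
    · rw [push_apply_of_notMem hx, push_apply_of_notMem hx, push_apply_of_notMem hx]
      exact (add_zero (0 : ℂ)).symm
  map_smul' c g := by
    funext x
    ext v
    change push e _ x v = c * push e _ x v
    by_cases hx : x ∈ e.source
    · exact (push_smul_conjVolForm_apply b (c • g) hx v).trans ((mul_assoc c _ _).trans
        (congrArg (c * ·) (push_smul_conjVolForm_apply b g hx v)).symm)
    · rw [push_apply_of_notMem hx, push_apply_of_notMem hx]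
      exact (mul_zero c).symm

variable {b} {e : OpenPartialHomeomorph X E} {g : E → ℂ}

theorem tsupport_smul_conjVolForm_subset : tsupport (fun z => g z • conjVolForm b) ⊆ tsupport g :=
  closure_mono fun z hz => by
    contrapose! hz
    rw [Function.notMem_support] at hz ⊢
    ext v
    change g z * _ = 0
    rw [hz, zero_mul]

variable [IsManifold 𝓘(ℂ, E) ω X] [T2Space X] [FiniteDimensional ℂ E]

theorem pushConj_mem_smoothForms (he : e ∈ atlas E X) (hg : ContDiff ℝ ∞ g)
    (hc : HasCompactSupport g) (hs : tsupport g ⊆ e.target) :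
    pushConj b e g ∈ smoothForms E X 0 3 := by
  refine ⟨push_isSmooth he (hg.fun_smul contDiff_const)
    (hc.mono' (subset_trans (subset_tsupport _) tsupport_smul_conjVolForm_subset))
    (tsupport_smul_conjVolForm_subset.trans hs), push_hasBidegree fun y ζ v => ?_⟩
  change g y * conjVolForm b _ = _ * (g y * conjVolForm b v)
  rw [conjVolForm_apply, conjVolForm_apply]
  have := det_smul_vec b ζ v
  refine (congrArg (fun c => g y * starRingEnd ℂ c) this).trans ?_
  rw [map_mul, map_pow]
  ring

variable [MeasurableSpace E] [BorelSpace E] (μ : Measure E) [μ.IsAddHaarMeasure]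
  {t : CForm E X (0 + 3) →ₗ[ℂ] ℂ}

/-- Functionals on `(0, 3)`-forms which vanish on exact forms do not change under mollification. -/
theorem map_pushConj_mollify (ht : ∀ f ∈ exactForms E X 0 3, t f = 0) (he : e ∈ atlas E X)
    {ρ : E → ℝ} {ε : ℝ} (hρ : ContDiff ℝ ∞ ρ) (hsupp : ∀ w, ε < ‖w‖ → ρ w = 0)
    (hinv : ∀ (ζ : ℂ) w, ‖ζ‖ = 1 → ρ (ζ • w) = ρ w) (hint : ∫ w, ρ w ∂μ = 1)
    (hg : ContDiff ℝ ∞ g) (hc : HasCompactSupport g)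
    (hs : Metric.cthickening ε (tsupport g) ⊆ e.target) :
    t (pushConj b e fun z => ∫ w, (ρ (z - w) : ℂ) * g w ∂μ) = t (pushConj b e g) := by
  have : FiniteDimensional ℝ E := FiniteDimensional.complexToReal E
  have : ProperSpace E := FiniteDimensional.proper ℝ E
  have hth := isCompact_closedBall (0 : E) ε
  have hε : tsupport g + Metric.closedBall 0 ε ⊆ Metric.cthickening ε (tsupport g) := by
    rintro _ ⟨x, hx, w, hw, rfl⟩
    exact Metric.mem_cthickening_of_dist_le _ x _ _ hx (by simpa [dist_eq_norm] using hw)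
  have hcth : IsCompact (tsupport g + Metric.closedBall 0 ε) := IsCompact.add hc hth
  set m : E → ℂ := fun z => ∫ w, (ρ (z - w) : ℂ) * g w ∂μ with hm
  -- Substituting w ↦ z - w brings the mollification into the shape produced by the homotopy
  -- formula.
  have hm' : m = fun z => ∫ w, (ρ w : ℂ) * g (z - w) ∂μ := by
    ext z
    rw [hm, ← integral_sub_left_eq_self _ μ z]
    simp
  set η := mollifyHomotopy μ b ρ ε g with hη
  have hηc : ContDiff ℝ ∞ η := contDiff_mollifyHomotopy μ b hρ hg
  have hηs := tsupport_mollifyHomotopy μ b (ρ := ρ) (ε := ε) hc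
  have hηcs : HasCompactSupport η := IsCompact.of_isClosed_subset hcth (isClosed_tsupport _) hηs
  have hηt : tsupport η ⊆ e.target := hηs.trans (hε.trans hs)
  have hd : dbarModel η = fun z => (g - m) z • conjVolForm b := by
    ext1 z
    rw [dbarModel_mollifyHomotopy μ b hρ hsupp hinv hint hg z, Pi.sub_apply, hm']
  have hdb : (push e η).dbar = pushConj b e (g - m) := by
    rw [dbar_push he hηc hηcs hηt, hd]
    rfl
  have hgm : ContDiff ℝ ∞ m := contDiff_mollify hρ hsupp hg hc
  -- The support of g - m is controlled through η: where η vanishes locally so does ∂̄η = (g - m)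
  -- dz̄₁∧dz̄₂∧dz̄₃.
  have hms : tsupport (g - m) ⊆ tsupport g + Metric.closedBall 0 ε := by
    refine (closure_minimal (fun z hz => ?_) (isClosed_tsupport η)).trans hηs
    rw [Function.mem_support] at hz
    by_contra hn
    have h0 : dbarModel η z = 0 := by
      have : η =ᶠ[𝓝 z] fun _ => 0 := notMem_tsupport_iff_eventuallyEq.1 hn
      rw [this.dbarModel_eq]
      exact dbarModel_zero z
    rw [hd] at h0
    have := congrArg (fun β : E [⋀^Fin 3]→L[ℝ] ℂ => β b) h0
    refine hz ?_
    simpa [Module.Basis.det_self] using this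
  have hmem : (push e η).dbar ∈ exactForms E X 0 3 := by
    refine ⟨?_, push e η, ⟨push_isSmooth he hηc hηcs hηt,
      push_hasBidegree (p := 0) (q := 2) fun y ζ v => ?_⟩, rfl⟩
    · rw [hdb]
      exact pushConj_mem_smoothForms he (hg.sub hgm) (IsCompact.of_isClosed_subset hcth
        (isClosed_tsupport _) hms) (hms.trans (hε.trans hs))
    · rw [pow_zero, one_mul]
      exact mollifyHomotopy_smul μ b hρ hg y ζ v
  have h0 := ht _ hmem
  rw [hdb, map_sub, map_sub, sub_eq_zero] at h0
  exact h0.symm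

end PushConj

end

end ComplexForms

/-! ### Functionals vanishing on exact (0,3)-forms have continuous densities. -/

namespace ComplexForms

open Complex Filter Topology Set MeasureTheory

noncomputable section

section CutCoeff

variable {E : Type*} [NormedAddCommGroup E] [NormedSpace ℂ E]
  {X : Type*} [TopologicalSpace X] [ChartedSpace E X] {b : Module.Basis (Fin 3) ℂ E}
  {e e' : OpenPartialHomeomorph X E} {χ : X → ℝ} {f : CForm E X (0 + 3)}

variable (b e χ f) in
/-- The coefficient of `χ f` with respect to `dz̄₁ ∧ dz̄₂ ∧ dz̄₃` in the chart `e`. -/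
def cutCoeff : E → ℂ :=
  e.target.indicator fun z => (χ (e.symm z) : ℂ) * f.inChart e z b

theorem cutCoeff_of_mem {z : E} (hz : z ∈ e.target) :
    cutCoeff b e χ f z = (χ (e.symm z) : ℂ) * f.inChart e z b := indicator_of_mem hz _

theorem cutCoeff_eq_zero {z : E} (hz : z ∉ e '' tsupport χ) : cutCoeff b e χ f z = 0 := by
  by_cases h : z ∈ e.target
  · rw [cutCoeff_of_mem h, image_eq_zero_of_notMem_tsupport fun h' => hz ⟨_, h', e.right_inv h⟩,
      ofReal_zero, zero_mul]
  · exact indicator_of_notMem h _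

omit [NormedSpace ℂ E] [ChartedSpace E X] in
theorem isCompact_image_tsupport [CompactSpace X] (hχ : tsupport χ ⊆ e.source) :
    IsCompact (e '' tsupport χ) :=
  (isClosed_tsupport χ).isCompact.image_of_continuousOn (e.continuousOn.mono hχ)

omit [NormedSpace ℂ E] [ChartedSpace E X] in
theorem image_tsupport_subset (hχ : tsupport χ ⊆ e.source) : e '' tsupport χ ⊆ e.target := by
  rintro _ ⟨x, hx, rfl⟩
  exact e.map_source (hχ hx)

theorem tsupport_cutCoeff_subset [CompactSpace X] (hχ : tsupport χ ⊆ e.source) :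
    tsupport (cutCoeff b e χ f) ⊆ e '' tsupport χ :=
  closure_minimal (fun _ hz => by_contra fun h => hz (cutCoeff_eq_zero h))
    (isCompact_image_tsupport hχ).isClosed

theorem contDiff_cutCoeff [CompactSpace X] (he : e ∈ atlas E X)
    (hχ : tsupport χ ⊆ e.source) (hχ' : ContDiffOn ℝ ∞ (χ ∘ e.symm) e.target) (hf : f.IsSmooth) :
    ContDiff ℝ ∞ (cutCoeff b e χ f) := by
  rw [contDiff_iff_contDiffAt]
  intro z
  by_cases hz : z ∈ e.target
  · have hn := e.open_target.mem_nhds hz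
    have h1 := (hχ'.contDiffAt hn)
    have h2 := (hf e he).contDiffAt hn
    have h3 : ContDiffAt ℝ ∞ (fun z => ((χ (e.symm z) : ℝ) : ℂ) * f.inChart e z b) z :=
      (ofRealCLM.contDiff.contDiffAt.comp z h1).mul
        ((ContinuousAlternatingMap.apply ℝ E ℂ (b : Fin 3 → E)).contDiff.contDiffAt.comp z h2)
    refine h3.congr_of_eventuallyEq ?_
    filter_upwards [hn] with y hy
    exact cutCoeff_of_mem hy
  · have : z ∉ tsupport (cutCoeff b e χ f) :=
      fun h => hz (image_tsupport_subset hχ (tsupport_cutCoeff_subset hχ h))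
    exact contDiffAt_const.congr_of_eventuallyEq (notMem_tsupport_iff_eventuallyEq.1 this)

theorem pushConj_apply_of_notMem (g : E → ℂ) {x : X} (hx : x ∉ e.source) :
    pushConj b e g x = 0 :=
  push_apply_of_notMem (k := 0 + 3) (θ := fun z => g z • conjVolForm b) hx

/-- Evaluation of a form at a point and at tangent vectors there. -/
def CForm.evalAt {k : ℕ} (x : X) (v : Fin k → E) : CForm E X k →ₗ[ℂ] ℂ where
  toFun f := f.valueAt x v
  map_add' _ _ := rfl
  map_smul' _ _ := rfl

theorem pushConj_mul_apply (g h : E → ℂ) (x : X) (v : Fin 3 → E) :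
    pushConj b e (fun z => g z * h z) x v = g (e x) * pushConj b e h x v := by
  by_cases hx : x ∈ e.source
  · refine (push_smul_conjVolForm_apply b _ hx v).trans ?_
    rw [mul_assoc]
    exact congrArg (g (e x) * ·) (push_smul_conjVolForm_apply b h hx v).symm
  · have h1 : pushConj b e (fun z => g z * h z) x = 0 := pushConj_apply_of_notMem _ hx
    have h2 : pushConj b e h x = 0 := pushConj_apply_of_notMem _ hx
    rw [h1, h2]
    exact (mul_zero _).symm

/-- Linearity over functions. It separates the mollified coefficient, which carries the integration,
from a fixed cutoff form, and so exhibits the kernel of the smoothing operator. -/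
theorem cutCoeff_pushConj_mul (g h : E → ℂ) (z : E) :
    cutCoeff b e' χ (pushConj b e fun z => g z * h z) z =
      g (e (e'.symm z)) * cutCoeff b e' χ (pushConj b e h) z := by
  by_cases hz : z ∈ e'.target
  · rw [cutCoeff_of_mem hz, cutCoeff_of_mem hz, mul_left_comm]
    exact congrArg (_ * ·) (pushConj_mul_apply g h _ _)
  · simp [cutCoeff, hz]

theorem cutCoeff_add (f f' : CForm E X (0 + 3)) :
    cutCoeff b e χ (f + f') = cutCoeff b e χ f + cutCoeff b e χ f' := by
  ext z
  by_cases hz : z ∈ e.target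
  · rw [Pi.add_apply, cutCoeff_of_mem hz, cutCoeff_of_mem hz, cutCoeff_of_mem hz]
    exact mul_add _ _ _
  · simp [cutCoeff, hz]

theorem cutCoeff_zero : cutCoeff b e χ (0 : CForm E X (0 + 3)) = 0 := by
  ext z
  by_cases hz : z ∈ e.target
  · rw [cutCoeff_of_mem hz]
    exact mul_zero _
  · exact indicator_of_notMem hz _

theorem cutCoeff_sum {ι : Type*} (s : Finset ι) (F : ι → CForm E X (0 + 3)) :
    cutCoeff b e χ (∑ i ∈ s, F i) = ∑ i ∈ s, cutCoeff b e χ (F i) := by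
  classical
  induction s using Finset.induction_on with
  | empty => simpa using cutCoeff_zero
  | insert i s hi ih => rw [Finset.sum_insert hi, Finset.sum_insert hi, cutCoeff_add, ih]

variable [IsManifold 𝓘(ℂ, E) ω X]

/-- A (0,3)-form is determined in a chart by its coefficient against dz̄₁∧dz̄₂∧dz̄₃, so cutting off
and pushing back gives χ f. -/
theorem pushConj_cutCoeff_apply (he : e ∈ atlas E X) (hχ : tsupport χ ⊆ e.source)
    (hf : f.HasBidegree 0 3) (x : X) (v : Fin 3 → E) :
    pushConj b e (cutCoeff b e χ f) x v = χ x * f x v := by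
  by_cases hx : x ∈ e.source
  · refine (push_smul_conjVolForm_apply b _ hx v).trans ?_
    have hy := e.map_source hx
    rw [cutCoeff_of_mem hy, e.left_inv hx, mul_assoc]
    refine congrArg (_ * ·) ?_
    have h1 := eq_smul_conjVolForm b (α := f.inChart e (e x)) fun ζ v => by
      have := hf.inChart he hy ζ v
      rw [pow_zero, one_mul] at this
      exact this
    change _ = f.valueAt x v
    rw [f.valueAt_eq he hx]
    exact (congrArg (fun β : E [⋀^Fin 3]→L[ℝ] ℂ => β fun i =>
      fderiv ℂ (e ∘ (chartAt E x).symm) (chartAt E x x) (v i)) h1).symm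
  · have h1 : pushConj b e (cutCoeff b e χ f) x = 0 := pushConj_apply_of_notMem _ hx
    rw [h1, image_eq_zero_of_notMem_tsupport fun h => hx (hχ h), ofReal_zero, zero_mul]
    rfl

theorem sum_pushConj_cutCoeff {ι : Type*} [Fintype ι] {e : ι → OpenPartialHomeomorph X E}
    {χ : ι → X → ℝ} (he : ∀ i, e i ∈ atlas E X) (hχ : ∀ i, tsupport (χ i) ⊆ (e i).source)
    (hsum : ∀ x, ∑ i, χ i x = 1) (hf : f.HasBidegree 0 3) :
    ∑ i, pushConj b (e i) (cutCoeff b (e i) (χ i) f) = f := by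
  funext x
  ext v
  have h1 : (∑ i, pushConj b (e i) (cutCoeff b (e i) (χ i) f)) x v =
      ∑ i, pushConj b (e i) (cutCoeff b (e i) (χ i) f) x v := by
    exact map_sum (CForm.evalAt (E := E) (X := X) (k := 0 + 3) x v) _ _
  refine h1.trans ?_
  rw [Finset.sum_congr rfl fun i _ => pushConj_cutCoeff_apply (he i) (hχ i) hf x v,
    ← Finset.sum_mul, ← ofReal_sum, hsum]
  exact one_mul _

variable [T2Space X] [CompactSpace X] [FiniteDimensional ℂ E]

/-- The kernel of a mollification of `(0, 3)`-forms is continuous. -/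
theorem continuous_mollify_kernel (he : e ∈ atlas E X) (he' : e' ∈ atlas E X)
    (hχ : tsupport χ ⊆ e'.source) (hχ' : ContDiffOn ℝ ∞ (χ ∘ e'.symm) e'.target) {ψ : E → ℂ}
    (hψ : ContDiff ℝ ∞ ψ) (hψc : HasCompactSupport ψ) (hψs : tsupport ψ ⊆ e.target) {ρ : E → ℝ}
    (hρ : Continuous ρ) : Continuous fun p : E × E => (ρ (e (e'.symm p.2) - p.1) : ℂ) *
      cutCoeff b e' χ (pushConj b e ψ) p.2 := by
  have hD := contDiff_cutCoeff (b := b) he' hχ hχ' (pushConj_mem_smoothForms (b := b) he hψ hψc hψs).1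
  rw [continuous_iff_continuousAt]
  rintro ⟨w, z⟩
  by_cases hz : z ∈ e'.target ∧ e'.symm z ∈ e.source
  · have h1 : ContinuousAt (fun z => e (e'.symm z)) z :=
      ContinuousAt.comp (g := e) (f := e'.symm) (e.continuousAt hz.2) (e'.continuousAt_symm hz.1)
    have h2 : ContinuousAt (fun p : E × E => e (e'.symm p.2)) (w, z) :=
      ContinuousAt.comp (g := fun z => e (e'.symm z)) (f := Prod.snd) h1 continuousAt_snd
    refine ContinuousAt.mul ?_ (hD.continuous.comp continuous_snd).continuousAt
    exact continuous_ofReal.continuousAt.comp (hρ.continuousAt.comp (h2.sub continuousAt_fst))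
  · have h0 : cutCoeff b e' χ (pushConj b e ψ) =ᶠ[𝓝 z] 0 := by
      rw [← notMem_tsupport_iff_eventuallyEq]
      intro h
      have hz' := image_tsupport_subset hχ (tsupport_cutCoeff_subset hχ h)
      have hx : e'.symm z ∉ e.source := fun hx => hz ⟨hz', hx⟩
      have h1 := CForm.inChart_eventuallyEq_zero (push_eventually_eq_zero (X := X) (k := 0 + 3)
        (θ := fun z => ψ z • conjVolForm b)
        (hψc.mono' (subset_trans (subset_tsupport _) tsupport_smul_conjVolForm_subset))
        (tsupport_smul_conjVolForm_subset.trans hψs) hx) he' (e'.map_target hz')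
      rw [e'.right_inv hz'] at h1
      refine (notMem_tsupport_iff_eventuallyEq.2 ?_) h
      filter_upwards [h1, e'.open_target.mem_nhds hz'] with y hy hy'
      rw [cutCoeff_of_mem hy']
      refine (congrArg (fun β : E [⋀^Fin 3]→L[ℝ] ℂ => (χ (e'.symm y) : ℂ) * β b) hy).trans ?_
      exact mul_zero _
    refine continuousAt_const.congr (f := fun _ => (0 : ℂ)) ?_
    filter_upwards [continuousAt_snd.eventually h0] with p hp
    rw [hp]
    simp

variable [MeasurableSpace E] [BorelSpace E] (μ : Measure E) [μ.IsAddHaarMeasure]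
  {t : CForm E X (0 + 3) →ₗ[ℂ] ℂ}

/-- A functional on `(0, 3)`-forms which vanishes on exact forms is given by continuous densities
in charts. -/
theorem exists_density {ι : Type*} [Fintype ι] {e : ι → OpenPartialHomeomorph X E}
    {χ : ι → X → ℝ} (he : ∀ i, e i ∈ atlas E X) (hχ : ∀ i, tsupport (χ i) ⊆ (e i).source)
    (hχ' : ∀ i, ContDiffOn ℝ ∞ (χ i ∘ (e i).symm) (e i).target)
    (hsum : ∀ x, ∑ i, χ i x = 1) (ht : ∀ f ∈ exactForms E X 0 3, t f = 0) :
    ∃ φ : ι → C(E, ℂ), ∀ f ∈ smoothForms E X 0 3,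
      t f = ∑ i, ∫ w, φ i w * cutCoeff b (e i) (χ i) f w ∂μ := by
  have : FiniteDimensional ℝ E := FiniteDimensional.complexToReal E
  have : ProperSpace E := FiniteDimensional.proper ℝ E
  -- Nested cutoffs: κ i is 1 on the image of the support of χ i, ε keeps the ε-thickening of the
  -- support of κ i inside the chart, and ψ i is 1 on that thickening.
  choose κ hκ hκc hκs hκ1 using fun i => exists_smooth_cutoff (isCompact_image_tsupport (hχ i))
    (e i).open_target (image_tsupport_subset (hχ i))
  have hKκ : ∀ i, e i '' tsupport (χ i) ⊆ tsupport (κ i) := fun i x hx =>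
    subset_tsupport _ (by simp [hκ1 i x hx])
  obtain ⟨ε, hε, hεs⟩ : ∃ ε > 0, ∀ i, Metric.cthickening ε (tsupport (κ i)) ⊆ (e i).target := by
    have h1 : ∀ i, ∀ᶠ ε in 𝓝[>] (0 : ℝ), Metric.cthickening ε (tsupport (κ i)) ⊆ (e i).target := by
      intro i
      obtain ⟨δ, hδ, h⟩ := (hκc i).isCompact.exists_cthickening_subset_open (e i).open_target (hκs i)
      filter_upwards [Ioo_mem_nhdsGT hδ] with ε hε
      exact (Metric.cthickening_mono hε.2.le _).trans h
    obtain ⟨ε, h, h'⟩ := ((eventually_all.2 h1).and self_mem_nhdsWithin).exists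
    exact ⟨ε, h', h⟩
  choose ψ hψ hψc hψs hψ1 using fun i => exists_smooth_cutoff ((hκc i).isCompact.cthickening (r := ε))
    (e i).open_target (hεs i)
  obtain ⟨ρ, hρ, hρs, hρi, hρint⟩ := exists_rotation_invariant_bump (E := E) (μ := μ) hε
  have hρc : HasCompactSupport ρ := HasCompactSupport.intro (isCompact_closedBall (0 : E) ε)
    fun w hw => hρs w (by simpa using hw)
  set K : Set E := ⋃ i, tsupport (κ i) with hKdef
  have hK : IsCompact K := isCompact_iUnion fun i => (hκc i).isCompact
  have : CompactSpace K := isCompact_iff_compactSpace.1 hK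
  set ν : Measure K := μ.comap (↑) with hν
  have : IsFiniteMeasure ν := ⟨by
    rw [hν, Measure.comap_apply _ Subtype.val_injective
      (fun s hs => hK.measurableSet.subtype_image hs) _ MeasurableSet.univ]
    simpa using hK.measure_lt_top⟩
  have hint : ∀ F : E → ℂ, ∫ y : K, F y ∂ν = ∫ w in K, F w ∂μ :=
    fun F => integral_subtype_comap hK.measurableSet F
  -- mollification
  let sm : ι → C(K, ℂ) → E → ℂ := fun i g z => ∫ y : K, (ρ (z - y) : ℂ) * (κ i y * g y) ∂ν
  have hsm : ∀ i g, ContDiff ℝ ∞ (sm i g) := by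
    intro i g
    obtain ⟨G, hG⟩ := ContinuousMap.exists_restrict_eq hK.isClosed g
    have h1 := contDiff_setIntegral_translate (μ := μ) hρ hρc hK
      (u := fun w => (κ i w : ℂ) * G w) (Continuous.continuousOn (by
        have := (hκ i).continuous
        fun_prop))
    convert! h1 using 2 with z
    rw [← hint fun w => (ρ (z - w) : ℂ) * (κ i w * G w), ← hG]
    rfl
  have hsm0 : ∀ i g z, z ∉ Metric.cthickening ε (tsupport (κ i)) → sm i g z = 0 := by
    intro i g z hz
    refine integral_eq_zero_of_ae (Eventually.of_forall fun y => ?_)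
    by_cases hy : (y : E) ∈ tsupport (κ i)
    · have : ε < ‖z - y‖ := by
        by_contra hn
        exact hz (Metric.mem_cthickening_of_dist_le z y _ _ hy (by rw [dist_eq_norm]; linarith))
      simp [hρs _ this]
    · simp [image_eq_zero_of_notMem_tsupport hy]
  have hsmt : ∀ i g, tsupport (sm i g) ⊆ Metric.cthickening ε (tsupport (κ i)) := fun i g =>
    closure_minimal (fun z hz => by_contra fun h => hz (hsm0 i g z h)) Metric.isClosed_cthickening
  have hsmooth : ∀ i g, pushConj b (e i) (sm i g) ∈ smoothForms E X 0 3 := fun i g =>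
    pushConj_mem_smoothForms (he i) (hsm i g) (IsCompact.of_isClosed_subset
      ((hκc i).isCompact.cthickening) (isClosed_tsupport _) (hsmt i g)) ((hsmt i g).trans (hεs i))
  have hsmψ : ∀ i g, sm i g = fun z => sm i g z * (ψ i z : ℂ) := by
    intro i g
    ext z
    by_cases hz : z ∈ Metric.cthickening ε (tsupport (κ i))
    · simp [hψ1 i z hz]
    · simp [hsm0 i g z hz]
  have hinteg : ∀ i (g : C(K, ℂ)) z, Integrable (fun y : K => (ρ (z - y) : ℂ) * (κ i y * g y)) ν := by
    intro i g z
    have h1 := (hκ i).continuous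
    have h2 := hρ.continuous
    exact integrable_continuous_of_compactSpace ν (by fun_prop)
  -- The functional t is defined on forms; composing it with smoothing gives a functional on tuples
  -- of continuous functions.
  let τ : (ι → C(K, ℂ)) →ₗ[ℂ] ℂ :=
    { toFun := fun v => ∑ i, t (pushConj b (e i) (sm i (v i)))
      map_add' := fun v v' => by
        rw [← Finset.sum_add_distrib]
        refine Finset.sum_congr rfl fun i _ => ?_
        rw [← map_add, ← map_add]
        refine congrArg t (congrArg (pushConj b (e i)) (funext fun z => ?_))
        refine Eq.trans ?_ (integral_add (hinteg i _ z) (hinteg i _ z))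
        refine integral_congr_ae (Eventually.of_forall fun y => ?_)
        change _ * (_ * (v i y + v' i y)) = _ * (_ * v i y) + _ * (_ * v' i y)
        ring
      map_smul' := fun c v => by
        rw [RingHom.id_apply, Finset.smul_sum]
        refine Finset.sum_congr rfl fun i _ => ?_
        rw [← map_smul, ← map_smul]
        refine congrArg t (congrArg (pushConj b (e i)) (funext fun z => ?_))
        refine Eq.trans ?_ (integral_const_mul c _)
        refine integral_congr_ae (Eventually.of_forall fun y => ?_)
        change _ * (_ * (c * v i y)) = c * (_ * (_ * v i y))
        ring }
  let cvec : ∀ f : CForm E X (0 + 3), f.IsSmooth → ι → C(K, ℂ) := fun f hf i =>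
    ⟨fun z => cutCoeff b (e i) (χ i) f z,
      (contDiff_cutCoeff (he i) (hχ i) (hχ' i) hf).continuous.comp continuous_subtype_val⟩
  have hc0 : ∀ i f w, w ∉ K → cutCoeff b (e i) (χ i) f w = 0 := fun i f w hw =>
    cutCoeff_eq_zero fun h => hw (mem_iUnion.2 ⟨i, hKκ i h⟩)
  -- On the cut coefficients of a smooth form, κ i has no effect and mollification does not change
  -- t. Thus τ extends t.
  have hτ : ∀ f (hf : f ∈ smoothForms E X 0 3), τ (cvec f hf.1) = t f := by
    intro f hf
    conv_rhs => rw [← sum_pushConj_cutCoeff (b := b) he hχ hsum hf.2, map_sum]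
    refine Finset.sum_congr rfl fun i _ => ?_
    have hts := (tsupport_cutCoeff_subset (b := b) (f := f) (hχ i)).trans (hKκ i)
    rw [← map_pushConj_mollify μ ht (he i) hρ hρs hρi hρint
      (contDiff_cutCoeff (b := b) (he i) (hχ i) (hχ' i) hf.1)
      (IsCompact.of_isClosed_subset (hκc i).isCompact (isClosed_tsupport _) hts)
      ((Metric.cthickening_subset_of_subset _ hts).trans (hεs i))]
    congr 2
    ext z
    rw [← setIntegral_eq_integral_of_forall_compl_eq_zero (s := K), ← hint]
    · refine integral_congr_ae (Eventually.of_forall fun y => ?_)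
      change _ * ((κ i y : ℂ) * cutCoeff b (e i) (χ i) f y) = _ * cutCoeff b (e i) (χ i) f y
      by_cases hy : (y : E) ∈ e i '' tsupport (χ i)
      · simp [hκ1 i y hy]
      · simp [cutCoeff_eq_zero hy]
    · intro w hw
      rw [hc0 i f w hw, mul_zero]
  -- Component j of kernel i expresses, in chart j, the effect of a unit mass at y mollified in
  -- chart i.
  let kern : ι → C(K, ι → C(K, ℂ)) := fun i => ⟨fun y j => ContinuousMap.curry
    ⟨fun p : K × K => (κ i p.1 : ℂ) * ((ρ (e i ((e j).symm p.2) - p.1) : ℂ) *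
      cutCoeff b (e j) (χ j) (pushConj b (e i) fun z => (ψ i z : ℂ)) p.2), by
      have h1 := continuous_mollify_kernel (b := b) (he i) (he j) (hχ j) (hχ' j)
        (ψ := fun z => (ψ i z : ℂ)) (ofRealCLM.contDiff.comp (hψ i))
        ((hψc i).comp_left ofReal_zero) ((closure_mono fun z hz => by
          simpa using hz).trans (hψs i)) hρ.continuous
      have h2 := (hκ i).continuous
      refine Continuous.mul (by fun_prop) (h1.comp (f := fun p : K × K => ((p.1 : E), (p.2 : E)))
        (by fun_prop))⟩ y, continuous_pi fun j => ContinuousMap.continuous _⟩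
  -- The integral operator returns the cut coefficients of the smooth form made from v. Hence τ of
  -- its value is t of that form, which is τ v by definition.
  have hS : ∀ v : ι → C(K, ℂ), ∑ i, ∫ y, v i y • kern i y ∂ν =
      cvec (∑ i, pushConj b (e i) (sm i (v i))) (Submodule.sum_mem _ fun i _ => hsmooth i (v i)).1 := by
    intro v
    ext j z
    let ev : (ι → C(K, ℂ)) →L[ℂ] ℂ := (ContinuousMap.evalCLM ℂ z).comp (ContinuousLinearMap.proj j)
    change ev (∑ i, ∫ y, v i y • kern i y ∂ν) = cutCoeff b (e j) (χ j) _ (z : E)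
    rw [map_sum, cutCoeff_sum, Finset.sum_apply]
    refine Finset.sum_congr rfl fun i _ => ?_
    rw [← ev.integral_comp_comm (integrable_continuous_of_compactSpace ν (by fun_prop)), hsmψ,
      cutCoeff_pushConj_mul, ← integral_mul_const]
    refine integral_congr_ae (Eventually.of_forall fun y => ?_)
    change v i y * ((κ i y : ℂ) * (_ * _)) = _
    ring
  obtain ⟨φ, hφ⟩ := exists_representation_of_kernel_invariant ν kern
    (fun i => ContinuousLinearMap.proj i) (τ := τ) (fun v => by
      refine (congrArg τ (hS v)).trans ?_
      rw [hτ _ (Submodule.sum_mem _ fun i _ => hsmooth i (v i)), map_sum]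
      rfl)
  -- Tietze extension from K; the values outside K are irrelevant because the cut coefficients
  -- vanish there.
  choose Φ hΦ using fun i => ContinuousMap.exists_restrict_eq hK.isClosed (φ i)
  refine ⟨Φ, fun f hf => ?_⟩
  rw [← hτ f hf, hφ]
  refine Finset.sum_congr rfl fun i _ => ?_
  rw [← setIntegral_eq_integral_of_forall_compl_eq_zero (s := K), ← hint]
  · refine integral_congr_ae (Eventually.of_forall fun y => ?_)
    change cutCoeff b (e i) (χ i) f y * φ i y = _
    rw [mul_comm, ← hΦ]
    rfl
  · intro w hw
    rw [hc0 i f w hw, mul_zero]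

end CutCoeff

end

end ComplexForms

/-! ### Regularity: smoothness and holomorphy of densities, in the manner of Weyl's lemma. -/

namespace ComplexForms

open Complex Filter Topology Set MeasureTheory

noncomputable section

section Regularity

variable {E : Type*} [NormedAddCommGroup E] [NormedSpace ℂ E] [FiniteDimensional ℂ E]
  [MeasurableSpace E] [BorelSpace E] {μ : Measure E} [μ.IsAddHaarMeasure] {U : Set E} {h : E → ℂ}

omit [NormedSpace ℂ E] [FiniteDimensional ℂ E] [μ.IsAddHaarMeasure] in
theorem integrable_mul_of_continuousOn [IsFiniteMeasureOnCompacts μ] {g : E → ℂ}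
    (hh : ContinuousOn h U) (hg : Continuous g) (hc : HasCompactSupport g) (hs : tsupport g ⊆ U) :
    Integrable (fun z => g z * h z) μ := by
  rw [← integrableOn_iff_integrable_of_support_subset (s := tsupport g)]
  · exact ((hg.continuousOn).mul (hh.mono hs)).integrableOn_compact hc
  · exact (Function.support_mul_subset_left _ _).trans (subset_tsupport g)

/-- A continuous function which is invariant under mollification is smooth. -/
theorem contDiffOn_of_mollify_invariant (hU : IsOpen U) (hh : ContinuousOn h U)
    (hinv : ∀ (ρ : E → ℝ) (ε : ℝ), ContDiff ℝ ∞ ρ → (∀ w, ε < ‖w‖ → ρ w = 0) →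
      (∀ (ζ : ℂ) w, ‖ζ‖ = 1 → ρ (ζ • w) = ρ w) → ∫ w, ρ w ∂μ = 1 → ∀ g : E → ℂ,
      ContDiff ℝ ∞ g → HasCompactSupport g → Metric.cthickening ε (tsupport g) ⊆ U →
      ∫ z, (∫ w, (ρ (z - w) : ℂ) * g w ∂μ) * h z ∂μ = ∫ z, g z * h z ∂μ) :
    ContDiffOn ℝ ∞ h U := by
  have : FiniteDimensional ℝ E := FiniteDimensional.complexToReal E
  have : ProperSpace E := FiniteDimensional.proper ℝ E
  intro z₀ hz₀
  obtain ⟨r', hr', hrU⟩ := Metric.isOpen_iff.1 hU z₀ hz₀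
  obtain ⟨r, hr, hr2⟩ : ∃ r > 0, 2 * r < r' := ⟨r' / 4, by positivity, by linarith⟩
  obtain ⟨ρ, hρ, hρs, hρi, hρint⟩ := exists_rotation_invariant_bump (E := E) (μ := μ) hr
  have hρc : HasCompactSupport ρ := HasCompactSupport.intro (isCompact_closedBall (0 : E) r)
    fun w hw => hρs w (by simpa using hw)
  set K := Metric.closedBall z₀ (2 * r) with hK
  have hKU : K ⊆ U := (Metric.closedBall_subset_ball hr2).trans hrU
  have hKc : IsCompact K := isCompact_closedBall _ _
  have hball : Metric.ball z₀ r ⊆ K := (Metric.ball_subset_ball (by linarith)).trans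
    Metric.ball_subset_closedBall
  -- The candidate smooth representative. Test functions on the ball of radius r have mollifications
  -- supported in K, of radius 2r, so integrating over K loses nothing.
  set H : E → ℂ := fun z => ∫ w in K, (ρ (z - w) : ℂ) * h w ∂μ with hH
  have hHs : ContDiff ℝ ∞ H := contDiff_setIntegral_translate hρ hρc hKc (hh.mono hKU)
  -- Evenness, the case ζ = -1, lets the mollification be moved from the test function to h.
  have hsymm : ∀ w, ρ (-w) = ρ w := fun w => by
    have := hρi (-1) w (by simp)
    simpa using this
  have hfin : IsFiniteMeasure (μ.restrict K) := ⟨by simpa using hKc.measure_lt_top⟩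
  have key : ∀ g : E → ℝ, ContDiff ℝ ∞ g → HasCompactSupport g → tsupport g ⊆ Metric.ball z₀ r →
      ∫ z, g z • (h z - H z) ∂μ = 0 := by
    intro g hg hgc hgs
    have hth : Metric.cthickening r (tsupport fun z => (g z : ℂ)) ⊆ K := by
      refine (Metric.cthickening_subset_of_subset r (((closure_mono fun z hz => ?_ :
        tsupport (fun z => (g z : ℂ)) ⊆ tsupport g)).trans
        (hgs.trans Metric.ball_subset_closedBall))).trans ?_
      · simpa using hz
      · rw [cthickening_closedBall hr.le hr.le, hK, two_mul]
    have hgcC : HasCompactSupport fun z => (g z : ℂ) := hgc.comp_left ofReal_zero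
    have hgC : ContDiff ℝ ∞ fun z => (g z : ℂ) := ofRealCLM.contDiff.comp hg
    have h1 := hinv ρ r hρ hρs hρi hρint _ hgC hgcC (hth.trans hKU)
    have hgK : ∀ w, w ∉ K → g w = 0 := fun w hw =>
      image_eq_zero_of_notMem_tsupport fun h => hw (hball (hgs h))
    have h2 : ∫ z, (∫ w, (ρ (z - w) : ℂ) * g w ∂μ) * h z ∂μ =
        ∫ z in K, ∫ w in K, (ρ (z - w) : ℂ) * g w * h z ∂μ ∂μ := by
      rw [← setIntegral_eq_integral_of_forall_compl_eq_zero (s := K)]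
      · refine integral_congr_ae (Eventually.of_forall fun z => ?_)
        simp only
        rw [← integral_mul_const, setIntegral_eq_integral_of_forall_compl_eq_zero]
        intro w hw
        simp [hgK w hw]
      · intro z hz
        rw [integral_eq_zero_of_ae (Eventually.of_forall fun w => ?_), zero_mul]
        by_cases hw : w ∈ tsupport fun z => (g z : ℂ)
        · have : r < ‖z - w‖ := by
            by_contra hn
            exact hz (hth (Metric.mem_cthickening_of_dist_le z w _ _ hw
              (by rw [dist_eq_norm]; linarith)))
          simp [hρs _ this]
        · simp [image_eq_zero_of_notMem_tsupport (f := fun z => (g z : ℂ)) hw]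
    have h3 : ∫ z in K, ∫ w in K, (ρ (z - w) : ℂ) * g w * h z ∂μ ∂μ =
        ∫ w in K, ∫ z in K, (ρ (z - w) : ℂ) * g w * h z ∂μ ∂μ := by
      refine integral_integral_swap ?_
      rw [Measure.prod_restrict]
      refine ContinuousOn.integrableOn_compact (hKc.prod hKc) ?_
      have c1 := hρ.continuous
      have c2 := hg.continuous
      have c3 : Continuous fun p : E × E => (ρ (p.1 - p.2) : ℂ) * g p.2 := by fun_prop
      refine ContinuousOn.mul c3.continuousOn ?_
      exact ContinuousOn.comp (g := h) (f := (Prod.fst : E × E → E)) (t := K) (hh.mono hKU)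
        continuousOn_fst fun p hp => hp.1
    have h4 : ∫ w in K, ∫ z in K, (ρ (z - w) : ℂ) * g w * h z ∂μ ∂μ = ∫ w, (g w : ℂ) * H w ∂μ := by
      rw [← setIntegral_eq_integral_of_forall_compl_eq_zero (s := K) (f := fun w => (g w : ℂ) * H w)]
      · refine integral_congr_ae (Eventually.of_forall fun w => ?_)
        simp only [hH]
        rw [← integral_const_mul]
        refine integral_congr_ae (Eventually.of_forall fun z => ?_)
        simp only
        rw [← hsymm (z - w), neg_sub]
        ring
      · intro w hw
        simp [hgK w hw]
    have h5 : ∫ z, (g z : ℂ) * (h z - H z) ∂μ = 0 := by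
      simp only [mul_sub]
      rw [integral_sub (integrable_mul_of_continuousOn (U := U) hh hgC.continuous hgcC
        ((subset_closure.trans (Metric.closure_subset_cthickening _ _)).trans (hth.trans hKU)))
        (integrable_mul_of_continuousOn (U := univ) hHs.continuous.continuousOn hgC.continuous hgcC
        (subset_univ _)), ← h1, h2, h3, h4, sub_self]
    simpa only [real_smul] using h5
  have hcont : ContinuousOn (fun z => h z - H z) (Metric.ball z₀ r) :=
    (hh.mono (hball.trans hKU)).sub hHs.continuous.continuousOn
  have hae := Metric.isOpen_ball.ae_eq_zero_of_integral_contDiff_smul_eq_zero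
    (hcont.locallyIntegrableOn Metric.isOpen_ball.measurableSet) key
  have heq : EqOn (fun z => h z - H z) (fun _ => 0) (Metric.ball z₀ r) :=
    Measure.eqOn_open_of_ae_eq ((ae_restrict_iff' Metric.isOpen_ball.measurableSet).2 hae)
      Metric.isOpen_ball hcont continuousOn_const
  refine (hHs.contDiffAt.congr_of_eventuallyEq ?_).contDiffWithinAt
  filter_upwards [Metric.ball_mem_nhds z₀ hr] with z hz
  exact sub_eq_zero.1 (heq hz)

/-- A smooth function which is orthogonal to all antiholomorphic derivatives of test functions is
holomorphic. -/
theorem antilinearPart_fderiv_eq_zero (hU : IsOpen U) (hh : ContDiffOn ℝ ∞ h U)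
    (horth : ∀ (u : E → ℂ) (v : E), ContDiff ℝ ∞ u → HasCompactSupport u → tsupport u ⊆ U →
      ∫ z, antilinearPart (fderiv ℝ u z) v * h z ∂μ = 0) {z : E} (hz : z ∈ U) :
    antilinearPart (fderiv ℝ h z) = 0 := by
  have : FiniteDimensional ℝ E := FiniteDimensional.complexToReal E
  have hDc : ContinuousOn (fderiv ℝ h) U := hh.continuousOn_fderiv_of_isOpen hU (by simp)
  have hDv : ∀ v, ContinuousOn (fun z => fderiv ℝ h z v) U := fun v =>
    hDc.clm_apply continuousOn_const
  have hcont : ∀ v, ContinuousOn (fun z => antilinearPart (fderiv ℝ h z) v) U := by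
    intro v
    simp only [antilinearPart_apply]
    have := hDv v
    have := hDv (I • v)
    fun_prop
  ext v
  refine Measure.eqOn_open_of_ae_eq (μ := μ) (g := fun _ => (0 : ℂ))
    ((ae_restrict_iff' hU.measurableSet).2 ?_) hU (hcont v) continuousOn_const hz
  refine hU.ae_eq_zero_of_integral_contDiff_smul_eq_zero
    ((hcont v).locallyIntegrableOn hU.measurableSet) fun g hg hgc hgs => ?_
  have hgC : ContDiff ℝ ∞ fun z => (g z : ℂ) := ofRealCLM.contDiff.comp hg
  have hgcC : HasCompactSupport fun z => (g z : ℂ) := hgc.comp_left ofReal_zero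
  have hgsC : tsupport (fun z => (g z : ℂ)) ⊆ U :=
    (closure_mono fun z hz => by simpa using hz).trans hgs
  have hDg : Continuous (fderiv ℝ fun z => (g z : ℂ)) := hgC.continuous_fderiv (by simp)
  have hDgc := hgcC.fderiv (𝕜 := ℝ)
  have hDgs : tsupport (fderiv ℝ fun z => (g z : ℂ)) ⊆ U := (tsupport_fderiv_subset ℝ).trans hgsC
  have i1 : ∀ v, Integrable (fun z => fderiv ℝ (fun z => (g z : ℂ)) z v * h z) μ := fun v =>
    integrable_mul_of_continuousOn hh.continuousOn (hDg.clm_apply continuous_const)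
      (hDgc.comp_left (g := fun L : E →L[ℝ] ℂ => L v) rfl)
      ((closure_mono (show Function.support (fun z => fderiv ℝ (fun z => (g z : ℂ)) z v) ⊆
        Function.support (fderiv ℝ fun z => (g z : ℂ)) from
          fun z hz h0 => hz (by simp [h0]))).trans hDgs)
  have i2 : ∀ v, Integrable (fun z => (g z : ℂ) * fderiv ℝ h z v) μ := fun v =>
    integrable_mul_of_continuousOn (hDv v) hgC.continuous hgcC hgsC
  have i3 : Integrable (fun z => (g z : ℂ) * h z) μ :=
    integrable_mul_of_continuousOn hh.continuousOn hgC.continuous hgcC hgsC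
  -- No boundary terms occur because g has compact support in U. The conjugate-linear derivative
  -- therefore moves from u = g to h with a sign.
  have parts : ∀ v, ∫ z, (g z : ℂ) * fderiv ℝ h z v ∂μ =
      - ∫ z, fderiv ℝ (fun z => (g z : ℂ)) z v * h z ∂μ := fun v =>
    integral_mul_fderiv_eq_neg_fderiv_mul_of_integrable (i1 v) (i2 v) i3
      (fun x _ => hgC.differentiable (by simp) x)
      (fun x hx => ((hh.contDiffAt (hU.mem_nhds (hgsC hx))).differentiableAt (by simp)))
  have h0 := horth _ v hgC hgcC hgsC
  simp only [antilinearPart_apply, real_smul] at h0 ⊢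
  have e1 : ∀ z, (1 / 2 : ℂ) • (fderiv ℝ (fun z => (g z : ℂ)) z v +
      I • fderiv ℝ (fun z => (g z : ℂ)) z (I • v)) * h z =
      (1 / 2 : ℂ) * (fderiv ℝ (fun z => (g z : ℂ)) z v * h z) +
        (1 / 2 * I) * (fderiv ℝ (fun z => (g z : ℂ)) z (I • v) * h z) := fun z => by
    simp only [smul_eq_mul]; ring
  have e2 : ∀ z, (g z : ℂ) * (1 / 2 : ℂ) • (fderiv ℝ h z v + I • fderiv ℝ h z (I • v)) =
      (1 / 2 : ℂ) * ((g z : ℂ) * fderiv ℝ h z v) +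
        (1 / 2 * I) * ((g z : ℂ) * fderiv ℝ h z (I • v)) := fun z => by
    simp only [smul_eq_mul]; ring
  simp only [e1] at h0
  simp only [e2]
  rw [integral_add ((i1 _).const_mul _) ((i1 _).const_mul _), integral_const_mul,
    integral_const_mul] at h0
  rw [integral_add ((i2 _).const_mul _) ((i2 _).const_mul _), integral_const_mul,
    integral_const_mul, parts, parts]
  linear_combination -h0

end Regularity

end

end ComplexForms

/-! ### Densities as (3,0)-forms and their change of variables. -/

namespace ComplexForms

open Complex Filter Topology Set MeasureTheory

noncomputable section

section Density

variable {E : Type*} [NormedAddCommGroup E] [NormedSpace ℂ E]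
  {X : Type*} [TopologicalSpace X] [ChartedSpace E X] [IsManifold 𝓘(ℂ, E) ω X]
  {b : Module.Basis (Fin 3) ℂ E} {e e' : OpenPartialHomeomorph X E} {χ : X → ℝ}

variable (b e) in
/-- The `(3, 0)`-form given by `q dz₁ ∧ dz₂ ∧ dz₃` in the chart `e`, and zero elsewhere. -/
def pushVol (q : E → ℂ) : CForm E X (3 + 0) := push e fun z => q z • volForm b

theorem inChart_pushVol_of_mem (he : e ∈ atlas E X) (he' : e' ∈ atlas E X) (q : E → ℂ) {z : E}
    (hz : z ∈ e'.target) (hz' : e'.symm z ∈ e.source) :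
    (pushVol b e q).inChart e' z b = q (e (e'.symm z)) *
      LinearMap.det (fderiv ℂ (e ∘ e'.symm) z : E →ₗ[ℂ] E) := by
  have h1 := push_inChart_transition (k := 3) (θ := fun z => q z • volForm b) he he' hz hz'
  refine (congrArg (fun β : E [⋀^Fin 3]→L[ℝ] ℂ => β b) h1).trans ?_
  have h2 := congrArg (fun β : E [⋀^Fin 3]→L[ℝ] ℂ => β b)
    (volForm_comp b (fderiv ℂ (e ∘ e'.symm) z))
  refine congrArg (q (e (e'.symm z)) * ·) (h2.trans ?_)
  change _ * b.det b = _
  rw [Module.Basis.det_self, mul_one]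

theorem inChart_pushConj_of_mem (he : e ∈ atlas E X) (he' : e' ∈ atlas E X) (q : E → ℂ) {z : E}
    (hz : z ∈ e'.target) (hz' : e'.symm z ∈ e.source) :
    (pushConj b e q).inChart e' z b = q (e (e'.symm z)) *
      starRingEnd ℂ (LinearMap.det (fderiv ℂ (e ∘ e'.symm) z : E →ₗ[ℂ] E)) := by
  have h1 := push_inChart_transition (k := 3) (θ := fun z => q z • conjVolForm b) he he' hz hz'
  refine (congrArg (fun β : E [⋀^Fin 3]→L[ℝ] ℂ => β b) h1).trans ?_
  have h2 := congrArg (fun β : E [⋀^Fin 3]→L[ℝ] ℂ => β b)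
    (conjVolForm_comp b (fderiv ℂ (e ∘ e'.symm) z))
  refine congrArg (q (e (e'.symm z)) * ·) (h2.trans ?_)
  change _ * starRingEnd ℂ (b.det b) = _
  rw [Module.Basis.det_self, map_one, mul_one]

theorem inChart_push_of_notMem {k : ℕ} (he' : e' ∈ atlas E X) (θ : E → E [⋀^Fin k]→L[ℝ] ℂ) {z : E}
    (hz : z ∈ e'.target) (hz' : e'.symm z ∉ e.source) : (push e θ).inChart e' z = 0 := by
  rw [CForm.inChart_apply _ he' hz]
  have : (push e θ).valueAt (e'.symm z) = 0 := push_apply_of_notMem hz'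
  rw [this]
  rfl

/-- The cutoff χ keeps the support closed inside the chart domain, so extension by zero is
continuous although φ is defined on all of E. -/
theorem continuousOn_inChart_pushVol (he : e ∈ atlas E X) (he' : e' ∈ atlas E X) (hχc : Continuous χ)
    (hχ : tsupport χ ⊆ e.source) {φ : E → ℂ} (hφ : Continuous φ) :
    ContinuousOn (fun z => (pushVol b e fun w => (χ (e.symm w) : ℂ) * φ w).inChart e' z b)
      e'.target := by
  have : FiniteDimensional ℂ E := b.finiteDimensional_of_finite
  intro z hz
  refine ContinuousAt.continuousWithinAt ?_
  by_cases hz' : e'.symm z ∈ e.source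
  · have heq : (fun z => (pushVol b e fun w => (χ (e.symm w) : ℂ) * φ w).inChart e' z b) =ᶠ[𝓝 z]
        fun z => (χ (e'.symm z) : ℂ) * φ (e (e'.symm z)) *
          LinearMap.det (fderiv ℂ (e ∘ e'.symm) z : E →ₗ[ℂ] E) := by
      filter_upwards [eventually_mem_source_of_mem hz hz'] with y hy
      rw [inChart_pushVol_of_mem he he' _ hy.1 hy.2, e.left_inv hy.2]
    refine ContinuousAt.congr ?_ heq.symm
    have h1 : ContinuousAt e'.symm z := e'.continuousAt_symm hz
    have h2 : ContinuousAt (fun z => e (e'.symm z)) z :=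
      ContinuousAt.comp (g := e) (f := e'.symm) (e.continuousAt hz') h1
    have h3 : ContinuousAt (fderiv ℂ (e ∘ e'.symm)) z :=
      ((contDiffAt_transition he' he hz hz').fderiv_right (m := ω) le_top).continuousAt
    have h4 : ContinuousAt (fun z => (fderiv ℂ (e ∘ e'.symm) z).det) z :=
      ContinuousLinearMap.continuous_det.continuousAt.comp h3
    refine ContinuousAt.mul (ContinuousAt.mul ?_ (hφ.continuousAt.comp h2)) h4
    exact continuous_ofReal.continuousAt.comp (hχc.continuousAt.comp h1)
  · have h0 : ∀ᶠ x in 𝓝 (e'.symm z), χ x = 0 :=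
      notMem_tsupport_iff_eventuallyEq.1 fun h => hz' (hχ h)
    have heq : (fun z => (pushVol b e fun w => (χ (e.symm w) : ℂ) * φ w).inChart e' z b) =ᶠ[𝓝 z]
        fun _ => 0 := by
      filter_upwards [(e'.continuousAt_symm hz).eventually h0, e'.open_target.mem_nhds hz] with y hy hy'
      by_cases hy2 : e'.symm y ∈ e.source
      · rw [inChart_pushVol_of_mem he he' _ hy' hy2, e.left_inv hy2, hy]
        simp
      · exact congrArg (fun β : E [⋀^Fin 3]→L[ℝ] ℂ => β b) (inChart_push_of_notMem (k := 3) he' _ hy' hy2)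
    exact continuousAt_const.congr heq.symm

theorem abs_det_restrictScalars [FiniteDimensional ℂ E] (A : E →L[ℂ] E) :
    ((|(A.restrictScalars ℝ).det| : ℝ) : ℂ) =
      LinearMap.det (A : E →ₗ[ℂ] E) * starRingEnd ℂ (LinearMap.det (A : E →ₗ[ℂ] E)) := by
  have h : (A.restrictScalars ℝ).det = normSq (LinearMap.det (A : E →ₗ[ℂ] E)) := by
    rw [← Algebra.norm_complex_apply, ← LinearMap.det_restrictScalars]
    rfl
  rw [h, abs_of_nonneg (normSq_nonneg _), mul_conj]

variable [MeasurableSpace E] [BorelSpace E] (μ : Measure E) [μ.IsAddHaarMeasure]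

/-- Pairing a (3,0)-form with a (0,3)-form is chart independent: the real Jacobian is det times its
conjugate. The conjugate factor cancels against the transformation of the (0,3)-coefficient, and the
remaining factor transforms the (3,0)-coefficient. -/
theorem integral_cutCoeff_pushConj (he : e ∈ atlas E X) (he' : e' ∈ atlas E X) (φ : E → ℂ)
    {g : E → ℂ} (hg : tsupport g ⊆ e'.target) :
    ∫ w, φ w * cutCoeff b e χ (pushConj b e' g) w ∂μ =
      ∫ z, g z * (pushVol b e fun w => (χ (e.symm w) : ℂ) * φ w).inChart e' z b ∂μ := by
  have : FiniteDimensional ℂ E := b.finiteDimensional_of_finite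
  have : FiniteDimensional ℝ E := FiniteDimensional.complexToReal E
  set T : OpenPartialHomeomorph E E := e'.symm.trans e with hT
  have hs : ∀ z, z ∈ T.source ↔ z ∈ e'.target ∧ e'.symm z ∈ e.source := fun z => by simp [hT]
  have ht : ∀ w, w ∈ T.target ↔ w ∈ e.target ∧ e.symm w ∈ e'.source := fun w => by simp [hT]
  rw [← setIntegral_eq_integral_of_forall_compl_eq_zero (s := T.target),
    ← setIntegral_eq_integral_of_forall_compl_eq_zero (s := T.source)
      (f := fun z => g z * (pushVol b e fun w => (χ (e.symm w) : ℂ) * φ w).inChart e' z b),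
    integral_target_eq_integral_abs_det_fderiv_smul μ
      (f' := fun z => (fderiv ℂ (e ∘ e'.symm) z).restrictScalars ℝ)]
  · refine setIntegral_congr_fun T.open_source.measurableSet fun z hz => ?_
    obtain ⟨hz1, hz2⟩ := (hs z).1 hz
    have hw : e (e'.symm z) ∈ e.target := e.map_source hz2
    have hTz : T z = e (e'.symm z) := rfl
    have hw' : e.symm (e (e'.symm z)) ∈ e'.source := by rw [e.left_inv hz2]; exact e'.map_target hz1
    simp only [hTz]
    rw [cutCoeff_of_mem hw, inChart_pushConj_of_mem he' he _ hw hw',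
      inChart_pushVol_of_mem he he' _ hz1 hz2, e.left_inv hz2, e'.right_inv hz1, real_smul,
      abs_det_restrictScalars]
    have hd : LinearMap.det (fderiv ℂ (e' ∘ e.symm) (e (e'.symm z)) : E →ₗ[ℂ] E) *
        LinearMap.det (fderiv ℂ (e ∘ e'.symm) z : E →ₗ[ℂ] E) = 1 := by
      have h1 := fderiv_transition_comp he' he he' hz1 hz2 (e'.map_target hz1)
      rw [fderiv_transition_self e' hz1] at h1
      rw [← LinearMap.det_comp]
      have h2 := congrArg (fun A : E →L[ℂ] E => LinearMap.det (A : E →ₗ[ℂ] E)) h1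
      exact h2.trans LinearMap.det_id
    have hd' := congrArg (starRingEnd ℂ) hd
    rw [map_mul, map_one] at hd'
    linear_combination (φ (e (e'.symm z)) * χ (e'.symm z) * g z *
      LinearMap.det (fderiv ℂ (e ∘ e'.symm) z : E →ₗ[ℂ] E)) * hd'
  · intro z hz
    obtain ⟨hz1, hz2⟩ := (hs z).1 hz
    exact ((contDiffAt_transition he' he hz1 hz2).differentiableAt (by simp)).hasFDerivAt.restrictScalars ℝ
  · intro z hz
    by_cases hz1 : z ∈ e'.target
    · have hz2 : e'.symm z ∉ e.source := fun h => hz ((hs z).2 ⟨hz1, h⟩)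
      have : (pushVol b e fun w => (χ (e.symm w) : ℂ) * φ w).inChart e' z b = 0 :=
        congrArg (fun β : E [⋀^Fin 3]→L[ℝ] ℂ => β b) (inChart_push_of_notMem (k := 3) he' _ hz1 hz2)
      rw [this, mul_zero]
    · rw [image_eq_zero_of_notMem_tsupport fun h => hz1 (hg h), zero_mul]
  · intro w hw
    by_cases hw1 : w ∈ e.target
    · have hw2 : e.symm w ∉ e'.source := fun h => hw ((ht w).2 ⟨hw1, h⟩)
      have : (pushConj b e' g).inChart e w b = 0 :=
        congrArg (fun β : E [⋀^Fin 3]→L[ℝ] ℂ => β b) (inChart_push_of_notMem (k := 3) he _ hw1 hw2)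
      rw [cutCoeff_of_mem hw1, this, mul_zero, mul_zero]
    · rw [cutCoeff, indicator_of_notMem hw1, mul_zero]

end Density

end

end ComplexForms

/-! ### Serre duality in the case needed: exactness of (0,3)-forms. -/

namespace ComplexForms

open Complex Filter Topology Set MeasureTheory

noncomputable section

section Duality

variable {E : Type*} [NormedAddCommGroup E] [NormedSpace ℂ E]
  {X : Type*} [TopologicalSpace X] [ChartedSpace E X] [IsManifold 𝓘(ℂ, E) ω X]

theorem isManifold_real : IsManifold 𝓘(ℝ, E) ∞ X := by
  refine isManifold_of_contDiffOn _ _ _ fun e e' he he' => ?_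
  have h := ((contDiffOn_transition (X := X) he he').restrict_scalars ℝ).of_le (m := ∞) le_top
  simpa using h

theorem exists_finite_partition [FiniteDimensional ℂ E] [T2Space X] [CompactSpace X] :
    ∃ (t : Finset X) (χ : t → X → ℝ), (∀ i, Continuous (χ i)) ∧
      (∀ i, tsupport (χ i) ⊆ (chartAt E (i : X)).source) ∧
      (∀ i, ContDiffOn ℝ ∞ (χ i ∘ (chartAt E (i : X)).symm) (chartAt E (i : X)).target) ∧
      ∀ x, ∑ i, χ i x = 1 := by
  have : FiniteDimensional ℝ E := FiniteDimensional.complexToReal E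
  have : IsManifold 𝓘(ℝ, E) ∞ X := isManifold_real
  obtain ⟨t, ht⟩ := isCompact_univ.elim_finite_subcover (fun x : X => (chartAt E x).source)
    (fun x => (chartAt E x).open_source) fun x _ => mem_iUnion.2 ⟨x, mem_chart_source E x⟩
  obtain ⟨f, hf⟩ := SmoothPartitionOfUnity.exists_isSubordinate 𝓘(ℝ, E) (isClosed_univ (X := X))
    (fun x : t => (chartAt E (x : X)).source) (fun x => (chartAt E (x : X)).open_source)
    (fun x hx => by simpa using ht hx)
  refine ⟨t, fun i => f i, fun i => (f i).contMDiff.continuous, hf, fun i => ?_, fun x => ?_⟩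
  · have h1 := contMDiffOn_symm_of_mem_maximalAtlas (I := 𝓘(ℝ, E)) (n := ∞)
      (IsManifold.subset_maximalAtlas (chart_mem_atlas E (i : X)))
    exact contMDiffOn_iff_contDiffOn.1 ((f i).contMDiff.comp_contMDiffOn h1)
  · rw [← finsum_eq_sum_of_fintype]
    exact f.sum_eq_one trivial

variable (b : Module.Basis (Fin 3) ℂ E)

omit [IsManifold 𝓘(ℂ, E) ω X] in
theorem pushVol_hasBidegree (e : OpenPartialHomeomorph X E) (q : E → ℂ) :
    (pushVol b e q).HasBidegree 3 0 := by
  refine push_hasBidegree (p := 3) (q := 0) fun y ζ v => ?_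
  change q y * b.det _ = _ * (q y * b.det v)
  have := det_smul_vec b ζ v
  refine (congrArg (q y * ·) this).trans ?_
  rw [pow_zero]
  ring

omit [IsManifold 𝓘(ℂ, E) ω X] in
theorem CForm.HasBidegree.sum {p q : ℕ} {ι : Type*} {s : Finset ι} {F : ι → CForm E X (p + q)}
    (h : ∀ i ∈ s, (F i).HasBidegree p q) : (∑ i ∈ s, F i).HasBidegree p q := by
  intro x ζ v
  have h1 : ∀ w : Fin (p + q) → E, (∑ i ∈ s, F i) x w = ∑ i ∈ s, F i x w := fun w =>
    map_sum (CForm.evalAt (E := E) (X := X) x w) _ _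
  refine (h1 _).trans ?_
  refine Eq.trans ?_ (congrArg (ζ ^ p * (starRingEnd ℂ) ζ ^ q * ·) (h1 v)).symm
  rw [Finset.mul_sum]
  exact Finset.sum_congr rfl fun i hi => h i hi x ζ v

/-- A `(3, 0)`-form with holomorphic coefficients is smooth and closed. -/
theorem mem_closedForms_of_antilinearPart_eq_zero [FiniteDimensional ℂ E] {ψ : CForm E X (3 + 0)}
    (hψ : ψ.HasBidegree 3 0)
    (hd : ∀ e ∈ atlas E X, ContDiffOn ℝ ∞ (fun z => ψ.inChart e z b) e.target)
    (h0 : ∀ e ∈ atlas E X, ∀ z ∈ e.target, antilinearPart (fderiv ℝ (fun z => ψ.inChart e z b) z) = 0) :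
    ψ ∈ closedForms E X 3 0 := by
  have heq : ∀ e ∈ atlas E X, ∀ z ∈ e.target, ψ.inChart e z = ψ.inChart e z b • volForm b := by
    intro e he z hz
    refine eq_smul_volForm b (α := ψ.inChart e z) fun ζ v => ?_
    have := hψ.inChart he hz ζ v
    rw [pow_zero, mul_one] at this
    exact this
  refine ⟨⟨fun e he => ?_, hψ⟩, ?_⟩
  · exact (ContDiffOn.fun_smul (hd e he) contDiffOn_const).congr (heq e he)
  · funext x
    change ψ.dbar.valueAt x = 0
    have he := chart_mem_atlas E x
    have hx := mem_chart_target E x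
    have hn := (chartAt E x).open_target.mem_nhds hx
    have hev : ψ.inChart (chartAt E x) =ᶠ[𝓝 (chartAt E x x)]
        fun z => ψ.inChart (chartAt E x) z b • volForm b := by
      filter_upwards [hn] with z hz
      exact heq _ he z hz
    rw [CForm.dbar_valueAt, hev.dbarModel_eq, dbarModel_smul_const, h0 _ he _ hx]
    · have : (0 : E →L[ℝ] ℂ).smulRight (volForm b) = 0 := by
        ext v w
        exact zero_mul _
      rw [this]
      exact (ContinuousAlternatingMap.alternatizeUncurryFinCLM ℝ E ℂ).map_zero
    · exact ((hd _ he).contDiffAt hn).differentiableAt (by simp)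

/-- If there are no nonzero holomorphic `3`-forms, then every smooth `(0, 3)`-form is exact. -/
theorem smoothForms_le_exactForms (b : Module.Basis (Fin 3) ℂ E) [T2Space X] [CompactSpace X]
    (hA : ∀ ψ ∈ closedForms E X 3 0, ψ = 0) : smoothForms E X 0 3 ≤ exactForms E X 0 3 := by
  have : FiniteDimensional ℂ E := b.finiteDimensional_of_finite
  have : FiniteDimensional ℝ E := FiniteDimensional.complexToReal E
  borelize E
  let μ : Measure E := Measure.addHaar
  obtain ⟨s, χ, hχc, hχ, hχ', hsum⟩ := exists_finite_partition (E := E) (X := X)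
  intro f hf
  by_contra hfe
  -- A purely algebraic functional; no topology on the space of forms is used.
  obtain ⟨t, htf, hker⟩ := Submodule.exists_le_ker_of_notMem hfe
  have ht : ∀ f ∈ exactForms E X 0 3, t f = 0 := fun f hf => hker hf
  have he : ∀ i : s, chartAt E (i : X) ∈ atlas E X := fun i => chart_mem_atlas E _
  obtain ⟨φ, hφ⟩ := exists_density (b := b) μ he hχ hχ' hsum ht
  -- The local densities, weighted by the partition of unity, are glued to one global (3,0)-form
  -- representing t.
  let ψ : CForm E X (3 + 0) := ∑ i : s, pushVol b (chartAt E (i : X))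
    fun w => (χ i ((chartAt E (i : X)).symm w) : ℂ) * φ i w
  have hψ : ∀ e (z : E), ψ.inChart e z b = ∑ i : s, (pushVol b (chartAt E (i : X))
      fun w => (χ i ((chartAt E (i : X)).symm w) : ℂ) * φ i w).inChart e z b := fun e z =>
    map_sum (CForm.evalAt (E := E) (X := X) (k := 3 + 0) (e.symm z)
      (fun i => mfderiv 𝓘(ℂ, E) 𝓘(ℂ, E) e.symm z (b i))) _ _
  have hcont : ∀ e ∈ atlas E X, ContinuousOn (fun z => ψ.inChart e z b) e.target := by
    intro e he'
    simp only [hψ]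
    exact continuousOn_finsetSum _ fun i _ =>
      continuousOn_inChart_pushVol (he i) he' (hχc i) (hχ i) (φ i).continuous
  have hdens : ∀ e ∈ atlas E X, ∀ g : E → ℂ, ContDiff ℝ ∞ g → HasCompactSupport g →
      tsupport g ⊆ e.target → t (pushConj b e g) = ∫ z, g z * ψ.inChart e z b ∂μ := by
    intro e he' g hg hgc hgs
    rw [hφ _ (pushConj_mem_smoothForms he' hg hgc hgs)]
    simp only [hψ, Finset.mul_sum]
    rw [integral_finsetSum]
    · exact Finset.sum_congr rfl fun i _ => integral_cutCoeff_pushConj μ (he i) he' _ hgs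
    · exact fun i _ => integrable_mul_of_continuousOn
        (continuousOn_inChart_pushVol (he i) he' (hχc i) (hχ i) (φ i).continuous)
        hg.continuous hgc hgs
  have hsmooth : ∀ e ∈ atlas E X, ContDiffOn ℝ ∞ (fun z => ψ.inChart e z b) e.target := by
    intro e he'
    refine contDiffOn_of_mollify_invariant (μ := μ) e.open_target (hcont e he') ?_
    intro ρ ε hρ hρs hρi hρint g hg hgc hgs
    have : ProperSpace E := FiniteDimensional.proper ℝ E
    have hm0 := tsupport_mollify_subset (μ := μ) hρs (g := g)
    have hmc : HasCompactSupport fun z => ∫ w, (ρ (z - w) : ℂ) * g w ∂μ :=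
      IsCompact.of_isClosed_subset (hgc.isCompact.cthickening) (isClosed_tsupport _) hm0
    rw [← hdens e he' g hg hgc ((subset_closure.trans
      (Metric.closure_subset_cthickening _ _)).trans hgs),
      ← hdens e he' _ (contDiff_mollify hρ hρs hg hgc) hmc (hm0.trans hgs)]
    exact map_pushConj_mollify μ ht he' hρ hρs hρi hρint hg hgc hgs
  have hhol : ∀ e ∈ atlas E X, ∀ z ∈ e.target,
      antilinearPart (fderiv ℝ (fun z => ψ.inChart e z b) z) = 0 := by
    intro e he' z hz
    refine antilinearPart_fderiv_eq_zero (μ := μ) e.open_target (hsmooth e he') ?_ hz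
    intro u v hu huc hus
    -- The test forms u ι_v(dz̄₁∧dz̄₂∧dz̄₃) have ∂̄ equal to ∂̄u(v) dz̄₁∧dz̄₂∧dz̄₃. Since t kills
    -- these, ψ is orthogonal to all conjugate-linear derivatives of test functions.
    have hb : ∀ z, dbarModel (fun z => u z • (conjVolForm b).curryLeft v) z =
        antilinearPart (fderiv ℝ u z) v • conjVolForm b := by
      intro z
      rw [dbarModel_smul_const (hu.differentiable (by simp) z)]
      exact alternatizeUncurryFin_smulRight_curryLeft_conjVolForm b
        (fun ζ w => antilinearPart_map_smul _ _ _) v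
    have hDu : ContDiff ℝ ∞ fun z => antilinearPart (fderiv ℝ u z) v := by
      have : ContDiff ℝ ∞ (fderiv ℝ u) := hu.fderiv_right (by simp)
      simp only [antilinearPart_apply]
      have h1 : ∀ w : E, ContDiff ℝ ∞ fun z => fderiv ℝ u z w := fun w => this.clm_apply contDiff_const
      exact ContDiff.const_smul _ ((h1 v).add ((h1 (I • v)).const_smul I))
    have hDus : tsupport (fun z => antilinearPart (fderiv ℝ u z) v) ⊆ tsupport u := by
      refine (closure_mono (show Function.support (fun z => antilinearPart (fderiv ℝ u z) v) ⊆
        Function.support (fderiv ℝ u) from fun z hz h0 => hz ?_)).trans (tsupport_fderiv_subset ℝ)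
      simp only [antilinearPart_apply, h0]
      simp
    have hDuc : HasCompactSupport fun z => antilinearPart (fderiv ℝ u z) v :=
      IsCompact.of_isClosed_subset huc (isClosed_tsupport _) hDus
    have hθ : ContDiff ℝ ∞ fun z => u z • (conjVolForm b).curryLeft v :=
      ContDiff.fun_smul hu contDiff_const
    have hθs : tsupport (fun z => u z • (conjVolForm b).curryLeft v) ⊆ tsupport u := by
      refine closure_mono (show Function.support (fun z => u z • (conjVolForm b).curryLeft v) ⊆
        Function.support u from fun z hz h0 => hz ?_)
      ext w
      change u z * _ = 0
      rw [h0, zero_mul]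
    have hθc : HasCompactSupport fun z => u z • (conjVolForm b).curryLeft v :=
      IsCompact.of_isClosed_subset huc (isClosed_tsupport _) hθs
    rw [← hdens e he' _ hDu hDuc (hDus.trans hus)]
    refine ht _ ⟨pushConj_mem_smoothForms he' hDu hDuc (hDus.trans hus),
      push e fun z => u z • (conjVolForm b).curryLeft v, ⟨?_, ?_⟩, ?_⟩
    · exact push_isSmooth he' hθ hθc (hθs.trans hus)
    · refine push_hasBidegree (p := 0) (q := 2) fun y ζ w => ?_
      change u y * conjVolForm b (Matrix.vecCons v _) = _ * (u y * conjVolForm b (Matrix.vecCons v w))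
      rw [conjVolForm_apply, conjVolForm_apply, det_vecCons_smul, map_mul, map_pow, pow_zero]
      ring
    · rw [dbar_push he' hθ hθc (hθs.trans hus)]
      exact congrArg (push (k := 3) e) (funext hb)
  have hψ0 : ψ = 0 := hA ψ (mem_closedForms_of_antilinearPart_eq_zero b
    (CForm.HasBidegree.sum fun i _ => pushVol_hasBidegree b _ _) hsmooth hhol)
  refine htf ?_
  -- The form f is a sum of pieces supported in charts, and on each piece t is integration against ψ
  -- = 0.
  rw [← sum_pushConj_cutCoeff (b := b) he hχ hsum hf.2, map_sum]
  refine Finset.sum_eq_zero fun i _ => ?_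
  rw [hdens _ (he i) _ (contDiff_cutCoeff (he i) (hχ i) (hχ' i) hf.1)
    (IsCompact.of_isClosed_subset (isCompact_image_tsupport (hχ i)) (isClosed_tsupport _)
      (tsupport_cutCoeff_subset (hχ i)))
    ((tsupport_cutCoeff_subset (hχ i)).trans (image_tsupport_subset (hχ i))), hψ0]
  refine integral_eq_zero_of_ae (Eventually.of_forall fun z => ?_)
  exact mul_zero _

end Duality

end

end ComplexForms

/-! ### The form dz₁∧dz₂∧dz₃ wedged with its conjugate, and the complex orientation. -/

namespace ComplexForms

open Complex Filter Topology Set MeasureTheory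

noncomputable section

section Orientation

/-- A Laplace expansion: the antisymmetrized product of two `3 × 3` minors is a multiple of a
`6 × 6` determinant. -/
theorem sum_sign_det_mul_det (Z Z' : Fin 3 ⊕ Fin 3 → Fin 3 → ℂ) :
    ∑ s : Equiv.Perm (Fin 3 ⊕ Fin 3), (Equiv.Perm.sign s : ℂ) *
      ((Matrix.of fun j k => Z (s (Sum.inl j)) k).det *
        (Matrix.of fun j k => Z' (s (Sum.inr j)) k).det) =
      36 * (Matrix.of fun i => Sum.elim (Z i) (Z' i)).det := by
  set D := (Matrix.of fun i => Sum.elim (Z i) (Z' i)).det with hD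
  have hDs : D = ∑ s : Equiv.Perm (Fin 3 ⊕ Fin 3), (Equiv.Perm.sign s : ℂ) *
      ((∏ j, Z (s (Sum.inl j)) j) * ∏ j, Z' (s (Sum.inr j)) j) := by
    rw [hD, Matrix.det_apply']
    refine Finset.sum_congr rfl fun s _ => ?_
    rw [Fintype.prod_sum_type]
    rfl
  -- Each of the (3!)² = 36 pairs (p, q) in the expanded minors contributes the full determinant:
  -- reindexing s by (p, q) cancels both signs.
  have key : ∀ p q : Equiv.Perm (Fin 3), ∑ s : Equiv.Perm (Fin 3 ⊕ Fin 3), (Equiv.Perm.sign s : ℂ) *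
      (((Equiv.Perm.sign p : ℂ) * ∏ j, Z (s (Sum.inl (p j))) j) *
        ((Equiv.Perm.sign q : ℂ) * ∏ j, Z' (s (Sum.inr (q j))) j)) = D := by
    intro p q
    rw [hDs, ← Equiv.sum_comp (Equiv.mulRight (Equiv.Perm.sumCongr p q)) fun s =>
      (Equiv.Perm.sign s : ℂ) * ((∏ j, Z (s (Sum.inl j)) j) * ∏ j, Z' (s (Sum.inr j)) j)]
    refine Finset.sum_congr rfl fun s _ => ?_
    simp only [Equiv.coe_mulRight, Equiv.Perm.sign_mul, Equiv.Perm.sign_sumCongr, Units.val_mul,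
      Int.cast_mul, Equiv.Perm.mul_apply, Equiv.Perm.sumCongr_apply, Sum.map_inl, Sum.map_inr]
    ring
  have hexp : ∀ s : Equiv.Perm (Fin 3 ⊕ Fin 3), (Equiv.Perm.sign s : ℂ) *
      ((Matrix.of fun j k => Z (s (Sum.inl j)) k).det *
        (Matrix.of fun j k => Z' (s (Sum.inr j)) k).det) =
      ∑ p : Equiv.Perm (Fin 3), ∑ q : Equiv.Perm (Fin 3), (Equiv.Perm.sign s : ℂ) *
      (((Equiv.Perm.sign p : ℂ) * ∏ j, Z (s (Sum.inl (p j))) j) *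
        ((Equiv.Perm.sign q : ℂ) * ∏ j, Z' (s (Sum.inr (q j))) j)) := by
    intro s
    rw [Matrix.det_apply', Matrix.det_apply', Finset.sum_mul_sum, Finset.mul_sum]
    exact Finset.sum_congr rfl fun p _ => Finset.mul_sum _ _ _
  rw [Finset.sum_congr rfl fun s _ => hexp s, Finset.sum_comm]
  have : ∀ p : Equiv.Perm (Fin 3), ∑ s : Equiv.Perm (Fin 3 ⊕ Fin 3), ∑ q : Equiv.Perm (Fin 3),
      (Equiv.Perm.sign s : ℂ) * (((Equiv.Perm.sign p : ℂ) * ∏ j, Z (s (Sum.inl (p j))) j) *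
        ((Equiv.Perm.sign q : ℂ) * ∏ j, Z' (s (Sum.inr (q j))) j)) = 6 * D := by
    intro p
    rw [Finset.sum_comm, Finset.sum_congr rfl fun q _ => key p q, Finset.sum_const, Finset.card_univ,
      Fintype.card_perm, nsmul_eq_mul]
    norm_num [Nat.factorial]
  rw [Finset.sum_congr rfl fun p _ => this p, Finset.sum_const, Finset.card_univ,
      Fintype.card_perm, nsmul_eq_mul]
  norm_num [Nat.factorial]
  ring

variable {E : Type*} [NormedAddCommGroup E] [NormedSpace ℂ E] (b : Module.Basis (Fin 3) ℂ E)

/-- The real and imaginary parts of the complex coordinates. -/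
def realCoord : E →ₗ[ℝ] (Fin 3 ⊕ Fin 3 → ℝ) where
  toFun v := Sum.elim (fun j => (b.repr v j).re) fun j => (b.repr v j).im
  map_add' v w := by
    ext (j | j) <;> simp
  map_smul' c v := by
    have h : b.repr (c • v) = (c : ℂ) • b.repr v := by rw [← map_smul, Complex.coe_smul]
    ext (j | j) <;> simp [h]

theorem realCoord_injective : Function.Injective (realCoord b) := by
  intro v w h
  refine b.ext_elem fun j => Complex.ext ?_ ?_
  · exact congrFun h (Sum.inl j)
  · exact congrFun h (Sum.inr j)

/-- The determinant of six vectors in the real coordinates of the complex vector space `E`. -/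
def realDet (v : Fin 3 ⊕ Fin 3 → E) : ℝ := (Matrix.of fun i => realCoord b (v i)).det

theorem realDet_ne_zero {v : Fin 3 ⊕ Fin 3 → E} (hv : LinearIndependent ℝ v) : realDet b v ≠ 0 := by
  have h1 : LinearIndependent ℝ fun i => realCoord b (v i) :=
    hv.map' (realCoord b) (LinearMap.ker_eq_bot.2 (realCoord_injective b))
  have h2 := (Matrix.linearIndependent_rows_iff_isUnit (A := Matrix.of fun i => realCoord b (v i))).1 h1
  rw [Matrix.isUnit_iff_isUnit_det] at h2
  exact h2.ne_zero

/-- The matrix of the zⱼ and z̄ⱼ is the real coordinate matrix times the block matrix with rows (1,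
1) and (I, -I), of determinant (-2I)³ = 8I. With the Laplace factor 36 this gives 288 I. -/
theorem sum_sign_volForm (v : Fin 3 ⊕ Fin 3 → E) :
    ∑ s : Equiv.Perm (Fin 3 ⊕ Fin 3), (Equiv.Perm.sign s : ℂ) *
      (volForm b (fun j => v (s (Sum.inl j))) *
        starRingEnd ℂ (volForm b fun j => v (s (Sum.inr j)))) = 288 * I * realDet b v := by
  have h1 : ∀ w : Fin 3 → E, volForm b w = (Matrix.of fun j k => b.repr (w j) k).det := fun w => by
    rw [volForm_apply, Module.Basis.det_apply, ← Matrix.det_transpose]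
    rfl
  have h2 : ∀ w : Fin 3 → E, starRingEnd ℂ (volForm b w) =
      (Matrix.of fun j k => starRingEnd ℂ (b.repr (w j) k)).det := fun w => by
    rw [h1, RingHom.map_det]
    rfl
  simp_rw [h2, h1]
  refine (sum_sign_det_mul_det (fun i => b.repr (v i))
    (fun i k => starRingEnd ℂ (b.repr (v i) k))).trans ?_
  have h3 : (Matrix.of fun i => Sum.elim (fun k => b.repr (v i) k)
      (fun k => starRingEnd ℂ (b.repr (v i) k)) : Matrix (Fin 3 ⊕ Fin 3) (Fin 3 ⊕ Fin 3) ℂ) =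
      (Matrix.of fun i => realCoord b (v i)).map ofReal *
        Matrix.fromBlocks 1 1 (I • 1) ((-I) • 1) := by
    ext i (j | j)
    · simp [Matrix.mul_apply, realCoord, Matrix.one_apply]
    · simp [Matrix.mul_apply, realCoord, Matrix.one_apply]
      apply Complex.ext <;> simp
  have h4 : (Matrix.fromBlocks 1 1 (I • 1) ((-I) • 1) :
      Matrix (Fin 3 ⊕ Fin 3) (Fin 3 ⊕ Fin 3) ℂ).det = 8 * I := by
    rw [Matrix.det_fromBlocks_one₁₁]
    have : ((-I) • 1 - I • 1 * 1 : Matrix (Fin 3) (Fin 3) ℂ) = (-2 * I) • 1 := by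
      rw [mul_one, ← sub_smul]
      congr 1
      ring
    rw [this, Matrix.det_smul, Matrix.det_one, Fintype.card_fin, mul_one, mul_pow, I_pow_three]
    ring
  rw [h3, Matrix.det_mul, h4]
  have h5 : ((Matrix.of fun i => realCoord b (v i)).map ofReal).det = (realDet b v : ℂ) := by
    rw [realDet]
    exact (RingHom.map_det ofRealHom _).symm
  rw [h5]
  ring

/-- A complex linear map multiplies vol and its conjugate by det and its conjugate. Comparing the
two instances of `sum_sign_volForm` gives the real determinant |det|². -/
theorem realDet_comp (A : E →L[ℂ] E) (v : Fin 3 ⊕ Fin 3 → E) :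
    realDet b (fun i => A (v i)) = normSq (LinearMap.det (A : E →ₗ[ℂ] E)) * realDet b v := by
  have h : ∀ w : Fin 3 → E, volForm b (fun j => A (w j)) =
      LinearMap.det (A : E →ₗ[ℂ] E) * volForm b w := fun w =>
    congrArg (fun β : E [⋀^Fin 3]→L[ℝ] ℂ => β w) (volForm_comp b A)
  have h1 := sum_sign_volForm b fun i => A (v i)
  have h2 := sum_sign_volForm b v
  have h3 : ∑ s : Equiv.Perm (Fin 3 ⊕ Fin 3), (Equiv.Perm.sign s : ℂ) *
      (volForm b (fun j => A (v (s (Sum.inl j)))) *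
        starRingEnd ℂ (volForm b fun j => A (v (s (Sum.inr j))))) =
      normSq (LinearMap.det (A : E →ₗ[ℂ] E)) * (288 * I * realDet b v) := by
    rw [← h2, Finset.mul_sum]
    refine Finset.sum_congr rfl fun s _ => ?_
    rw [h, h, map_mul, ← mul_conj]
    ring
  have h4 : (realDet b (fun i => A (v i)) : ℂ) =
      normSq (LinearMap.det (A : E →ₗ[ℂ] E)) * realDet b v := by
    have : (288 * I : ℂ) ≠ 0 := by simp
    refine mul_left_cancel₀ this ?_
    rw [← h1, h3]
    ring
  exact_mod_cast h4

theorem continuous_realDet : Continuous (realDet b) := by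
  have : FiniteDimensional ℂ E := b.finiteDimensional_of_finite
  have : FiniteDimensional ℝ E := FiniteDimensional.complexToReal E
  have h : Continuous (realCoord b) := LinearMap.continuous_of_finiteDimensional _
  refine Continuous.matrix_det ?_
  exact continuous_pi fun i => h.comp (continuous_apply i)

end Orientation

end

end ComplexForms

/-! ### Cutoffs, integrability, and the disappearing boundary term. -/

namespace ComplexForms

open Complex Filter Topology Set MeasureTheory

noncomputable section

section Cutoff

variable {W : Type*} [NormedAddCommGroup W] [NormedSpace ℝ W] [FiniteDimensional ℝ W]

/-- Smooth cutoff functions exhausting the space, with gradients decaying uniformly like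
`1 / (1 + ‖w‖)`. -/
theorem exists_cutoff_sequence : ∃ (χ : ℕ → W → ℝ) (K : ℝ), (∀ n, ContDiff ℝ ∞ (χ n)) ∧
    (∀ n, HasCompactSupport (χ n)) ∧ (∀ n w, |χ n w| ≤ K) ∧
    (∀ n w v, |fderiv ℝ (χ n) w v| ≤ K * (1 + ‖w‖)⁻¹ * ‖v‖) ∧
    (∀ w, Tendsto (fun n => χ n w) atTop (𝓝 1)) ∧
    ∀ w v, Tendsto (fun n => fderiv ℝ (χ n) w v) atTop (𝓝 0) := by
  obtain ⟨f, hf, hc, -, h1⟩ := exists_smooth_cutoff (E := W) (K := Metric.closedBall 0 1)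
    (U := univ) (isCompact_closedBall _ _) isOpen_univ (subset_univ _)
  obtain ⟨K₁, hK₁⟩ := hc.exists_bound_of_continuous hf.continuous
  have hf' : Continuous (fderiv ℝ f) := hf.continuous_fderiv (by simp)
  obtain ⟨K₂, hK₂⟩ := (hc.fderiv ℝ).exists_bound_of_continuous hf'
  obtain ⟨ρ, hρ⟩ := (hc.fderiv ℝ).isCompact.isBounded.subset_closedBall (0 : W)
  have hK₁' : 0 ≤ K₁ := (norm_nonneg _).trans (hK₁ 0)
  have hK₂' : 0 ≤ K₂ := (norm_nonneg _).trans (hK₂ 0)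
  set r : ℕ → ℝ := fun n => (n + 1 : ℝ) with hr
  have hrpos : ∀ n, 0 < r n := fun n => by positivity
  have hr1 : ∀ n, 1 ≤ r n := fun n => by simp [hr]
  have hrinv : Tendsto (fun n => (r n)⁻¹) atTop (𝓝 0) :=
    tendsto_inv_atTop_zero.comp
      (tendsto_atTop_add_const_right _ _ tendsto_natCast_atTop_atTop)
  have hd : ∀ n w v, fderiv ℝ (fun w => f ((r n)⁻¹ • w)) w v =
      (r n)⁻¹ * fderiv ℝ f ((r n)⁻¹ • w) v := fun n w v => by
    rw [fderiv_comp_smul, smul_apply, smul_eq_mul]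
  have hb : ∀ n w v, |fderiv ℝ f ((r n)⁻¹ • w) v| ≤ K₂ * ‖v‖ := fun n w v =>
    (ContinuousLinearMap.le_opNorm _ _).trans (mul_le_mul_of_nonneg_right (hK₂ _) (norm_nonneg _))
  refine ⟨fun n w => f ((r n)⁻¹ • w), K₁ + K₂ * (1 + |ρ|), fun n => ?_, fun n => ?_,
    fun n w => ?_, fun n w v => ?_, fun w => ?_, fun w v => ?_⟩
  · exact hf.comp (contDiff_const_smul _)
  · exact hc.comp_smul (inv_ne_zero (hrpos n).ne')
  · exact (hK₁ _).trans (le_add_of_nonneg_right (by positivity))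
  · rw [hd, abs_mul, abs_of_pos (inv_pos.2 (hrpos n))]
    by_cases hw : (r n)⁻¹ • w ∈ tsupport (fderiv ℝ f)
    · have h2 : ‖w‖ ≤ r n * ρ := by
        have := mem_closedBall_zero_iff.1 (hρ hw)
        rwa [norm_smul, norm_inv, Real.norm_of_nonneg (hrpos n).le, inv_mul_le_iff₀ (hrpos n)]
          at this
      -- On the support of the gradient ‖w‖ is at most a constant times r n, so 1/r n is bounded by
      -- a constant times 1/(1+‖w‖), uniformly in n.
      have h3 : (r n)⁻¹ ≤ (1 + |ρ|) * (1 + ‖w‖)⁻¹ := by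
        rw [← div_eq_mul_inv, le_div_iff₀ (by positivity), inv_mul_le_iff₀ (hrpos n)]
        nlinarith [hr1 n, le_abs_self ρ, hrpos n]
      calc (r n)⁻¹ * |fderiv ℝ f ((r n)⁻¹ • w) v|
          ≤ ((1 + |ρ|) * (1 + ‖w‖)⁻¹) * (K₂ * ‖v‖) :=
            mul_le_mul h3 (hb n w v) (abs_nonneg _) (by positivity)
        _ = (0 + K₂ * (1 + |ρ|)) * (1 + ‖w‖)⁻¹ * ‖v‖ := by ring
        _ ≤ _ := by gcongr
    · rw [image_eq_zero_of_notMem_tsupport hw]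
      simp only [zero_apply, abs_zero, mul_zero]
      positivity
  · have h3 : Tendsto (fun n => (r n)⁻¹ * ‖w‖) atTop (𝓝 0) := by
      simpa using hrinv.mul_const ‖w‖
    refine tendsto_const_nhds.congr' ?_
    filter_upwards [h3.eventually (ge_mem_nhds (zero_lt_one' ℝ))] with n hn
    refine (h1 _ ?_).symm
    rw [mem_closedBall_zero_iff, norm_smul, norm_inv, Real.norm_of_nonneg (hrpos n).le]
    exact hn
  · simp_rw [hd]
    have h3 : Tendsto (fun n => (r n)⁻¹ * (K₂ * ‖v‖)) atTop (𝓝 0) := by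
      simpa using hrinv.mul_const (K₂ * ‖v‖)
    refine squeeze_zero_norm (fun n => ?_) h3
    rw [norm_mul, norm_inv, Real.norm_of_nonneg (hrpos n).le]
    exact mul_le_mul_of_nonneg_left (hb n w v) (inv_pos.2 (hrpos n)).le

end Cutoff

section Stokes

variable {W : Type*} [NormedAddCommGroup W] [NormedSpace ℝ W] [FiniteDimensional ℝ W]
  [MeasurableSpace W] [BorelSpace W] (μ : Measure W) [μ.IsAddHaarMeasure]

/-- The integrand is O((1+‖w‖)⁻⁷), just above the critical exponent 6. It dominates the gradient of
a cutoff times a bounded β times the decaying form, so dominated convergence removes the boundary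
term. -/
theorem integrable_inv_mul_inv_norm_sq_pow (hW : Module.finrank ℝ W = 6) :
    Integrable (fun w : W => (1 + ‖w‖)⁻¹ * (16 / (‖w‖ ^ 2 + 4)) ^ 3) μ := by
  have h := (integrable_one_add_norm (E := W) (μ := μ) (r := 7) (by rw [hW]; norm_num)).const_mul
    (32 ^ 3)
  refine h.mono' ?_ (Eventually.of_forall fun w => ?_)
  · refine Continuous.aestronglyMeasurable ?_
    have h1 : ∀ w : W, 1 + ‖w‖ ≠ 0 := fun w => by positivity
    have h2 : ∀ w : W, ‖w‖ ^ 2 + 4 ≠ 0 := fun w => by positivity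
    fun_prop (disch := assumption)
  · rw [Real.norm_of_nonneg (by positivity), Real.rpow_neg (by positivity)]
    norm_cast
    have h3 : 16 / (‖w‖ ^ 2 + 4) ≤ 32 * ((1 + ‖w‖) ^ 2)⁻¹ := by
      rw [← div_eq_mul_inv, div_le_div_iff₀ (by positivity) (by positivity)]
      nlinarith [sq_nonneg (‖w‖ - 1)]
    calc (1 + ‖w‖)⁻¹ * (16 / (‖w‖ ^ 2 + 4)) ^ 3
        ≤ (1 + ‖w‖)⁻¹ * (32 * ((1 + ‖w‖) ^ 2)⁻¹) ^ 3 := by gcongr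
      _ = 32 ^ 3 * ((1 + ‖w‖) ^ 7)⁻¹ := by
        have : 1 + ‖w‖ ≠ 0 := by positivity
        field_simp
      _ ≤ _ := by norm_num

theorem integrable_inv_norm_sq_pow_six (hW : Module.finrank ℝ W = 6) :
    Integrable (fun w : W => (16 / (‖w‖ ^ 2 + 4)) ^ 3 * (16 / (‖w‖ ^ 2 + 4)) ^ 3) μ := by
  refine ((integrable_inv_mul_inv_norm_sq_pow μ hW).const_mul 128).mono' ?_
    (Eventually.of_forall fun w => ?_)
  · refine Continuous.aestronglyMeasurable ?_
    have h2 : ∀ w : W, ‖w‖ ^ 2 + 4 ≠ 0 := fun w => by positivity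
    fun_prop (disch := assumption)
  · rw [Real.norm_of_nonneg (by positivity), ← mul_assoc]
    refine mul_le_mul_of_nonneg_right ?_ (by positivity)
    have h3 : 16 / (‖w‖ ^ 2 + 4) ≤ 8 * (1 + ‖w‖)⁻¹ := by
      rw [← div_eq_mul_inv, div_le_div_iff₀ (by positivity) (by positivity)]
      nlinarith [sq_nonneg (‖w‖ - 1)]
    have h4 : 16 / (‖w‖ ^ 2 + 4) ≤ 4 := by
      rw [div_le_iff₀ (by positivity)]
      nlinarith [sq_nonneg ‖w‖]
    have h5 : 0 ≤ 16 / (‖w‖ ^ 2 + 4) := by positivity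
    calc (16 / (‖w‖ ^ 2 + 4)) ^ 3 = (16 / (‖w‖ ^ 2 + 4)) ^ 2 * (16 / (‖w‖ ^ 2 + 4)) := by ring
      _ ≤ 4 ^ 2 * (8 * (1 + ‖w‖)⁻¹) := by gcongr
      _ = 128 * (1 + ‖w‖)⁻¹ := by ring

variable {μ}

/-- Integration by parts against the cutoff functions: the boundary term disappears in the limit. -/
theorem tendsto_integral_cutoff_by_parts (hW : Module.finrank ℝ W = 6) {χ : ℕ → W → ℝ} {K : ℝ}
    (hχ : ∀ n, ContDiff ℝ ∞ (χ n)) (hχc : ∀ n, HasCompactSupport (χ n))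
    (hχd : ∀ n w v, |fderiv ℝ (χ n) w v| ≤ K * (1 + ‖w‖)⁻¹ * ‖v‖)
    (hχ0 : ∀ w v, Tendsto (fun n => fderiv ℝ (χ n) w v) atTop (𝓝 0))
    {β g : W → ℂ} (hβ : ContDiff ℝ 1 β) (hg : ContDiff ℝ 1 g) {M C : ℝ} (hM : ∀ w, ‖β w‖ ≤ M)
    (hC : ∀ w, ‖g w‖ ≤ C * (16 / (‖w‖ ^ 2 + 4)) ^ 3) (v : W) :
    Tendsto (fun n => ∫ w, (χ n w : ℂ) * (fderiv ℝ β w v * g w + β w * fderiv ℝ g w v) ∂μ)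
      atTop (𝓝 0) := by
  have hχ' : ∀ n, ContDiff ℝ 1 fun w => (χ n w : ℂ) := fun n =>
    ofRealCLM.contDiff.comp ((hχ n).of_le one_le_infty)
  have hχc' : ∀ n, HasCompactSupport fun w => (χ n w : ℂ) := fun n =>
    (hχc n).comp_left (g := fun x : ℝ => (x : ℂ)) ofReal_zero
  have hdχ : ∀ n w, fderiv ℝ (fun w => (χ n w : ℂ)) w v = (fderiv ℝ (χ n) w v : ℂ) := fun n w => by
    have h := ofRealCLM.hasFDerivAt.comp w
      ((hχ n).differentiable (by simp) w).hasFDerivAt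
    exact congrArg (fun L : W →L[ℝ] ℂ => L v) h.fderiv
  have hβg : ContDiff ℝ 1 fun w => β w * g w := hβ.mul hg
  have hdβg : ∀ w, fderiv ℝ (fun w => β w * g w) w v = fderiv ℝ β w v * g w + β w * fderiv ℝ g w v :=
    fun w => by
      rw [fderiv_fun_mul (hβ.differentiable (by simp) w) (hg.differentiable (by simp) w)]
      simp only [add_apply, smul_apply, smul_eq_mul]
      ring
  have hparts : ∀ n, ∫ w, (χ n w : ℂ) * (fderiv ℝ β w v * g w + β w * fderiv ℝ g w v) ∂μ =
      -∫ w, (fderiv ℝ (χ n) w v : ℂ) * (β w * g w) ∂μ := fun n => by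
    simp_rw [← hdβg, ← hdχ]
    have c1 : Continuous fun w => fderiv ℝ (fun w => (χ n w : ℂ)) w v :=
      ((hχ' n).continuous_fderiv (by simp)).clm_apply continuous_const
    have c2 : Continuous fun w => fderiv ℝ (fun w => β w * g w) w v :=
      (hβg.continuous_fderiv (by simp)).clm_apply continuous_const
    refine integral_mul_fderiv_eq_neg_fderiv_mul_of_integrable ?_ ?_ ?_
      (fun w _ => (hχ' n).differentiable (by simp) w) fun w _ => hβg.differentiable (by simp) w
    · refine (c1.mul hβg.continuous).integrable_of_hasCompactSupport (HasCompactSupport.mul_right ?_)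
      exact (hχc' n).fderiv_apply ℝ v
    · exact ((hχ' n).continuous.mul c2).integrable_of_hasCompactSupport (hχc' n).mul_right
    · exact ((hχ' n).continuous.mul hβg.continuous).integrable_of_hasCompactSupport
        (hχc' n).mul_right
  simp_rw [hparts]
  rw [← neg_zero]
  refine Tendsto.neg ?_
  rw [← integral_zero W ℂ (μ := μ)]
  refine tendsto_integral_of_dominated_convergence
    (fun w => K * ‖v‖ * (M * C) * ((1 + ‖w‖)⁻¹ * (16 / (‖w‖ ^ 2 + 4)) ^ 3)) (fun n => ?_)
    ((integrable_inv_mul_inv_norm_sq_pow μ hW).const_mul _) (fun n => ?_) ?_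
  · refine Continuous.aestronglyMeasurable ?_
    exact (continuous_ofReal.comp (((hχ n).continuous_fderiv (by simp)).clm_apply
      continuous_const)).mul hβg.continuous
  · refine Eventually.of_forall fun w => ?_
    rw [norm_mul, norm_mul, norm_real]
    calc ‖fderiv ℝ (χ n) w v‖ * (‖β w‖ * ‖g w‖)
        ≤ (K * (1 + ‖w‖)⁻¹ * ‖v‖) * (M * (C * (16 / (‖w‖ ^ 2 + 4)) ^ 3)) := by
          refine mul_le_mul (hχd n w v) ?_ (by positivity) ((abs_nonneg _).trans (hχd n w v))
          exact mul_le_mul (hM w) (hC w) (norm_nonneg _) ((norm_nonneg _).trans (hM w))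
      _ = _ := by ring
  · refine Eventually.of_forall fun w => ?_
    have h := ((continuous_ofReal.tendsto _).comp (hχ0 w v)).mul_const (β w * g w)
    rw [ofReal_zero, zero_mul] at h
    exact h

theorem sum_sign_mul_right {ι : Type*} [Fintype ι] [DecidableEq ι] (τ : Equiv.Perm ι)
    (G : Equiv.Perm ι → ℂ) :
    ∑ s : Equiv.Perm ι, (Equiv.Perm.sign s : ℂ) * G (s * τ) =
      (Equiv.Perm.sign τ : ℂ) * ∑ s : Equiv.Perm ι, (Equiv.Perm.sign s : ℂ) * G s := by
  rw [← Equiv.sum_comp (Equiv.mulRight τ) fun s => (Equiv.Perm.sign s : ℂ) * G s, Finset.mul_sum]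
  refine Finset.sum_congr rfl fun s _ => ?_
  have h : ((Equiv.Perm.sign τ : ℤ) : ℂ) * (Equiv.Perm.sign τ : ℤ) = 1 := by
    rw [← Int.cast_mul, ← Units.val_mul, Int.units_mul_self]
    simp
  simp only [Equiv.coe_mulRight, Equiv.Perm.sign_mul, Units.val_mul, Int.cast_mul]
  linear_combination (-(Equiv.Perm.sign s : ℂ) * G (s * τ)) * h

end Stokes

end

end ComplexForms

/-! ### Stokes' theorem for a∧ā in components. -/

namespace ComplexForms

open Complex Filter Topology Set MeasureTheory

noncomputable section

section Pairing

variable {W : Type*} [NormedAddCommGroup W] [NormedSpace ℝ W]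
  {e : Fin 3 ⊕ Fin 3 → W}
  {A : Fin 3 ⊕ Fin 3 → Fin 3 ⊕ Fin 3 → Fin 3 ⊕ Fin 3 → W → ℂ}
  {B : Fin 3 ⊕ Fin 3 → Fin 3 ⊕ Fin 3 → W → ℂ}

/-- The coefficient of the `6`-form `a ∧ ā`, up to normalization, for a `3`-form `a` with
components `A i j k`. -/
def pairing (A : Fin 3 ⊕ Fin 3 → Fin 3 ⊕ Fin 3 → Fin 3 ⊕ Fin 3 → W → ℂ) (w : W) : ℂ :=
  ∑ s : Equiv.Perm (Fin 3 ⊕ Fin 3), (Equiv.Perm.sign s : ℂ) *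
    (A (s (Sum.inl 0)) (s (Sum.inl 1)) (s (Sum.inl 2)) w *
      starRingEnd ℂ (A (s (Sum.inr 0)) (s (Sum.inr 1)) (s (Sum.inr 2)) w))

/-- The summand of the exact form `d (β ∧ ā)` belonging to the permutation `s`. -/
def pairingTerm (e : Fin 3 ⊕ Fin 3 → W)
    (A : Fin 3 ⊕ Fin 3 → Fin 3 ⊕ Fin 3 → Fin 3 ⊕ Fin 3 → W → ℂ)
    (B : Fin 3 ⊕ Fin 3 → Fin 3 ⊕ Fin 3 → W → ℂ) (s : Equiv.Perm (Fin 3 ⊕ Fin 3)) (w : W) : ℂ :=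
  fderiv ℝ (B (s (Sum.inl 1)) (s (Sum.inl 2))) w (e (s (Sum.inl 0))) *
      starRingEnd ℂ (A (s (Sum.inr 0)) (s (Sum.inr 1)) (s (Sum.inr 2)) w) +
    B (s (Sum.inl 1)) (s (Sum.inl 2)) w *
      fderiv ℝ (fun w => starRingEnd ℂ (A (s (Sum.inr 0)) (s (Sum.inr 1)) (s (Sum.inr 2)) w)) w
        (e (s (Sum.inl 0)))

theorem fderiv_conj {f : W → ℂ} {w : W} (hf : DifferentiableAt ℝ f w) (v : W) :
    fderiv ℝ (fun w => starRingEnd ℂ (f w)) w v = starRingEnd ℂ (fderiv ℝ f w v) := by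
  have h := conjCLE.toContinuousLinearMap.hasFDerivAt.comp w hf.hasFDerivAt
  exact congrArg (fun L : W →L[ℝ] ℂ => L v) h.fderiv

/-- This is a∧ā = d(β∧ā). After antisymmetrization the three terms of a = dβ agree, which gives the
factor 3. The four terms of the conjugate of da = 0 also agree, so the part of d(β∧ā) that
differentiates ā vanishes. The permutations τ and ρ carry these terms into each other. -/
theorem pairing_eq_sum_pairingTerm (hA : ∀ i j k, ContDiff ℝ 1 (A i j k))
    (hAB : ∀ i j k w, A i j k w = fderiv ℝ (B j k) w (e i) - fderiv ℝ (B i k) w (e j) +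
      fderiv ℝ (B i j) w (e k))
    (hd : ∀ i j k l w, fderiv ℝ (A j k l) w (e i) - fderiv ℝ (A i k l) w (e j) +
      fderiv ℝ (A i j l) w (e k) - fderiv ℝ (A i j k) w (e l) = 0) (w : W) :
    pairing A w = 3 * ∑ s : Equiv.Perm (Fin 3 ⊕ Fin 3),
      (Equiv.Perm.sign s : ℂ) * pairingTerm e A B s w := by
  set G : Equiv.Perm (Fin 3 ⊕ Fin 3) → ℂ := fun s =>
    fderiv ℝ (B (s (Sum.inl 1)) (s (Sum.inl 2))) w (e (s (Sum.inl 0))) *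
      starRingEnd ℂ (A (s (Sum.inr 0)) (s (Sum.inr 1)) (s (Sum.inr 2)) w) with hG
  set H : Equiv.Perm (Fin 3 ⊕ Fin 3) → ℂ := fun s =>
    B (s (Sum.inl 1)) (s (Sum.inl 2)) w * starRingEnd ℂ
      (fderiv ℝ (A (s (Sum.inr 0)) (s (Sum.inr 1)) (s (Sum.inr 2))) w (e (s (Sum.inl 0)))) with hH
  let τ₁ : Equiv.Perm (Fin 3 ⊕ Fin 3) := Equiv.swap (Sum.inl 0) (Sum.inl 1)
  let τ₂ : Equiv.Perm (Fin 3 ⊕ Fin 3) :=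
    Equiv.swap (Sum.inl 0) (Sum.inl 1) * Equiv.swap (Sum.inl 0) (Sum.inl 2)
  let ρ₁ : Equiv.Perm (Fin 3 ⊕ Fin 3) := Equiv.swap (Sum.inl 0) (Sum.inr 0)
  let ρ₂ : Equiv.Perm (Fin 3 ⊕ Fin 3) :=
    Equiv.swap (Sum.inl 0) (Sum.inr 0) * Equiv.swap (Sum.inl 0) (Sum.inr 1)
  let ρ₃ : Equiv.Perm (Fin 3 ⊕ Fin 3) := Equiv.swap (Sum.inl 0) (Sum.inr 0) *
    (Equiv.swap (Sum.inl 0) (Sum.inr 1) * Equiv.swap (Sum.inl 0) (Sum.inr 2))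
  have s1 := sum_sign_mul_right τ₁ G
  have s2 := sum_sign_mul_right τ₂ G
  have r1 := sum_sign_mul_right ρ₁ H
  have r2 := sum_sign_mul_right ρ₂ H
  have r3 := sum_sign_mul_right ρ₃ H
  have e1 : Equiv.Perm.sign τ₁ = -1 := by decide
  have e2 : Equiv.Perm.sign τ₂ = 1 := by decide
  have f1 : Equiv.Perm.sign ρ₁ = -1 := by decide
  have f2 : Equiv.Perm.sign ρ₂ = 1 := by decide
  have f3 : Equiv.Perm.sign ρ₃ = -1 := by decide
  rw [e1] at s1
  rw [e2] at s2
  rw [f1] at r1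
  rw [f2] at r2
  rw [f3] at r3
  simp only [Units.val_neg, Units.val_one, Int.cast_neg, Int.cast_one, neg_mul, one_mul] at s1 s2 r1 r2 r3
  have hsum1 : pairing A w = ∑ s, (Equiv.Perm.sign s : ℂ) * G s -
      ∑ s, (Equiv.Perm.sign s : ℂ) * G (s * τ₁) + ∑ s, (Equiv.Perm.sign s : ℂ) * G (s * τ₂) := by
    rw [← Finset.sum_sub_distrib, ← Finset.sum_add_distrib, pairing]
    refine Finset.sum_congr rfl fun s _ => ?_
    rw [hAB (s (Sum.inl 0))]
    have a1 : τ₁ (Sum.inl 0) = Sum.inl 1 := by decide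
    have a2 : τ₁ (Sum.inl 1) = Sum.inl 0 := by decide
    have a3 : τ₁ (Sum.inl 2) = Sum.inl 2 := by decide
    have a4 : ∀ j, τ₁ (Sum.inr j) = Sum.inr j := by decide
    have b1 : τ₂ (Sum.inl 0) = Sum.inl 2 := by decide
    have b2 : τ₂ (Sum.inl 1) = Sum.inl 0 := by decide
    have b3 : τ₂ (Sum.inl 2) = Sum.inl 1 := by decide
    have b4 : ∀ j, τ₂ (Sum.inr j) = Sum.inr j := by decide
    simp only [hG, Equiv.Perm.mul_apply, a1, a2, a3, a4, b1, b2, b3, b4]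
    ring
  have hsum2 : ∑ s, (Equiv.Perm.sign s : ℂ) * H s - ∑ s, (Equiv.Perm.sign s : ℂ) * H (s * ρ₁) +
      ∑ s, (Equiv.Perm.sign s : ℂ) * H (s * ρ₂) - ∑ s, (Equiv.Perm.sign s : ℂ) * H (s * ρ₃) = 0 := by
    rw [← Finset.sum_sub_distrib, ← Finset.sum_add_distrib, ← Finset.sum_sub_distrib]
    refine Finset.sum_eq_zero fun s _ => ?_
    have a1 : ρ₁ (Sum.inl 0) = Sum.inr 0 := by decide
    have a2 : ρ₁ (Sum.inl 1) = Sum.inl 1 := by decide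
    have a3 : ρ₁ (Sum.inl 2) = Sum.inl 2 := by decide
    have a4 : ρ₁ (Sum.inr 0) = Sum.inl 0 := by decide
    have a5 : ρ₁ (Sum.inr 1) = Sum.inr 1 := by decide
    have a6 : ρ₁ (Sum.inr 2) = Sum.inr 2 := by decide
    have b1 : ρ₂ (Sum.inl 0) = Sum.inr 1 := by decide
    have b2 : ρ₂ (Sum.inl 1) = Sum.inl 1 := by decide
    have b3 : ρ₂ (Sum.inl 2) = Sum.inl 2 := by decide
    have b4 : ρ₂ (Sum.inr 0) = Sum.inl 0 := by decide
    have b5 : ρ₂ (Sum.inr 1) = Sum.inr 0 := by decide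
    have b6 : ρ₂ (Sum.inr 2) = Sum.inr 2 := by decide
    have c1 : ρ₃ (Sum.inl 0) = Sum.inr 2 := by decide
    have c2 : ρ₃ (Sum.inl 1) = Sum.inl 1 := by decide
    have c3 : ρ₃ (Sum.inl 2) = Sum.inl 2 := by decide
    have c4 : ρ₃ (Sum.inr 0) = Sum.inl 0 := by decide
    have c5 : ρ₃ (Sum.inr 1) = Sum.inr 0 := by decide
    have c6 : ρ₃ (Sum.inr 2) = Sum.inr 1 := by decide
    simp only [hH, Equiv.Perm.mul_apply, a1, a2, a3, a4, a5, a6, b1, b2, b3, b4, b5, b6, c1, c2, c3,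
      c4, c5, c6]
    have h := congrArg (starRingEnd ℂ) (hd (s (Sum.inl 0)) (s (Sum.inr 0)) (s (Sum.inr 1))
      (s (Sum.inr 2)) w)
    simp only [map_sub, map_add, map_zero] at h
    linear_combination ((Equiv.Perm.sign s : ℂ) * B (s (Sum.inl 1)) (s (Sum.inl 2)) w) * h
  have hGH : ∑ s : Equiv.Perm (Fin 3 ⊕ Fin 3), (Equiv.Perm.sign s : ℂ) * pairingTerm e A B s w =
      ∑ s, (Equiv.Perm.sign s : ℂ) * G s + ∑ s, (Equiv.Perm.sign s : ℂ) * H s := by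
    rw [← Finset.sum_add_distrib]
    refine Finset.sum_congr rfl fun s _ => ?_
    rw [pairingTerm, fderiv_conj ((hA _ _ _).differentiable (by simp) w), mul_add]
  rw [s1, s2] at hsum1
  rw [r1, r2, r3] at hsum2
  rw [hGH, hsum1]
  linear_combination (-3 / 4 : ℂ) * hsum2

variable [FiniteDimensional ℝ W] [MeasurableSpace W] [BorelSpace W] {μ : Measure W}
  [μ.IsAddHaarMeasure]

omit [NormedSpace ℝ W] [FiniteDimensional ℝ W] [MeasurableSpace W] [BorelSpace W] in
theorem continuous_pairing (hA : ∀ i j k, Continuous (A i j k)) : Continuous (pairing A) :=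
  continuous_finsetSum _ fun _ _ => continuous_const.mul
    ((hA _ _ _).mul (continuous_conj.comp (hA _ _ _)))

theorem integrable_pairing (hW : Module.finrank ℝ W = 6) (hA : ∀ i j k, Continuous (A i j k))
    {C : ℝ} (hC : ∀ i j k w, ‖A i j k w‖ ≤ C * (16 / (‖w‖ ^ 2 + 4)) ^ 3) :
    Integrable (pairing A) μ := by
  refine integrable_finsetSum _ fun s _ => Integrable.const_mul ?_ _
  refine ((integrable_inv_norm_sq_pow_six μ hW).const_mul (C * C)).mono'
    ((hA _ _ _).mul (continuous_conj.comp (hA _ _ _))).aestronglyMeasurable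
    (Eventually.of_forall fun w => ?_)
  rw [norm_mul, RCLike.norm_conj]
  calc _ ≤ (C * (16 / (‖w‖ ^ 2 + 4)) ^ 3) * (C * (16 / (‖w‖ ^ 2 + 4)) ^ 3) :=
        mul_le_mul (hC _ _ _ w) (hC _ _ _ w) (norm_nonneg _) ((norm_nonneg _).trans (hC (Sum.inl 0) (Sum.inl 0) (Sum.inl 0) w))
    _ = _ := by ring

/-- Stokes' theorem for `a ∧ ā = d (β ∧ ā)` on a six-dimensional space, where `a = dβ` is closed
and decays like the pullback of a form on the sphere by stereographic projection, and `β` is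
bounded. -/
theorem integral_pairing_eq_zero (hW : Module.finrank ℝ W = 6)
    (hA : ∀ i j k, ContDiff ℝ 1 (A i j k)) (hB : ∀ i j, ContDiff ℝ 1 (B i j))
    (hAB : ∀ i j k w, A i j k w = fderiv ℝ (B j k) w (e i) - fderiv ℝ (B i k) w (e j) +
      fderiv ℝ (B i j) w (e k))
    (hd : ∀ i j k l w, fderiv ℝ (A j k l) w (e i) - fderiv ℝ (A i k l) w (e j) +
      fderiv ℝ (A i j l) w (e k) - fderiv ℝ (A i j k) w (e l) = 0)
    {C M : ℝ} (hC : ∀ i j k w, ‖A i j k w‖ ≤ C * (16 / (‖w‖ ^ 2 + 4)) ^ 3)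
    (hM : ∀ i j w, ‖B i j w‖ ≤ M) : ∫ w, pairing A w ∂μ = 0 := by
  obtain ⟨χ, K, hχ, hχc, hχK, hχd, hχ1, hχ0⟩ := exists_cutoff_sequence (W := W)
  have hAc : ∀ i j k, Continuous (A i j k) := fun i j k => (hA i j k).continuous
  have hA' : ∀ i j k, ContDiff ℝ 1 fun w => starRingEnd ℂ (A i j k w) := fun i j k =>
    conjCLE.contDiff.comp (hA i j k)
  have hint := integrable_pairing (μ := μ) hW hAc hC
  have lim1 : Tendsto (fun n => ∫ w, (χ n w : ℂ) * pairing A w ∂μ) atTop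
      (𝓝 (∫ w, pairing A w ∂μ)) := by
    refine tendsto_integral_of_dominated_convergence (fun w => K * ‖pairing A w‖) (fun n => ?_)
      (hint.norm.const_mul K) (fun n => Eventually.of_forall fun w => ?_)
      (Eventually.of_forall fun w => ?_)
    · exact ((continuous_ofReal.comp (hχ n).continuous).mul
        (continuous_pairing hAc)).aestronglyMeasurable
    · rw [norm_mul, norm_real]
      exact mul_le_mul_of_nonneg_right (hχK n w) (norm_nonneg _)
    · have h := ((continuous_ofReal.tendsto _).comp (hχ1 w)).mul_const (pairing A w)
      rw [ofReal_one, one_mul] at h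
      exact h
  have hterm : ∀ s : Equiv.Perm (Fin 3 ⊕ Fin 3), Continuous (pairingTerm e A B s) := fun s =>
    ((((hB _ _).continuous_fderiv (by simp)).clm_apply continuous_const).mul
      (hA' _ _ _).continuous).add ((hB _ _).continuous.mul
        (((hA' _ _ _).continuous_fderiv (by simp)).clm_apply continuous_const))
  have heq : ∀ n, ∫ w, (χ n w : ℂ) * pairing A w ∂μ = 3 * ∑ s : Equiv.Perm (Fin 3 ⊕ Fin 3),
      (Equiv.Perm.sign s : ℂ) * ∫ w, (χ n w : ℂ) * pairingTerm e A B s w ∂μ := fun n => by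
    simp_rw [← integral_const_mul]
    rw [← integral_finsetSum, ← integral_const_mul]
    · refine integral_congr_ae (Eventually.of_forall fun w => ?_)
      dsimp only
      rw [pairing_eq_sum_pairingTerm hA hAB hd, Finset.mul_sum, Finset.mul_sum, Finset.mul_sum]
      refine Finset.sum_congr rfl fun s _ => ?_
      ring
    · intro s _
      refine Integrable.const_mul ?_ _
      exact ((continuous_ofReal.comp (hχ n).continuous).mul
        (hterm s)).integrable_of_hasCompactSupport
          ((hχc n).comp_left (g := fun x : ℝ => (x : ℂ)) ofReal_zero).mul_right
  have lim2 : Tendsto (fun n => ∫ w, (χ n w : ℂ) * pairing A w ∂μ) atTop (𝓝 0) := by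
    simp_rw [heq]
    have h : Tendsto (fun n => ∑ s : Equiv.Perm (Fin 3 ⊕ Fin 3),
        (Equiv.Perm.sign s : ℂ) * ∫ w, (χ n w : ℂ) * pairingTerm e A B s w ∂μ) atTop
        (𝓝 (∑ s : Equiv.Perm (Fin 3 ⊕ Fin 3), (Equiv.Perm.sign s : ℂ) * 0)) :=
      tendsto_finsetSum _ fun s _ => Tendsto.const_mul _
        (tendsto_integral_cutoff_by_parts hW hχ hχc hχd hχ0 (hB _ _) (hA' _ _ _) (hM _ _)
          (fun w => (RCLike.norm_conj _).trans_le (hC _ _ _ w)) _)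
    simpa using h.const_mul 3
  exact tendsto_nhds_unique lim1 lim2

/-- A continuous nonnegative function with integral zero vanishes identically, not just almost
everywhere. -/
theorem re_mul_pairing_eq_zero (hW : Module.finrank ℝ W = 6)
    (hA : ∀ i j k, Continuous (A i j k))
    {C : ℝ} (hC : ∀ i j k w, ‖A i j k w‖ ≤ C * (16 / (‖w‖ ^ 2 + 4)) ^ 3)
    (h0 : ∫ w, pairing A w ∂μ = 0) (κ : ℂ) (hκ : ∀ w, 0 ≤ (κ * pairing A w).re) (w : W) :
    (κ * pairing A w).re = 0 := by
  have hint := (integrable_pairing (μ := μ) hW hA hC).const_mul κ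
  have h1 : ∫ w, (κ * pairing A w).re ∂μ = 0 := by
    have h2 := integral_re hint
    rw [integral_const_mul, h0, mul_zero] at h2
    exact h2
  rw [integral_eq_zero_iff_of_nonneg hκ hint.re] at h1
  have hc : Continuous fun w => (κ * pairing A w).re :=
    continuous_re.comp (continuous_const.mul (continuous_pairing hA))
  exact congrFun ((hc.ae_eq_iff_eq μ continuous_const).1 h1) w

end Pairing

end

end ComplexForms

/-! ### The Poincaré lemma with a bounded primitive. -/

namespace ComplexForms

open Complex Filter Topology Set MeasureTheory

noncomputable section

section Poincare

variable {W : Type*} [NormedAddCommGroup W] [NormedSpace ℝ W] {a : W → W [⋀^Fin 3]→L[ℝ] ℂ}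

theorem fderiv_apply_of_extDeriv_eq_zero {w : W} (h : extDeriv a w = 0) (u x y z : W) :
    fderiv ℝ a w u ![x, y, z] - fderiv ℝ a w x ![u, y, z] + fderiv ℝ a w y ![u, x, z] -
      fderiv ℝ a w z ![u, x, y] = 0 := by
  have h1 := congrArg (fun β : W [⋀^Fin 4]→L[ℝ] ℂ => β ![u, x, y, z]) h
  have h2 : extDeriv a w ![u, x, y, z] = 0 := h1
  rw [extDeriv, ContinuousAlternatingMap.alternatizeUncurryFin_apply, Fin.sum_univ_four] at h2
  have r0 : Fin.removeNth 0 ![u, x, y, z] = ![x, y, z] := by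
    ext i; fin_cases i <;> rfl
  have r1 : Fin.removeNth 1 ![u, x, y, z] = ![u, y, z] := by
    ext i; fin_cases i <;> rfl
  have r2 : Fin.removeNth 2 ![u, x, y, z] = ![u, x, z] := by
    ext i; fin_cases i <;> rfl
  have r3 : Fin.removeNth 3 ![u, x, y, z] = ![u, x, y] := by
    ext i; fin_cases i <;> rfl
  rw [r0, r1, r2, r3] at h2
  have m3 : ((-1 : ℤ)) ^ ((3 : Fin 4) : ℕ) = -1 := by norm_num [show ((3 : Fin 4) : ℕ) = 3 from rfl]
  have m2 : ((-1 : ℤ)) ^ ((2 : Fin 4) : ℕ) = 1 := by norm_num [show ((2 : Fin 4) : ℕ) = 2 from rfl]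
  rw [m3, m2] at h2
  simp at h2
  linear_combination h2

theorem fderiv_apply_const (ha : Differentiable ℝ a) (v : Fin 3 → W) (w x : W) :
    fderiv ℝ (fun w => a w v) w x = fderiv ℝ a w x v := by
  rw [fderiv_continuousAlternatingMap_apply_const (ha w)]
  rfl

/-- The components of the primitive of the closed `3`-form `a` given by the Poincaré lemma. -/
def primitive (a : W → W [⋀^Fin 3]→L[ℝ] ℂ) (y z u : W) : ℂ :=
  ∫ t in Icc (0 : ℝ) 1, (t : ℂ) ^ 2 * a (t • u) ![u, y, z]

theorem hasFDerivAt_radial (ha : Differentiable ℝ a) (y z u x : W) (t : ℝ) :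
    fderiv ℝ (fun u => (t : ℂ) ^ 2 * a (t • u) ![u, y, z]) u x =
      (t : ℂ) ^ 2 * (t * fderiv ℝ a (t • u) x ![u, y, z] + a (t • u) ![x, y, z]) := by
  have h1 : HasFDerivAt (fun u : W => a (t • u)) (t • fderiv ℝ a (t • u)) u := by
    have := (ha (t • u)).hasFDerivAt.comp u ((hasFDerivAt_id u).const_smul t)
    refine this.congr_fderiv ?_
    ext v
    simp
  have h2 : ∀ i : Fin 3, HasFDerivAt (fun u : W => (![u, y, z] : Fin 3 → W) i)
      ((![ContinuousLinearMap.id ℝ W, 0, 0] : Fin 3 → W →L[ℝ] W) i) u := by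
    intro i
    fin_cases i
    · exact hasFDerivAt_id u
    · exact hasFDerivAt_const y u
    · exact hasFDerivAt_const z u
  have h3 := ((h1.continuousAlternatingMap_apply h2).const_mul ((t : ℂ) ^ 2)).fderiv
  have h4 := congrArg (fun L : W →L[ℝ] ℂ => L x) h3
  refine Eq.trans h4 ?_
  have u0 : Function.update ![u, y, z] 0 x = ![x, y, z] := by
    ext i; fin_cases i <;> rfl
  simp only [Fin.sum_univ_three, smul_apply, add_apply]
  simp [u0, mul_add]

variable [FiniteDimensional ℝ W]

theorem contDiff_radial (ha : ContDiff ℝ ∞ a) (y z : W) :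
    ContDiff ℝ ∞ fun q : W × ℝ => (q.2 : ℂ) ^ 2 * a (q.2 • q.1) ![q.1, y, z] := by
  refine ((ofRealCLM.contDiff.comp contDiff_snd).pow 2).mul (contDiff_iff_contDiffAt.2 fun q => ?_)
  refine ContDiffAt.form_apply (f := fun q : W × ℝ => a (q.2 • q.1))
    (w := fun i q => (![q.1, y, z] : Fin 3 → W) i) ?_ fun i => ?_
  · exact (ha.comp (contDiff_snd.smul contDiff_fst)).contDiffAt
  · fin_cases i
    · exact contDiff_fst.contDiffAt
    · exact contDiffAt_const
    · exact contDiffAt_const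

theorem contDiff_primitive (ha : ContDiff ℝ ∞ a) (y z : W) : ContDiff ℝ ∞ (primitive a y z) :=
  contDiff_setIntegral (F := fun u (t : ℝ) => (t : ℂ) ^ 2 * a (t • u) ![u, y, z]) isCompact_Icc
    (contDiff_radial ha y z)

theorem fderiv_primitive (ha : ContDiff ℝ ∞ a) (y z u x : W) :
    fderiv ℝ (primitive a y z) u x = ∫ t in Icc (0 : ℝ) 1,
      (t : ℂ) ^ 2 * (t * fderiv ℝ a (t • u) x ![u, y, z] + a (t • u) ![x, y, z]) := by
  have h := map_fderiv_setIntegral (ν := (volume : Measure ℝ)) (isCompact_Icc (a := (0 : ℝ)) (b := 1))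
    (f := fun u (t : ℝ) => (t : ℂ) ^ 2 * a (t • u) ![u, y, z])
    ((contDiff_radial ha y z).of_le one_le_infty) (ContinuousLinearMap.apply ℝ ℂ x) u
  refine h.trans (integral_congr_ae (Eventually.of_forall fun t => ?_))
  exact hasFDerivAt_radial (ha.differentiable (by simp)) y z u x t

/-- The Poincaré lemma for `3`-forms, in components. -/
theorem apply_eq_fderiv_primitive (ha : ContDiff ℝ ∞ a) (hd : ∀ w, extDeriv a w = 0)
    (u x y z : W) : a u ![x, y, z] = fderiv ℝ (primitive a y z) u x -
      fderiv ℝ (primitive a x z) u y + fderiv ℝ (primitive a x y) u z := by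
  have had := ha.differentiable (by simp)
  have hcont : ∀ x y z : W, Continuous fun t : ℝ =>
      (t : ℂ) ^ 2 * (t * fderiv ℝ a (t • u) x ![u, y, z] + a (t • u) ![x, y, z]) := by
    intro x y z
    have h1 : Continuous fun t : ℝ => a (t • u) ![x, y, z] :=
      (ContinuousAlternatingMap.apply ℝ W ℂ ![x, y, z]).continuous.comp
        (ha.continuous.comp (continuous_id.smul continuous_const))
    have h2 : Continuous fun t : ℝ => fderiv ℝ a (t • u) x ![u, y, z] :=
      (ContinuousAlternatingMap.apply ℝ W ℂ ![u, y, z]).continuous.comp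
        (((ha.continuous_fderiv (by simp)).comp (continuous_id.smul continuous_const)).clm_apply
          continuous_const)
    exact (continuous_ofReal.pow 2).mul ((continuous_ofReal.mul h2).add h1)
  have hint : ∀ x y z : W, IntegrableOn (fun t : ℝ =>
      (t : ℂ) ^ 2 * (t * fderiv ℝ a (t • u) x ![u, y, z] + a (t • u) ![x, y, z])) (Icc 0 1) :=
    fun x y z => (hcont x y z).continuousOn.integrableOn_compact isCompact_Icc
  rw [fderiv_primitive ha, fderiv_primitive ha, fderiv_primitive ha,
    ← integral_sub (hint _ _ _) (hint _ _ _),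
    ← integral_add (by exact (hint _ _ _).sub (hint _ _ _)) (hint _ _ _),
    integral_Icc_eq_integral_Ioc, ← intervalIntegral.integral_of_le zero_le_one]
  -- Closedness combines the three derivative terms into the radial derivative of a, and
  -- antisymmetry turns the other three into 3t² a. The integrand is then the t-derivative of t³
  -- a(tu), whose boundary value at 0 vanishes.
  have hderiv : ∀ t ∈ uIcc (0 : ℝ) 1, HasDerivAt (fun t : ℝ => (t : ℂ) ^ 3 * a (t • u) ![x, y, z])
      ((t : ℂ) ^ 2 * (t * fderiv ℝ a (t • u) x ![u, y, z] + a (t • u) ![x, y, z]) -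
        (t : ℂ) ^ 2 * (t * fderiv ℝ a (t • u) y ![u, x, z] + a (t • u) ![y, x, z]) +
        (t : ℂ) ^ 2 * (t * fderiv ℝ a (t • u) z ![u, x, y] + a (t • u) ![z, x, y])) t := by
    intro t _
    have h1 : HasDerivAt (fun t : ℝ => (t : ℂ) ^ 3) (3 * (t : ℂ) ^ 2) t := by
      refine ((hasDerivAt_id t).ofReal_comp.pow 3).congr_deriv ?_
      simp
    have h2 : HasDerivAt (fun t : ℝ => t • u) u t := by
      simpa using (hasDerivAt_id t).smul_const u
    have h3 : HasDerivAt (fun t : ℝ => a (t • u) ![x, y, z])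
        (fderiv ℝ a (t • u) u ![x, y, z]) t :=
      (ContinuousAlternatingMap.apply ℝ W ℂ ![x, y, z]).hasFDerivAt.comp_hasDerivAt t
        ((had (t • u)).hasFDerivAt.comp_hasDerivAt t h2)
    refine (h1.mul h3).congr_deriv ?_
    have h4 := fderiv_apply_of_extDeriv_eq_zero (hd (t • u)) u x y z
    have h5 : a (t • u) ![y, x, z] = -a (t • u) ![x, y, z] := by
      have h7 : a (t • u) (![x, y, z] ∘ ⇑(Equiv.swap 0 1)) = -a (t • u) ![x, y, z] :=
        (a (t • u)).map_swap ![x, y, z] (by decide)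
      rw [← h7]
      congr 1
      ext i; fin_cases i <;> rfl
    have h6 : a (t • u) ![z, x, y] = a (t • u) ![x, y, z] := by
      have h7 : a (t • u) (![x, y, z] ∘ ⇑(Equiv.swap 1 2)) = -a (t • u) ![x, y, z] :=
        (a (t • u)).map_swap ![x, y, z] (by decide)
      have h8 : a (t • u) (![x, z, y] ∘ ⇑(Equiv.swap 0 1)) = -a (t • u) ![x, z, y] :=
        (a (t • u)).map_swap ![x, z, y] (by decide)
      have h9 : ![x, y, z] ∘ ⇑(Equiv.swap 1 2) = ![x, z, y] := by
        ext i; fin_cases i <;> rfl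
      have h10 : ![x, z, y] ∘ ⇑(Equiv.swap 0 1) = ![z, x, y] := by
        ext i; fin_cases i <;> rfl
      rw [h9] at h7
      rw [h10, h7, neg_neg] at h8
      exact h8
    rw [h5, h6]
    linear_combination ((t : ℂ) ^ 3) * h4
  have hcont' := ((hcont x y z).sub (hcont y x z)).add (hcont z x y)
  have h := intervalIntegral.integral_eq_sub_of_hasDerivAt hderiv (hcont'.intervalIntegrable _ _)
  refine Eq.symm (Eq.trans h ?_)
  simp

omit [FiniteDimensional ℝ W] in
-- With s = t‖u‖, the one linear factor ‖u‖ in the integrand is absorbed by the decay: s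
-- (16/(s²+4))³ ≤ 64. Boundedness of the primitive is what the cutoff argument needs.
theorem norm_primitive_le {C : ℝ} (hC : ∀ w v, ‖a w v‖ ≤ C * (16 / (‖w‖ ^ 2 + 4)) ^ 3 * ∏ i, ‖v i‖)
    (hC0 : 0 ≤ C) (y z u : W) : ‖primitive a y z u‖ ≤ 64 * C * (‖y‖ * ‖z‖) := by
  have h := norm_setIntegral_le_of_norm_le_const (μ := (volume : Measure ℝ)) (s := Icc (0 : ℝ) 1)
    (f := fun t : ℝ => (t : ℂ) ^ 2 * a (t • u) ![u, y, z])
    (C := 64 * C * (‖y‖ * ‖z‖)) (by simp) fun t ht => ?_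
  · refine h.trans_eq ?_
    simp
  · have h1 := hC (t • u) ![u, y, z]
    simp only [Fin.prod_univ_three, Matrix.cons_val] at h1
    rw [norm_mul, norm_pow, norm_real, Real.norm_of_nonneg ht.1]
    rw [norm_smul, Real.norm_of_nonneg ht.1] at h1
    set s := t * ‖u‖ with hs
    have hs0 : 0 ≤ s := mul_nonneg ht.1 (norm_nonneg _)
    have h2 : 16 / (s ^ 2 + 4) ≤ 4 := by
      rw [div_le_iff₀ (by positivity)]
      nlinarith [sq_nonneg s]
    have h3 : s * (16 / (s ^ 2 + 4)) ≤ 4 := by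
      rw [← mul_div_assoc, div_le_iff₀ (by positivity)]
      nlinarith [sq_nonneg (s - 2)]
    have h4 : 0 ≤ 16 / (s ^ 2 + 4) := by positivity
    have h5 : s * (16 / (s ^ 2 + 4)) ^ 3 ≤ 64 := by
      calc s * (16 / (s ^ 2 + 4)) ^ 3 = (s * (16 / (s ^ 2 + 4))) * (16 / (s ^ 2 + 4)) ^ 2 := by ring
        _ ≤ 4 * 4 ^ 2 := by gcongr
        _ = 64 := by norm_num
    calc t ^ 2 * ‖a (t • u) ![u, y, z]‖
        ≤ t ^ 2 * (C * (16 / (s ^ 2 + 4)) ^ 3 * (‖u‖ * ‖y‖ * ‖z‖)) := by gcongr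
      _ = t * (s * (16 / (s ^ 2 + 4)) ^ 3) * C * (‖y‖ * ‖z‖) := by rw [hs]; ring
      _ ≤ 1 * 64 * C * (‖y‖ * ‖z‖) := by
        have : 0 ≤ s * (16 / (s ^ 2 + 4)) ^ 3 := by positivity
        have ht1 := ht.2
        gcongr
      _ = 64 * C * (‖y‖ * ‖z‖) := by ring

/-- If a closed `3`-form `a` on a six-dimensional space decays like the pullback of a form on the
sphere by stereographic projection, and `a ∧ ā` has constant sign, then `a ∧ ā` vanishes. -/
theorem re_mul_pairing_eq_zero_of_closed (hW : Module.finrank ℝ W = 6) (ha : ContDiff ℝ ∞ a)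
    (hd : ∀ w, extDeriv a w = 0) {C : ℝ}
    (hC : ∀ w v, ‖a w v‖ ≤ C * (16 / (‖w‖ ^ 2 + 4)) ^ 3 * ∏ i, ‖v i‖) (hC0 : 0 ≤ C)
    (e : Fin 3 ⊕ Fin 3 → W) (κ : ℂ)
    (hκ : ∀ w, 0 ≤ (κ * pairing (fun i j k w => a w ![e i, e j, e k]) w).re) (w : W) :
    (κ * pairing (fun i j k w => a w ![e i, e j, e k]) w).re = 0 := by
  borelize W
  obtain ⟨N, hN⟩ : ∃ N, ∀ i, ‖e i‖ ≤ N := by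
    obtain ⟨N, hN⟩ := (Set.finite_range fun i => ‖e i‖).bddAbove
    exact ⟨N, fun i => hN ⟨i, rfl⟩⟩
  have hN0 : 0 ≤ N := (norm_nonneg _).trans (hN (Sum.inl 0))
  have had := ha.differentiable (by simp)
  have hA : ∀ i j k, ContDiff ℝ 1 fun w => a w ![e i, e j, e k] := fun i j k =>
    (ContinuousAlternatingMap.apply ℝ W ℂ ![e i, e j, e k]).contDiff.comp (ha.of_le one_le_infty)
  have hCA : ∀ i j k w, ‖a w ![e i, e j, e k]‖ ≤ C * N ^ 3 * (16 / (‖w‖ ^ 2 + 4)) ^ 3 := by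
    intro i j k w
    refine (hC _ _).trans ?_
    simp only [Fin.prod_univ_three, Matrix.cons_val]
    have := hN i
    have := hN j
    have := hN k
    calc C * (16 / (‖w‖ ^ 2 + 4)) ^ 3 * (‖e i‖ * ‖e j‖ * ‖e k‖)
        ≤ C * (16 / (‖w‖ ^ 2 + 4)) ^ 3 * (N * N * N) := by gcongr
      _ = _ := by ring
  refine re_mul_pairing_eq_zero (μ := Measure.addHaar) hW (fun i j k => (hA i j k).continuous) hCA
    ?_ κ hκ w
  refine integral_pairing_eq_zero (e := e) (B := fun i j => primitive a (e i) (e j)) hW hA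
    (fun i j => (contDiff_primitive ha _ _).of_le one_le_infty)
    (fun i j k w => apply_eq_fderiv_primitive ha hd w _ _ _) (fun i j k l w => ?_) hCA
    (M := 64 * C * (N * N)) fun i j w => ?_
  · simp_rw [fderiv_apply_const had]
    exact fderiv_apply_of_extDeriv_eq_zero (hd w) _ _ _ _
  · refine (norm_primitive_le hC hC0 _ _ _).trans ?_
    have := hN i
    have := hN j
    gcongr

end Poincare

end

end ComplexForms

/-! ### Pullback of forms to real vector spaces. -/

namespace ComplexForms

open Complex Filter Topology Set MeasureTheory

noncomputable section

section Pullback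

theorem two_le_infty : (2 : WithTop ℕ∞) ≤ ∞ := by
  have h : ((2 : ℕ∞) : WithTop ℕ∞) ≤ ∞ := WithTop.coe_le_coe.2 le_top
  exact h

variable {E : Type*} [NormedAddCommGroup E] [NormedSpace ℂ E]
  {X : Type*} [TopologicalSpace X] [ChartedSpace E X]
  {V : Type*} [NormedAddCommGroup V] [NormedSpace ℝ V] {k : ℕ}

/-- The pullback of a form on a complex manifold by a map defined on a real vector space. -/
def formPullback (Θ : V → X) (α : CForm E X k) (u : V) : V [⋀^Fin k]→L[ℝ] ℂ :=
  (α.valueAt (Θ u)).compContinuousLinearMap (fderiv ℝ (chartAt E (Θ u) ∘ Θ) u)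

variable [IsManifold 𝓘(ℂ, E) ω X] {Θ : V → X} {u : V}

theorem contDiffAt_chart_comp {e : OpenPartialHomeomorph X E} (he : e ∈ atlas E X)
    (hΘ : ContMDiffAt 𝓘(ℝ, V) 𝓘(ℝ, E) ∞ Θ u) (hu : Θ u ∈ e.source) :
    ContDiffAt ℝ ∞ (e ∘ Θ) u := by
  have := isManifold_real (E := E) (X := X)
  have h := (contMDiffAt_of_mem_maximalAtlas (I := 𝓘(ℝ, E)) (n := ∞)
    (IsManifold.subset_maximalAtlas he) hu).comp u hΘ
  exact contMDiffAt_iff_contDiffAt.1 h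

theorem fderiv_chart_comp {e e' : OpenPartialHomeomorph X E} (he : e ∈ atlas E X)
    (he' : e' ∈ atlas E X) (hΘ : ContMDiffAt 𝓘(ℝ, V) 𝓘(ℝ, E) ∞ Θ u) (hu : Θ u ∈ e.source)
    (hu' : Θ u ∈ e'.source) :
    fderiv ℝ (e' ∘ Θ) u =
      ((fderiv ℂ (e' ∘ e.symm) (e (Θ u))).restrictScalars ℝ).comp (fderiv ℝ (e ∘ Θ) u) := by
  have h1 : DifferentiableAt ℝ (e ∘ Θ) u :=
    (contDiffAt_chart_comp he hΘ hu).differentiableAt (by simp)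
  have h2 : DifferentiableAt ℂ (e' ∘ e.symm) (e (Θ u)) :=
    (contDiffAt_transition he he' (e.map_source hu) (by rwa [e.left_inv hu])).differentiableAt
      (by simp)
  have h3 := (h2.hasFDerivAt.restrictScalars ℝ).comp u (f := e ∘ Θ) h1.hasFDerivAt
  rw [← h3.fderiv]
  refine Filter.EventuallyEq.fderiv_eq ?_
  filter_upwards [hΘ.continuousAt.preimage_mem_nhds (e.open_source.mem_nhds hu)] with z hz
  simp [e.left_inv hz]

/-- The definition uses a chart that varies with the point. The chain rule for transition maps
allows one fixed chart near a point, as needed before differentiating. -/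
theorem formPullback_eq (α : CForm E X k) {e : OpenPartialHomeomorph X E} (he : e ∈ atlas E X)
    (hΘ : ContMDiffAt 𝓘(ℝ, V) 𝓘(ℝ, E) ∞ Θ u) (hu : Θ u ∈ e.source) :
    formPullback Θ α u = (α.inChart e (e (Θ u))).compContinuousLinearMap (fderiv ℝ (e ∘ Θ) u) := by
  rw [formPullback, α.valueAt_eq he hu,
    fderiv_chart_comp (chart_mem_atlas E (Θ u)) he hΘ (mem_chart_source E _) hu]
  rfl

theorem formPullback_eventuallyEq (α : CForm E X k) {e : OpenPartialHomeomorph X E}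
    (he : e ∈ atlas E X) (hΘ : ∀ᶠ z in 𝓝 u, ContMDiffAt 𝓘(ℝ, V) 𝓘(ℝ, E) ∞ Θ z)
    (hu : Θ u ∈ e.source) : formPullback Θ α =ᶠ[𝓝 u] fun z =>
      (α.inChart e ((e ∘ Θ) z)).compContinuousLinearMap (fderiv ℝ (e ∘ Θ) z) := by
  filter_upwards [hΘ, hΘ.self_of_nhds.continuousAt.preimage_mem_nhds (e.open_source.mem_nhds hu)]
    with z hz hz'
  exact formPullback_eq α he hz hz'

theorem contDiffAt_formPullback [FiniteDimensional ℂ E] [FiniteDimensional ℝ V] {α : CForm E X k}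
    (hα : α.IsSmooth) (hΘ : ∀ᶠ z in 𝓝 u, ContMDiffAt 𝓘(ℝ, V) 𝓘(ℝ, E) ∞ Θ z) :
    ContDiffAt ℝ ∞ (formPullback Θ α) u := by
  have : FiniteDimensional ℝ E := FiniteDimensional.complexToReal E
  set e := chartAt E (Θ u) with he'
  have he : e ∈ atlas E X := chart_mem_atlas E _
  have hu : Θ u ∈ e.source := mem_chart_source E _
  have h1 := contDiffAt_chart_comp he hΘ.self_of_nhds hu
  have h2 : ContDiffAt ℝ ∞ (α.inChart e) ((e ∘ Θ) u) :=
    (hα e he).contDiffAt (e.open_target.mem_nhds (e.map_source hu))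
  refine ContDiffAt.congr_of_eventuallyEq ?_ (formPullback_eventuallyEq α he hΘ hu)
  exact ContDiffAt.form_pullback (f := fun z => α.inChart e ((e ∘ Θ) z)) (h2.comp u h1)
    (h1.fderiv_right (by simp))

theorem extDeriv_formPullback_eq_zero {α : CForm E X k} (hα : α.IsSmooth)
    (hd : ∀ e ∈ atlas E X, ∀ y ∈ e.target, extDeriv (α.inChart e) y = 0)
    (hΘ : ∀ᶠ z in 𝓝 u, ContMDiffAt 𝓘(ℝ, V) 𝓘(ℝ, E) ∞ Θ z) :
    extDeriv (formPullback Θ α) u = 0 := by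
  set e := chartAt E (Θ u) with he'
  have he : e ∈ atlas E X := chart_mem_atlas E _
  have hu : Θ u ∈ e.source := mem_chart_source E _
  have h1 := contDiffAt_chart_comp he hΘ.self_of_nhds hu
  have h2 : DifferentiableAt ℝ (α.inChart e) ((e ∘ Θ) u) :=
    ((hα e he).contDiffAt (e.open_target.mem_nhds (e.map_source hu))).differentiableAt (by simp)
  rw [(formPullback_eventuallyEq α he hΘ hu).extDeriv_eq, extDeriv_pullback h2 h1
    (by rw [minSmoothness_of_isRCLikeNormedField]; exact two_le_infty),
    hd e he ((e ∘ Θ) u) (e.map_source hu)]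
  rfl

theorem formPullback_comp {V' : Type*} [NormedAddCommGroup V'] [NormedSpace ℝ V'] (α : CForm E X k)
    {σ : V' → V} {w : V'} (hσ : DifferentiableAt ℝ σ w)
    (hΘ : ContMDiffAt 𝓘(ℝ, V) 𝓘(ℝ, E) ∞ Θ (σ w)) :
    formPullback (Θ ∘ σ) α w =
      (formPullback Θ α (σ w)).compContinuousLinearMap (fderiv ℝ σ w) := by
  have h1 : DifferentiableAt ℝ (chartAt E (Θ (σ w)) ∘ Θ) (σ w) :=
    (contDiffAt_chart_comp (chart_mem_atlas E _) hΘ (mem_chart_source E _)).differentiableAt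
      (by simp)
  rw [formPullback, formPullback, Function.comp_apply, ← Function.comp_assoc,
    fderiv_comp w h1 hσ]
  rfl

end Pullback

end

end ComplexForms

/-! ### Vanishing of a decaying holomorphic 3-form by positivity. -/

namespace ComplexForms

open Complex Filter Topology Set MeasureTheory

noncomputable section

section Vanishing

variable {E : Type*} [NormedAddCommGroup E] [NormedSpace ℂ E] (b : Module.Basis (Fin 3) ℂ E)
  {X : Type*} [TopologicalSpace X] [ChartedSpace E X]

theorem exists_valueAt_eq_smul_volForm {α : CForm E X (3 + 0)} (hα : α.HasBidegree 3 0) (x : X) :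
    ∃ c : ℂ, (α.valueAt x : E [⋀^Fin 3]→L[ℝ] ℂ) = c • volForm b := by
  refine ⟨_, eq_smul_volForm b (α := α.valueAt x) fun ζ v => ?_⟩
  have := hα x ζ v
  rw [pow_zero, mul_one] at this
  exact this

variable [IsManifold 𝓘(ℂ, E) ω X]

/-- A holomorphic form of top degree is closed. -/
theorem extDeriv_inChart_eq_zero (b : Module.Basis (Fin 3) ℂ E) {α : CForm E X (3 + 0)} (hα : α ∈ closedForms E X 3 0)
    {e : OpenPartialHomeomorph X E} (he : e ∈ atlas E X) {y : E} (hy : y ∈ e.target) :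
    extDeriv (α.inChart e) y = 0 := by
  have heq : ∀ z ∈ e.target, α.inChart e z = α.inChart e z b • volForm b := by
    intro z hz
    refine eq_smul_volForm b (α := α.inChart e z) fun ζ v => ?_
    have := hα.1.2.inChart he hz ζ v
    rw [pow_zero, mul_one] at this
    exact this
  have hs : DifferentiableAt ℝ (α.inChart e) y :=
    ((hα.1.1 e he).contDiffAt (e.open_target.mem_nhds hy)).differentiableAt (by simp)
  have hd : dbarModel (α.inChart e) y = 0 := by
    rw [← CForm.dbar_inChart hα.1.1 he hy, hα.2]
    rfl
  refine extDeriv_eq_zero_of_dbarModel_eq_zero b (θ := α.inChart e)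
    (c := fun z => α.inChart e z b) ?_ ?_ hd
  · exact (ContinuousAlternatingMap.apply ℝ E ℂ (b : Fin 3 → E)).differentiableAt.comp y hs
  · filter_upwards [e.open_target.mem_nhds hy] with z hz
    exact heq z hz

variable {W : Type*} [NormedAddCommGroup W] [NormedSpace ℝ W] {F : W → X}

omit [IsManifold 𝓘(ℂ, E) ω X] in
theorem continuousAt_realDet {T : Type*} [TopologicalSpace T] {G : T → Fin 3 ⊕ Fin 3 → E} {t : T}
    (hG : ContinuousAt G t) : ContinuousAt (fun z => realDet b (G z)) t :=
  (continuous_realDet b).continuousAt.comp hG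

/-- The Jacobian determinant of `F` in the preferred chart at the image point. -/
def chartJacobian (F : W → X) (e : Fin 3 ⊕ Fin 3 → W) (w : W) : ℝ :=
  realDet b fun i => fderiv ℝ (chartAt E (F w) ∘ F) w (e i)

omit [IsManifold 𝓘(ℂ, E) ω X] in
theorem chartJacobian_ne_zero (e : Module.Basis (Fin 3 ⊕ Fin 3) ℝ W) {w : W}
    (hinj : Function.Injective (fderiv ℝ (chartAt E (F w) ∘ F) w)) :
    chartJacobian b F e w ≠ 0 := by
  refine realDet_ne_zero b ?_
  exact e.linearIndependent.map' (fderiv ℝ (chartAt E (F w) ∘ F) w : W →ₗ[ℝ] E)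
    (LinearMap.ker_eq_bot.2 hinj)

/-- Complex manifolds are oriented: the sign of the Jacobian is locally constant. -/
theorem eventually_chartJacobian_mul_pos (hF : ContMDiff 𝓘(ℝ, W) 𝓘(ℝ, E) ∞ F)
    (e : Fin 3 ⊕ Fin 3 → W) {w : W} (hw : chartJacobian b F e w ≠ 0) :
    ∀ᶠ z in 𝓝 w, 0 < chartJacobian b F e w * chartJacobian b F e z := by
  set c := chartAt E (F w) with hc
  have hcs : F w ∈ c.source := mem_chart_source E _
  have hca : c ∈ atlas E X := chart_mem_atlas E _
  have hcont : ContinuousAt (fun z => realDet b fun i => fderiv ℝ (c ∘ F) z (e i)) w := by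
    have h1 : ContinuousAt (fderiv ℝ (c ∘ F)) w :=
      ((contDiffAt_chart_comp hca (hF w) hcs).fderiv_right (m := 0) (by simp)).continuousAt
    have h2 : ContinuousAt (fun z i => fderiv ℝ (c ∘ F) z (e i)) w :=
      continuousAt_pi.2 fun i => h1.clm_apply continuousAt_const
    exact continuousAt_realDet b h2
  have hpos : 0 < chartJacobian b F e w * (realDet b fun i => fderiv ℝ (c ∘ F) w (e i)) :=
    mul_self_pos.2 hw
  filter_upwards [(continuousAt_const.mul hcont).eventually (lt_mem_nhds hpos),
    hF.continuous.continuousAt.preimage_mem_nhds (c.open_source.mem_nhds hcs)] with z hz hz'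
  -- Changing from the chart at F z to the fixed chart c multiplies the Jacobian by the nonnegative
  -- factor |det|², so continuity in c controls the sign.
  have h2 : (realDet b fun i => fderiv ℝ (c ∘ F) z (e i)) =
      normSq (LinearMap.det (fderiv ℂ (c ∘ (chartAt E (F z)).symm) (chartAt E (F z) (F z)) :
        E →ₗ[ℂ] E)) * chartJacobian b F e z := by
    rw [chartJacobian, ← realDet_comp,
      fderiv_chart_comp (chart_mem_atlas E (F z)) hca (hF z) (mem_chart_source E _) hz']
    rfl
  have hz2 : 0 < chartJacobian b F e w * (realDet b fun i => fderiv ℝ (c ∘ F) z (e i)) := hz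
  rw [h2, mul_left_comm] at hz2
  exact pos_of_mul_pos_right hz2 (normSq_nonneg _)

/-- The Jacobian never vanishes and its sign is locally constant, hence constant on the connected
space W. -/
theorem chartJacobian_mul_pos (hF : ContMDiff 𝓘(ℝ, W) 𝓘(ℝ, E) ∞ F)
    (e : Module.Basis (Fin 3 ⊕ Fin 3) ℝ W)
    (hinj : ∀ w, Function.Injective (fderiv ℝ (chartAt E (F w) ∘ F) w)) (w₀ w : W) :
    0 < chartJacobian b F e w₀ * chartJacobian b F e w := by
  have hne : ∀ w, chartJacobian b F e w ≠ 0 := fun w => chartJacobian_ne_zero b e (hinj w)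
  have hev := fun w => eventually_chartJacobian_mul_pos b hF e (hne w)
  have hclopen : IsClopen {w | 0 < chartJacobian b F e w₀ * chartJacobian b F e w} := by
    constructor
    · refine ⟨isOpen_iff_mem_nhds.2 fun w hw => ?_⟩
      have hw' : chartJacobian b F e w₀ * chartJacobian b F e w < 0 :=
        lt_of_le_of_ne (not_lt.1 hw) (mul_ne_zero (hne w₀) (hne w))
      filter_upwards [hev w] with z hz hz'
      nlinarith [mul_pos (neg_pos.2 hw') hz', mul_pos hz (mul_self_pos.2 (hne w₀))]
    · refine isOpen_iff_mem_nhds.2 fun w hw => ?_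
      filter_upwards [hev w] with z hz
      have h1 := mul_pos (show 0 < chartJacobian b F e w₀ * chartJacobian b F e w from hw) hz
      have h2 : 0 < (chartJacobian b F e w * chartJacobian b F e w) *
          (chartJacobian b F e w₀ * chartJacobian b F e z) := by linarith
      exact pos_of_mul_pos_right h2 (mul_self_nonneg _)
  have h := hclopen.eq_univ ⟨w₀, mul_self_pos.2 (hne w₀)⟩
  exact h.ge (mem_univ w)

omit [IsManifold 𝓘(ℂ, E) ω X] in
-- With α = c dz₁∧dz₂∧dz₃ at the image point, the factors c and its conjugate give |c|², and
-- `sum_sign_volForm` gives the rest.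
theorem pairing_formPullback {α : CForm E X 3} {w : W} {c : ℂ}
    (hc : α.valueAt (F w) = c • volForm b) (e : Fin 3 ⊕ Fin 3 → W) :
    pairing (fun i j k w => formPullback F α w ![e i, e j, e k]) w =
      normSq c * (288 * I * chartJacobian b F e w) := by
  rw [chartJacobian, ← sum_sign_volForm, Finset.mul_sum, pairing]
  have key : ∀ v : Fin 3 → W, formPullback F α w ![v 0, v 1, v 2] =
      c * volForm b fun j => fderiv ℝ (chartAt E (F w) ∘ F) w (v j) := by
    intro v
    have : (![v 0, v 1, v 2] : Fin 3 → W) = v := by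
      ext i; fin_cases i <;> rfl
    rw [this, formPullback, hc]
    rfl
  refine Finset.sum_congr rfl fun s _ => ?_
  rw [key fun j => e (s (Sum.inl j)), key fun j => e (s (Sum.inr j)), map_mul, ← mul_conj]
  ring

/-- A holomorphic `3`-form whose pullback by a local diffeomorphism from a six-dimensional vector
space decays like the pullback by stereographic projection vanishes on the image. -/
theorem valueAt_eq_zero_of_formPullback_bound (b : Module.Basis (Fin 3) ℂ E) [FiniteDimensional ℝ W]
    (hW : Module.finrank ℝ W = 6) (hF : ContMDiff 𝓘(ℝ, W) 𝓘(ℝ, E) ∞ F)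
    (hinj : ∀ w, Function.Injective (fderiv ℝ (chartAt E (F w) ∘ F) w))
    {α : CForm E X 3} (hα : α ∈ closedForms E X 3 0) {C : ℝ} (hC0 : 0 ≤ C)
    (hC : ∀ w v, ‖formPullback F α w v‖ ≤ C * (16 / (‖w‖ ^ 2 + 4)) ^ 3 * ∏ i, ‖v i‖) (w : W) :
    α.valueAt (F w) = 0 := by
  have : FiniteDimensional ℂ E := b.finiteDimensional_of_finite
  let e : Module.Basis (Fin 3 ⊕ Fin 3) ℝ W :=
    (Module.finBasisOfFinrankEq ℝ W hW).reindex (finSumFinEquiv (m := 3) (n := 3)).symm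
  have hΘ : ∀ w, ∀ᶠ z in 𝓝 w, ContMDiffAt 𝓘(ℝ, W) 𝓘(ℝ, E) ∞ F z := fun w =>
    Eventually.of_forall fun z => hF z
  have ha : ContDiff ℝ ∞ (formPullback F α) :=
    contDiff_iff_contDiffAt.2 fun w => contDiffAt_formPullback hα.1.1 (hΘ w)
  have hd : ∀ w, extDeriv (formPullback F α) w = 0 := fun w =>
    extDeriv_formPullback_eq_zero hα.1.1 (fun e he y hy => extDeriv_inChart_eq_zero b hα he hy)
      (hΘ w)
  -- The constant -I J(w), with J the Jacobian, cancels the phase I and the unknown orientation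
  -- sign, since J(w) J(z) > 0.
  have hre : ∀ (z : W) (c : ℂ), α.valueAt (F z) = c • volForm b →
      (-I * chartJacobian b F e w *
        pairing (fun i j k w => formPullback F α w ![e i, e j, e k]) z).re =
      288 * normSq c * (chartJacobian b F e w * chartJacobian b F e z) := by
    intro z c hc
    rw [pairing_formPullback b hc]
    have : -I * (chartJacobian b F e w : ℂ) *
        (normSq c * (288 * I * chartJacobian b F e z)) =
        ((288 * normSq c * (chartJacobian b F e w * chartJacobian b F e z) : ℝ) : ℂ) := by
      push_cast
      linear_combination (-288 * normSq c * chartJacobian b F e w * chartJacobian b F e z : ℂ) *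
        I_mul_I
    rw [this, ofReal_re]
  obtain ⟨c, hc⟩ := exists_valueAt_eq_smul_volForm b hα.1.2 (F w)
  have h0 := re_mul_pairing_eq_zero_of_closed hW ha hd hC hC0 e (-I * chartJacobian b F e w)
    (fun z => by
      obtain ⟨c, hc⟩ := exists_valueAt_eq_smul_volForm b hα.1.2 (F z)
      rw [hre z c hc]
      exact mul_nonneg (mul_nonneg (by norm_num) (normSq_nonneg _))
        (chartJacobian_mul_pos b hF e hinj w z).le) w
  rw [hre w c hc] at h0
  have hpos := chartJacobian_mul_pos b hF e hinj w w
  have hc0 : c = 0 := by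
    rcases mul_eq_zero.1 h0 with h | h
    · exact normSq_eq_zero.1 (by linarith)
    · exact absurd h hpos.ne'
  refine hc.trans ?_
  rw [hc0]
  ext v
  change (0 : ℂ) * _ = 0
  rw [zero_mul]

end Vanishing

end

end ComplexForms

/-! ### Stereographic projection and holomorphic 3-forms on the six-sphere. -/

namespace ComplexForms

open Complex Filter Topology Set MeasureTheory

noncomputable section

section InverseStereographic

variable {W H : Type*} [NormedAddCommGroup W] [InnerProductSpace ℝ W]
  [NormedAddCommGroup H] [InnerProductSpace ℝ H]

/-- Inverse stereographic projection from the unit vector `v`, with an isometric embedding `i` of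
the source onto the orthogonal complement of `v`. -/
def inverseStereo (i : W →ₗᵢ[ℝ] H) (v : H) (w : W) : H :=
  v + (‖w‖ ^ 2 + 4)⁻¹ • ((4 : ℝ) • i w - (8 : ℝ) • v)

theorem contDiff_inverseStereo (i : W →ₗᵢ[ℝ] H) (v : H) : ContDiff ℝ ∞ (inverseStereo i v) := by
  have h1 : ContDiff ℝ ∞ fun w : W => (‖w‖ ^ 2 + 4)⁻¹ :=
    ((contDiff_norm_sq ℝ).add contDiff_const).inv fun w => by positivity
  exact contDiff_const.add (h1.smul
    ((i.toContinuousLinearMap.contDiff.const_smul (4 : ℝ)).sub contDiff_const))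

/-- A crude form of the conformal factor 4/(‖w‖²+4); only the quadratic decay matters. With r =
1/(‖w‖²+4), the constant is 4 + 8·1 + 16·(1/4) = 16, from ‖w‖² r ≤ 1 and ‖w‖ r ≤ 1/4. -/
theorem norm_fderiv_inverseStereo_le (i : W →ₗᵢ[ℝ] H) {v : H} (hv : ‖v‖ = 1) (w : W) :
    ‖fderiv ℝ (inverseStereo i v) w‖ ≤ 16 / (‖w‖ ^ 2 + 4) := by
  set r := (‖w‖ ^ 2 + 4)⁻¹ with hr
  have hr0 : 0 < r := by positivity
  have hrw : ‖w‖ ^ 2 * r ≤ 1 := by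
    rw [hr, ← div_eq_mul_inv, div_le_one (by positivity)]
    linarith
  have hrw' : ‖w‖ * r ≤ 1 / 4 := by
    rw [hr, ← div_eq_mul_inv, div_le_iff₀ (by positivity)]
    nlinarith [sq_nonneg (‖w‖ - 2)]
  have h1 : HasFDerivAt (fun w : W => (‖w‖ ^ 2 + 4)⁻¹) (-(2 * r ^ 2) • innerSL ℝ w) w := by
    have h2 : HasFDerivAt (fun w : W => ‖w‖ ^ 2 + 4) (2 • innerSL ℝ w) w :=
      (hasStrictFDerivAt_norm_sq w).hasFDerivAt.add_const 4
    have h3 := (hasDerivAt_inv (show ‖w‖ ^ 2 + 4 ≠ 0 by positivity)).comp_hasFDerivAt w h2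
    refine h3.congr_fderiv ?_
    ext x
    simp [hr]
    ring
  have h2 : HasFDerivAt (fun w : W => (4 : ℝ) • i w - (8 : ℝ) • v)
      ((4 : ℝ) • i.toContinuousLinearMap) w :=
    (i.toContinuousLinearMap.hasFDerivAt.const_smul (4 : ℝ)).sub_const _
  have h3 := (h1.smul h2).const_add v
  have h4 : fderiv ℝ (inverseStereo i v) w = r • (4 : ℝ) • i.toContinuousLinearMap +
      (-(2 * r ^ 2) • innerSL ℝ w).smulRight ((4 : ℝ) • i w - (8 : ℝ) • v) := h3.fderiv
  rw [h4, div_eq_mul_inv, ← hr]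
  refine ContinuousLinearMap.opNorm_le_bound _ (by positivity) fun x => ?_
  have h5 : |inner ℝ w x| ≤ ‖w‖ * ‖x‖ := abs_real_inner_le_norm w x
  simp only [add_apply, smul_apply, ContinuousLinearMap.smulRight_apply, innerSL_apply_apply,
    LinearIsometry.coe_toContinuousLinearMap, smul_eq_mul]
  have h6 : ‖(4 : ℝ) • i w - (8 : ℝ) • v‖ ≤ 4 * ‖w‖ + 8 := by
    refine (norm_sub_le _ _).trans ?_
    rw [norm_smul, norm_smul, hv, i.norm_map]
    norm_num
  calc ‖r • (4 : ℝ) • i x + (-(2 * r ^ 2) * inner ℝ w x) • ((4 : ℝ) • i w - (8 : ℝ) • v)‖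
      ≤ r * (4 * ‖x‖) + (2 * r ^ 2 * (‖w‖ * ‖x‖)) * (4 * ‖w‖ + 8) := by
        refine (norm_add_le _ _).trans (add_le_add ?_ ?_)
        · rw [norm_smul, norm_smul, i.norm_map, Real.norm_of_nonneg hr0.le]
          norm_num
        · rw [norm_smul, norm_mul, norm_neg, Real.norm_of_nonneg (by positivity)]
          exact mul_le_mul (mul_le_mul_of_nonneg_left h5 (by positivity)) h6 (norm_nonneg _)
            (by positivity)
    _ = r * ‖x‖ * (4 + 8 * (‖w‖ ^ 2 * r) + 16 * (‖w‖ * r)) := by ring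
    _ ≤ r * ‖x‖ * 16 := by
        refine mul_le_mul_of_nonneg_left ?_ (by positivity)
        linarith
    _ = 16 * r * ‖x‖ := by ring

open Module in
theorem exists_stereographic'_symm_eq {n : ℕ} [Fact (finrank ℝ H = n + 1)]
    (v : Metric.sphere (0 : H) 1) : ∃ i : EuclideanSpace ℝ (Fin n) →ₗᵢ[ℝ] H,
      ∀ w, ((stereographic' n v).symm w : H) = inverseStereo i v w := by
  let U : (Submodule.span ℝ {(v : H)})ᗮ ≃ₗᵢ[ℝ] EuclideanSpace ℝ (Fin n) :=
    (OrthonormalBasis.fromOrthogonalSpanSingleton n (ne_zero_of_mem_unit_sphere v)).repr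
  refine ⟨(Submodule.span ℝ {(v : H)})ᗮ.subtypeₗᵢ.comp U.symm.toLinearIsometry, fun w => ?_⟩
  have h : ‖((U.symm w : (Submodule.span ℝ {(v : H)})ᗮ) : H)‖ = ‖w‖ := U.symm.norm_map w
  have h1 := stereographic'_symm_apply v w
  dsimp only at h1
  change _ = (‖((U.symm w : (Submodule.span ℝ {(v : H)})ᗮ) : H)‖ ^ 2 + 4)⁻¹ •
    (4 : ℝ) • ((U.symm w : (Submodule.span ℝ {(v : H)})ᗮ) : H) +
    (‖((U.symm w : (Submodule.span ℝ {(v : H)})ᗮ) : H)‖ ^ 2 + 4)⁻¹ •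
      (‖((U.symm w : (Submodule.span ℝ {(v : H)})ᗮ) : H)‖ ^ 2 - 4) • (v : H) at h1
  rw [h] at h1
  rw [h1]
  change _ = (v : H) + (‖w‖ ^ 2 + 4)⁻¹ • ((4 : ℝ) •
    ((U.symm w : (Submodule.span ℝ {(v : H)})ᗮ) : H) - (8 : ℝ) • (v : H))
  have h2 : (‖w‖ ^ 2 + 4)⁻¹ * (‖w‖ ^ 2 - 4) = 1 - (‖w‖ ^ 2 + 4)⁻¹ * 8 := by
    have : ‖w‖ ^ 2 + 4 ≠ 0 := by positivity
    field_simp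
    ring
  rw [smul_smul (‖w‖ ^ 2 + 4)⁻¹ (‖w‖ ^ 2 - 4), h2]
  module

end InverseStereographic

section Sphere

open Module

variable {E : Type*} [NormedAddCommGroup E] [NormedSpace ℂ E]
  {X : Type*} [TopologicalSpace X] [ChartedSpace E X]
  {H : Type*} [NormedAddCommGroup H] [InnerProductSpace ℝ H] [Fact (finrank ℝ H = 6 + 1)]
  (Φ : X ≃ₘ⟮𝓘(ℝ, E), 𝓡 6⟯ (Metric.sphere (0 : H) 1))

open Classical in
/-- The extension of the inverse of a diffeomorphism onto the unit sphere which is constant along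
rays; the value at the origin is irrelevant. -/
def radialExtension (p : Metric.sphere (0 : H) 1) (x : H) : X :=
  Φ.symm (if h : x = 0 then p else ⟨‖x‖⁻¹ • x, by
    rw [mem_sphere_zero_iff_norm, norm_smul, norm_inv, norm_norm,
      inv_mul_cancel₀ (norm_ne_zero_iff.2 h)]⟩)

theorem radialExtension_coe (p y : Metric.sphere (0 : H) 1) :
    radialExtension Φ p (y : H) = Φ.symm y := by
  have hy : ‖(y : H)‖ = 1 := norm_eq_of_mem_sphere y
  have h0 : (y : H) ≠ 0 := ne_zero_of_mem_unit_sphere y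
  rw [radialExtension, dif_neg h0]
  congr 1
  ext1
  change ‖(y : H)‖⁻¹ • (y : H) = y
  rw [hy, inv_one, one_smul]

/-- Extending along rays replaces the sphere by an open subset of a vector space. The pullback by
stereographic coordinates then factors through a smooth map of vector spaces, with an ordinary
derivative to estimate. -/
theorem contMDiffAt_radialExtension (p : Metric.sphere (0 : H) 1) {x : H} (hx : x ≠ 0) :
    ContMDiffAt 𝓘(ℝ, H) 𝓘(ℝ, E) ∞ (radialExtension Φ p) x := by
  refine Φ.symm.contMDiff.contMDiffAt.comp x ?_
  let U : TopologicalSpace.Opens H := ⟨{0}ᶜ, isOpen_compl_singleton⟩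
  have hmem : ∀ y : U, ‖(y : H)‖⁻¹ • (y : H) ∈ Metric.sphere (0 : H) 1 := fun y => by
    rw [mem_sphere_zero_iff_norm, norm_smul, norm_inv, norm_norm,
      inv_mul_cancel₀ (norm_ne_zero_iff.2 y.2)]
  have h1 : ContMDiff 𝓘(ℝ, H) 𝓘(ℝ, H) ∞ fun y : U => ‖(y : H)‖⁻¹ • (y : H) := by
    intro y
    refine (contMDiffAt_subtype_iff (f := fun y : H => ‖y‖⁻¹ • y)).2 ?_
    refine ContDiffAt.contMDiffAt ?_
    exact ((contDiffAt_norm ℝ y.2).inv (norm_ne_zero_iff.2 y.2)).smul contDiffAt_id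
  have h2 := (h1.codRestrict_sphere (n := 6) hmem) ⟨x, hx⟩
  refine (contMDiffAt_subtype_iff (x := (⟨x, hx⟩ : U))).1 (h2.congr_of_eventuallyEq ?_)
  refine Eventually.of_forall fun y => ?_
  exact dif_neg (show (y : H) ≠ 0 from y.2)

variable [IsManifold 𝓘(ℂ, E) ω X]

/-- Compactness of the sphere. All decay on ℝ⁶ then comes from the derivative of the inverse
projection. -/
theorem exists_norm_formPullback_radialExtension_le [FiniteDimensional ℂ E] {α : CForm E X 3}
    (hα : α.IsSmooth) (p : Metric.sphere (0 : H) 1) :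
    ∃ C, ∀ x : Metric.sphere (0 : H) 1, ‖formPullback (radialExtension Φ p) α (x : H)‖ ≤ C := by
  have : FiniteDimensional ℝ H := .of_fact_finrank_eq_succ 6
  have hc : ContinuousOn (formPullback (radialExtension Φ p) α) (Metric.sphere 0 1) := by
    intro x hx
    have hx0 : x ≠ 0 := ne_zero_of_mem_unit_sphere ⟨x, hx⟩
    refine (contDiffAt_formPullback hα ?_).continuousAt.continuousWithinAt
    filter_upwards [isOpen_compl_singleton.mem_nhds hx0] with z hz
    exact contMDiffAt_radialExtension Φ p hz
  obtain ⟨C, hC⟩ := (isCompact_sphere (0 : H) 1).exists_bound_of_continuousOn hc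
  exact ⟨C, fun x => hC x x.2⟩

omit [IsManifold 𝓘(ℂ, E) ω X] in
theorem contMDiff_symm_comp_stereographic'_symm (v : Metric.sphere (0 : H) 1) :
    ContMDiff (𝓡 6) 𝓘(ℝ, E) ∞ (Φ.symm ∘ (stereographic' 6 v).symm) := by
  refine Φ.symm.contMDiff.comp fun w => ?_
  exact contMDiffAt_symm_of_mem_maximalAtlas (I := 𝓡 6)
    (IsManifold.subset_maximalAtlas ⟨v, rfl⟩) (by simp)

/-- In coordinates, Φ followed by stereographic projection is a differentiable left inverse. -/
theorem injective_fderiv_chart_comp_stereographic'_symm (v : Metric.sphere (0 : H) 1)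
    (w : EuclideanSpace ℝ (Fin 6)) :
    Function.Injective (fderiv ℝ (chartAt E ((Φ.symm ∘ (stereographic' 6 v).symm) w) ∘
      (Φ.symm ∘ (stereographic' 6 v).symm)) w) := by
  have := isManifold_real (E := E) (X := X)
  set s := stereographic' 6 v with hs
  set F : EuclideanSpace ℝ (Fin 6) → X := Φ.symm ∘ s.symm with hFdef
  have hF : ContMDiff (𝓡 6) 𝓘(ℝ, E) ∞ F := contMDiff_symm_comp_stereographic'_symm Φ v
  set c := chartAt E (F w) with hc
  have hcs : F w ∈ c.source := mem_chart_source E _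
  have hca : c ∈ atlas E X := chart_mem_atlas E _
  have h1 : DifferentiableAt ℝ (c ∘ F) w :=
    (contDiffAt_chart_comp hca (hF w) hcs).differentiableAt (by simp)
  have ht : ∀ w, s.symm w ∈ s.source := fun w => s.map_target (by simp [hs])
  have h2 : DifferentiableAt ℝ (s ∘ Φ ∘ c.symm) (c (F w)) := by
    have a1 : ContMDiffAt 𝓘(ℝ, E) 𝓘(ℝ, E) ∞ c.symm (c (F w)) :=
      contMDiffAt_symm_of_mem_maximalAtlas (IsManifold.subset_maximalAtlas hca) (c.map_source hcs)
    have a2 : ContMDiffAt 𝓘(ℝ, E) (𝓡 6) ∞ (Φ ∘ c.symm) (c (F w)) :=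
      Φ.contMDiff.contMDiffAt.comp _ a1
    have a3 : (Φ ∘ c.symm) (c (F w)) = s.symm w := by
      change Φ (c.symm (c (F w))) = _
      rw [c.left_inv hcs]
      exact Φ.apply_symm_apply _
    have a4 : ContMDiffAt (𝓡 6) (𝓡 6) ∞ s ((Φ ∘ c.symm) (c (F w))) :=
      contMDiffAt_of_mem_maximalAtlas (IsManifold.subset_maximalAtlas ⟨v, rfl⟩) (by
        rw [a3]
        exact ht w)
    exact (contMDiffAt_iff_contDiffAt.1 (a4.comp _ a2)).differentiableAt (by simp)
  have h3 : (s ∘ Φ ∘ c.symm) ∘ (c ∘ F) =ᶠ[𝓝 w] id := by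
    filter_upwards [hF.continuous.continuousAt.preimage_mem_nhds (c.open_source.mem_nhds hcs)]
      with z hz
    have : s (Φ (c.symm (c (F z)))) = z := by
      rw [c.left_inv hz]
      change s (Φ (Φ.symm (s.symm z))) = z
      rw [Φ.apply_symm_apply, s.right_inv (by simp [hs])]
    exact this
  have h4 := (h2.hasFDerivAt.comp w (f := c ∘ F) h1.hasFDerivAt).fderiv
  rw [h3.fderiv_eq, fderiv_id] at h4
  refine Function.LeftInverse.injective
    (g := fderiv ℝ (s ∘ Φ ∘ c.symm) (c (F w))) fun x => ?_
  exact (congrArg (fun L : EuclideanSpace ℝ (Fin 6) →L[ℝ] EuclideanSpace ℝ (Fin 6) => L x) h4).symm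

/-- There are no nonzero holomorphic `3`-forms on a complex manifold diffeomorphic to the
six-sphere. -/
theorem eq_zero_of_mem_closedForms
    (Φ : X ≃ₘ⟮𝓘(ℝ, E), 𝓡 6⟯ (Metric.sphere (0 : H) 1)) (b : Module.Basis (Fin 3) ℂ E)
    {α : CForm E X (3 + 0)}
    (hα : α ∈ closedForms E X 3 0) : α = 0 := by
  have : FiniteDimensional ℂ E := b.finiteDimensional_of_finite
  funext x
  change (α.valueAt x : E [⋀^Fin 3]→L[ℝ] ℂ) = 0
  -- The pole is antipodal to Φ x, so x lies in the image of F.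
  set v : Metric.sphere (0 : H) 1 := -Φ x with hv
  obtain ⟨i, hi⟩ := exists_stereographic'_symm_eq (n := 6) v
  have hv1 : ‖(v : H)‖ = 1 := norm_eq_of_mem_sphere v
  set F : EuclideanSpace ℝ (Fin 6) → X := Φ.symm ∘ (stereographic' 6 v).symm with hFdef
  have hFx : F (stereographic' 6 v (Φ x)) = x := by
    rw [hFdef, Function.comp_apply, (stereographic' 6 v).left_inv, Φ.symm_apply_apply]
    rw [stereographic'_source, hv, mem_compl_singleton_iff]
    exact ne_neg_of_mem_unit_sphere ℝ _
  have hFcomp : F = radialExtension Φ v ∘ inverseStereo i (v : H) := by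
    funext w
    rw [Function.comp_apply, ← hi, radialExtension_coe]
    rfl
  obtain ⟨C, hC⟩ := exists_norm_formPullback_radialExtension_le Φ (α := α) hα.1.1 v
  have hC0 : 0 ≤ C := (norm_nonneg _).trans (hC v)
  -- A 3-form takes three vectors, each contracted by 16/(‖w‖²+4); hence the cube.
  have hbound : ∀ w u, ‖formPullback F (k := 3) α w u‖ ≤
      C * (16 / (‖w‖ ^ 2 + 4)) ^ 3 * ∏ j, ‖u j‖ := by
    intro w u
    have hσ : inverseStereo i (v : H) w ≠ 0 := by
      rw [← hi]
      exact ne_zero_of_mem_unit_sphere _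
    rw [hFcomp, formPullback_comp (k := 3) α
      ((contDiff_inverseStereo i (v : H)).differentiable (by simp) w)
      (contMDiffAt_radialExtension Φ v hσ)]
    have h1 : ‖formPullback (radialExtension Φ v) (k := 3) α (inverseStereo i (v : H) w)‖ ≤ C := by
      rw [← hi]
      exact hC _
    change ‖formPullback (radialExtension Φ v) (k := 3) α (inverseStereo i (v : H) w)
      (fun j => fderiv ℝ (inverseStereo i (v : H)) w (u j))‖ ≤ _
    refine (ContinuousAlternatingMap.le_opNorm _ _).trans ?_
    rw [mul_assoc]
    refine mul_le_mul h1 ?_ (by positivity) hC0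
    have h2 : ∀ j, ‖fderiv ℝ (inverseStereo i (v : H)) w (u j)‖ ≤ 16 / (‖w‖ ^ 2 + 4) * ‖u j‖ :=
      fun j => (ContinuousLinearMap.le_opNorm _ _).trans
        (mul_le_mul_of_nonneg_right (norm_fderiv_inverseStereo_le i hv1 w) (norm_nonneg _))
    refine (Finset.prod_le_prod (fun _ _ => norm_nonneg _) fun j _ => h2 j).trans_eq ?_
    rw [Finset.prod_mul_distrib, Finset.prod_const, Finset.card_univ, Fintype.card_fin]
  have h := valueAt_eq_zero_of_formPullback_bound b (W := EuclideanSpace ℝ (Fin 6)) (by simp)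
    (contMDiff_symm_comp_stereographic'_symm Φ v)
    (injective_fderiv_chart_comp_stereographic'_symm Φ v) (α := α) hα hC0 hbound
    (stereographic' 6 v (Φ x))
  rw [← hFdef, hFx] at h
  exact h

end Sphere

end

end ComplexForms

/-! ### From forms to holomorphic sections and Hodge numbers. -/

namespace ComplexForms

open Complex Filter Topology Set MeasureTheory

noncomputable section

section Holomorphic

variable {E : Type*} [NormedAddCommGroup E] [NormedSpace ℂ E]
  {X : Type*} [TopologicalSpace X] [ChartedSpace E X]

theorem hodgeNumber_eq_zero {p q : ℕ} (h : closedForms E X p q ≤ exactForms E X p q) :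
    hodgeNumber E X p q = 0 := by
  have : Subsingleton (DolbeaultCohomology E X p q) :=
    Submodule.Quotient.subsingleton_iff.2 (Submodule.submoduleOf_eq_top.2 h)
  exact rank_subsingleton' ℂ _

/-- The underlying complex-valued form of a holomorphic form. -/
def realForm {p : ℕ} (α : ∀ x : X, TangentSpace 𝓘(ℂ, E) x [⋀^Fin p]→L[ℂ] ℂ) : CForm E X p :=
  fun x => (α x).restrictScalars ℝ

variable [IsManifold 𝓘(ℂ, E) ω X]

/-- Viewed as a complex-valued form, a holomorphic 3-form has bidegree (3,0) and holomorphic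
coefficients, so it is ∂̄-closed and the hypothesis on closed forms applies. -/
theorem eq_zero_of_isHolomorphicForm [FiniteDimensional ℂ E] (b : Module.Basis (Fin 3) ℂ E)
    (hA : ∀ ψ ∈ closedForms E X 3 0, ψ = 0)
    {α : ∀ x : X, TangentSpace 𝓘(ℂ, E) x [⋀^Fin 3]→L[ℂ] ℂ} (hα : IsHolomorphicForm α) : α = 0 := by
  have hhol : ∀ e ∈ atlas E X,
      ContDiffOn ℂ ω (fun z => (realForm α).inChart e z b) e.target := fun e he =>
    (ContinuousAlternatingMap.apply ℂ E ℂ (b : Fin 3 → E)).contDiff.comp_contDiffOn (hα e he)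
  have hmem : (realForm α : CForm E X (3 + 0)) ∈ closedForms E X 3 0 := by
    refine mem_closedForms_of_antilinearPart_eq_zero b (fun x ζ v => ?_)
      (fun e he => ((hhol e he).restrict_scalars ℝ).of_le le_top) fun e he z hz => ?_
    · have h := (α x).toMultilinearMap.map_smul_univ (fun _ => ζ) v
      rw [pow_zero, mul_one]
      refine h.trans ?_
      rw [Finset.prod_const, Finset.card_univ, Fintype.card_fin]
      rfl
    · refine antilinearPart_eq_zero fun v => ?_
      have hd : DifferentiableAt ℂ (fun z => (realForm α).inChart e z b) z :=
        ((hhol e he).contDiffAt (e.open_target.mem_nhds hz)).differentiableAt (by simp)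
      have h := (hd.hasFDerivAt.restrictScalars ℝ).fderiv
      have h' : ∀ v, fderiv ℝ (fun z => (realForm α).inChart e z b) z v =
          fderiv ℂ (fun z => (realForm α).inChart e z b) z v := fun v =>
        congrArg (fun L : E →L[ℝ] ℂ => L v) h
      refine (h' _).trans ?_
      rw [map_smul]
      exact congrArg (I • ·) (h' v).symm
  have h0 := hA _ hmem
  funext x
  ext v
  exact congrArg (fun ψ : CForm E X 3 => ψ.valueAt x v) h0

end Holomorphic

end

end ComplexForms

theorem mainTheorem2
    {E : Type*} [NormedAddCommGroup E] [NormedSpace ℂ E] (hE : Module.finrank ℂ E = 3)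
    {X : Type*} [TopologicalSpace X] [ChartedSpace E X] [IsManifold 𝓘(ℂ, E) ω X]
    (Φ : X ≃ₘ⟮𝓘(ℝ, E), 𝓡 6⟯ (Metric.sphere (0 : EuclideanSpace ℝ (Fin 7)) 1)) :
    (∀ α : ∀ x : X, TangentSpace 𝓘(ℂ, E) x [⋀^Fin 3]→L[ℂ] ℂ,
        ComplexForms.IsHolomorphicForm α → α = 0) ∧
      ComplexForms.hodgeNumber E X 3 0 = 0 ∧
      ComplexForms.hodgeNumber E X 0 3 = 0 := by
  have hfin : FiniteDimensional ℂ E := Module.finite_of_finrank_pos (by rw [hE]; norm_num)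
  have hfact : Fact (Module.finrank ℝ (EuclideanSpace ℝ (Fin 7)) = 6 + 1) :=
    ⟨finrank_euclideanSpace_fin⟩
  let b : Module.Basis (Fin 3) ℂ E := Module.finBasisOfFinrankEq ℂ E hE
  -- Compactness and the Hausdorff property are transported from the sphere.
  have : CompactSpace X := Φ.toHomeomorph.symm.compactSpace
  have : T2Space X := Φ.toHomeomorph.symm.t2Space
  have hA : ∀ ψ ∈ ComplexForms.closedForms E X 3 0, ψ = 0 := fun ψ hψ =>
    ComplexForms.eq_zero_of_mem_closedForms Φ b hψ
  refine ⟨fun α hα => ComplexForms.eq_zero_of_isHolomorphicForm b hA hα, ?_, ?_⟩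
  · refine ComplexForms.hodgeNumber_eq_zero fun ψ hψ => ?_
    rw [hA ψ hψ]
    exact zero_mem _
  · exact ComplexForms.hodgeNumber_eq_zero fun ψ hψ =>
      ComplexForms.smoothForms_le_exactForms b hA hψ.1
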